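/- Let $\Bbbk$ be a field with $\operatorname{char}\Bbbk\neq 2$. A superalgebra is a $\mathbb Z/2$-graded unital associative $\Bbbk$-algebra $A=A_{\bar 0}\oplus A_{\bar 1}$; it is supercommutative if $A_{\bar 0}$ is central and $x^2=0$ for all $x\in A_{\bar 1}$, and all superalgebras below are supercommutative (the zero algebra is allowed). Morphisms are unital $\Bbbk$-algebra maps preserving the grading. Let $\mathsf{SAlgf}_\Bbbk$ be the category of finite-dimensional superalgebras. A formal super $\Bbbk$-functor is a functor $\mathsf{SAlgf}_\Bbbk\to\mathsf{Sets}$; morphisms are natural transformations. For $A\in\mathsf{SAlgf}_\Bbbk$ put $\mathrm{SSpf}\,A=\operatorname{Hom}_{\mathsf{SAlgf}_\Bbbk}(A,-)$. A formal $\Bbbk$-superscheme is a formal super $\Bbbk$-functor isomorphic to $\varinjlim_\lambda \mathrm{SSpf}\,A_\lambda$ for some inductive system indexed by a (nonempty) directed set, with $A_\lambda\in\mathsf{SAlgf}_\Bbbk$ and with every transition morphism $\mathrm{SSpf}\,A_\lambda\to\mathrm{SSpf}\,A_\mu$ ($\lambda\le\mu$) given by a surjection $A_\mu\to A_\lambda$;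 formal $\Bbbk$-superschemes form a full subcategory of the category of formal super $\Bbbk$-functors. A profinite $\Bbbk$-superalgebra is a topological superalgebra $A$ that is, algebraically and topologically, the inverse limit of its discrete finite-dimensional quotients $A/I$ by open superideals $I$; $\mathsf{PSAlg}_\Bbbk$ is the category of these with continuous morphisms of superalgebras. For $A\in\mathsf{PSAlg}_\Bbbk$ let $\mathrm{PSSpf}\,A$ send $B\in\mathsf{SAlgf}_\Bbbk$ to the set of continuous superalgebra morphisms $A\to B$, with $B$ discrete. Let $\mathsf{SCoalg}_\Bbbk$ be the category of super-cocommutative coassociative counital super-coalgebras $\mathbf A$: $\mathbb Z/2$-graded coalgebras whose coproduct $\Delta$ and counit $\epsilon$ preserve the grading, with $\Delta=c\circ\Delta$ for $c(v\otimes w)=(-1)^{|v||w|}w\otimes v$; morphisms are grading-preserving coalgebra maps. For $R\in\mathsf{SAlgf}_\Bbbk$, $R\otimes\mathbf A$ is an $R$-super-coalgebra by $R$-linear extension of $\Delta$ and $\epsilon$, where $(R\otimes\mathbf A)\otimes_R(R\otimes\mathbf A)$ is formed with the right action $x\cdot r=(-1)^{|x||r|}r\cdot x$. Put $$\mathrm{Sp}^*\mathbf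 A(R)=\{u\in(R\otimes\mathbf A)_{\bar 0}\mid \Delta(u)=u\otimes_R u,\ \epsilon(u)=1\},$$ where $R\to S$ and $\mathbf A\to\mathbf B$ act through $R\otimes\mathbf A\to S\otimes\mathbf A$ and $R\otimes\mathbf A\to R\otimes\mathbf B$. For $A\in\mathsf{SAlgf}_\Bbbk$, the dual $A^*$ is a super-coalgebra with counit $f\mapsto f(1)$ and coproduct dual to the product of $A$ under the pairing $\langle f\otimes g,a\otimes b\rangle=(-1)^{|g||a|}f(a)g(b)$. Theorem. (i) For every profinite $\Bbbk$-superalgebra $A$, $\mathrm{PSSpf}\,A$ is a formal $\Bbbk$-superscheme, and $A\mapsto\mathrm{PSSpf}\,A$ is an anti-equivalence from $\mathsf{PSAlg}_\Bbbk$ to the category of formal $\Bbbk$-superschemes. (ii) For every $A\in\mathsf{SAlgf}_\Bbbk$, the functors $\mathrm{SSpf}\,A$ and $\mathrm{Sp}^*A^*$ are isomorphic. (iii) $\mathbf A\mapsto\mathrm{Sp}^*\mathbf A$ is a covariant functor from $\mathsf{SCoalg}_\Bbbk$ to the category of formal super $\Bbbk$-functors; it takes values in formal $\Bbbk$-superschemes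 and is an equivalence from $\mathsf{SCoalg}_\Bbbk$ to the category of formal $\Bbbk$-superschemes. (iv) A formal super $\Bbbk$-functor is a formal $\Bbbk$-superscheme if and only if it commutes with finite projective limits. -/

import Mathlib

open CategoryTheory TensorProduct

universe u

noncomputable section

namespace SuperGeom

/-! ## Super vector spaces -/

section SuperVectorSpaces

variable {k : Type u} [Field k]
variable {V W V' W' : Type u} [AddCommGroup V] [Module k V] [AddCommGroup W] [Module k W]
variable [AddCommGroup V'] [Module k V'] [AddCommGroup W'] [Module k W']

/-- The Koszul sign `(-1)^{ij}` for parities `i`, `j`. -/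
def sgn (k : Type u) [Field k] (i j : ZMod 2) : k := (-1) ^ (i.val * j.val)

/-- The projection of a super vector space to its component of parity `i`. -/
def proj (𝒱 : ZMod 2 → Submodule k V) [DirectSum.Decomposition 𝒱] (i : ZMod 2) : V →ₗ[k] V :=
  (𝒱 i).subtype ∘ₗ DirectSum.component k _ _ i ∘ₗ
    (DirectSum.decomposeLinearEquiv 𝒱).toLinearMap

/-- The grading of a tensor product: `(V ⊗ W)_i` is spanned by the `v ⊗ w` with
`|v| + |w| = i`. -/
def tensorGr (𝒱 : ZMod 2 → Submodule k V) (𝒲 : ZMod 2 → Submodule k W) (i : ZMod 2) :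
    Submodule k (V ⊗[k] W) :=
  ⨆ j : ZMod 2, Submodule.map₂ (TensorProduct.mk k V W) (𝒱 j) (𝒲 (i - j))

/-- The linear map `v ⊗ w ↦ (-1)^{|v||w|} v ⊗ w` on a tensor product of super vector spaces. -/
def koszul (𝒱 : ZMod 2 → Submodule k V) [DirectSum.Decomposition 𝒱]
    (𝒲 : ZMod 2 → Submodule k W) [DirectSum.Decomposition 𝒲] : V ⊗[k] W →ₗ[k] V ⊗[k] W :=
  ∑ i : ZMod 2, ∑ j : ZMod 2, sgn k i j • TensorProduct.map (proj 𝒱 i) (proj 𝒲 j)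

/-- The twisting map `v ⊗ w ↦ (-1)^{|v||w|} w ⊗ v`. -/
def twist (𝒱 : ZMod 2 → Submodule k V) [DirectSum.Decomposition 𝒱]
    (𝒲 : ZMod 2 → Submodule k W) [DirectSum.Decomposition 𝒲] : V ⊗[k] W →ₗ[k] W ⊗[k] V :=
  (TensorProduct.comm k V W).toLinearMap ∘ₗ koszul 𝒱 𝒲

section lemmas

variable (𝒱 : ZMod 2 → Submodule k V) [DirectSum.Decomposition 𝒱]
variable (𝒲 : ZMod 2 → Submodule k W) [DirectSum.Decomposition 𝒲]

theorem proj_mem (i : ZMod 2) (v : V) : proj 𝒱 i v ∈ 𝒱 i := by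
  simp [proj]

theorem proj_of_mem {i : ZMod 2} (j : ZMod 2) {v : V} (hv : v ∈ 𝒱 i) :
    proj 𝒱 j v = if i = j then v else 0 := by
  change ((DirectSum.decompose 𝒱 v j : 𝒱 j) : V) = _
  split_ifs with h
  · subst h; exact DirectSum.decompose_of_mem_same 𝒱 hv
  · exact DirectSum.decompose_of_mem_ne 𝒱 hv h

theorem sum_proj (v : V) : ∑ i : ZMod 2, proj 𝒱 i v = v := by
  classical
  have h := DirectSum.sum_support_decompose 𝒱 v
  rw [Finset.sum_subset (Finset.subset_univ _)] at h
  · exact h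
  · intro i _ hi
    simpa using hi

theorem koszul_tmul {i j : ZMod 2} {v : V} {w : W} (hv : v ∈ 𝒱 i) (hw : w ∈ 𝒲 j) :
    koszul 𝒱 𝒲 (v ⊗ₜ[k] w) = sgn k i j • (v ⊗ₜ[k] w) := by
  simp only [koszul, LinearMap.sum_apply, LinearMap.smul_apply, TensorProduct.map_tmul,
    proj_of_mem 𝒱 _ hv, proj_of_mem 𝒲 _ hw]
  rw [Finset.sum_eq_single i, Finset.sum_eq_single j]
  · simp
  · intro b _ hb; simp [hb.symm]
  · simp
  · intro b _ hb; simp [hb.symm]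
  · simp

theorem sgn_cocycle (i j l : ZMod 2) :
    sgn k i j * sgn k (i + j) l = sgn k j l * sgn k i (j + l) := by
  have h : ∀ i j l : ZMod 2, Even (i.val * j.val + (i + j).val * l.val
      + (j.val * l.val + i.val * (j + l).val)) := by decide
  have h1 := (h i j l).neg_one_pow (α := k)
  rw [pow_add] at h1
  have h2 : ((-1 : k) ^ (j.val * l.val + i.val * (j + l).val)) *
      ((-1 : k) ^ (j.val * l.val + i.val * (j + l).val)) = 1 := by
    rw [← mul_pow]; simp
  simp only [sgn, ← pow_add]
  calc _ = (-1 : k) ^ (i.val * j.val + (i + j).val * l.val) *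
        (((-1 : k) ^ (j.val * l.val + i.val * (j + l).val)) *
        ((-1 : k) ^ (j.val * l.val + i.val * (j + l).val))) := by rw [h2, mul_one]
    _ = _ := by rw [← mul_assoc, h1, one_mul]

theorem tmul_mem_tensorGr (𝒱 : ZMod 2 → Submodule k V) (𝒲 : ZMod 2 → Submodule k W)
    {i j : ZMod 2} {v : V} {w : W} (hv : v ∈ 𝒱 i) (hw : w ∈ 𝒲 j) :
    v ⊗ₜ[k] w ∈ tensorGr 𝒱 𝒲 (i + j) := by
  refine Submodule.mem_iSup_of_mem i (Submodule.apply_mem_map₂ _ hv ?_)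
  simpa using hw

theorem map_mem_tensorGr {𝒱 : ZMod 2 → Submodule k V} {𝒲 : ZMod 2 → Submodule k W}
    {𝒱' : ZMod 2 → Submodule k V'} {𝒲' : ZMod 2 → Submodule k W'}
    {f : V →ₗ[k] V'} {g : W →ₗ[k] W'} (hf : ∀ i, ∀ v ∈ 𝒱 i, f v ∈ 𝒱' i)
    (hg : ∀ i, ∀ w ∈ 𝒲 i, g w ∈ 𝒲' i) {i : ZMod 2} {z : V ⊗[k] W}
    (hz : z ∈ tensorGr 𝒱 𝒲 i) : TensorProduct.map f g z ∈ tensorGr 𝒱' 𝒲' i := by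
  have h : tensorGr 𝒱 𝒲 i ≤ (tensorGr 𝒱' 𝒲' i).comap (TensorProduct.map f g) := by
    refine iSup_le fun j => Submodule.map₂_le.2 fun v hv w hw => ?_
    simpa using tmul_mem_tensorGr 𝒱' 𝒲' (hf _ _ hv) (hg _ _ hw)
  exact h hz

end lemmas

end SuperVectorSpaces

/-! ## Supercommutative superalgebras -/

/-- A supercommutative `k`-superalgebra: a `ℤ/2`-graded `k`-algebra whose even part is central
and whose odd elements have square zero. -/
structure SAlg (k : Type u) [Field k] where
  carrier : Type u
  [ring : Ring carrier]
  [algebra : Algebra k carrier]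
  gr : ZMod 2 → Submodule k carrier
  [graded : GradedAlgebra gr]
  even_central : ∀ a ∈ gr 0, ∀ b : carrier, a * b = b * a
  odd_sq : ∀ a ∈ gr 1, a * a = 0

attribute [instance] SAlg.ring SAlg.algebra SAlg.graded

namespace SAlg

variable {k : Type u} [Field k]

/-- Morphisms of superalgebras: unital `k`-algebra maps preserving the grading. -/
@[ext]
structure Hom (A B : SAlg k) where
  toAlgHom : A.carrier →ₐ[k] B.carrier
  map_gr : ∀ i, ∀ a ∈ A.gr i, toAlgHom a ∈ B.gr i

instance : Category (SAlg k) where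
  Hom A B := Hom A B
  id A := ⟨AlgHom.id k A.carrier, fun _ _ h => h⟩
  comp f g := ⟨g.toAlgHom.comp f.toAlgHom, fun i a h => g.map_gr i _ (f.map_gr i a h)⟩

/-- The property of being finite-dimensional. -/
def isFinite (k : Type u) [Field k] : ObjectProperty (SAlg k) :=
  fun A => FiniteDimensional k A.carrier

end SAlg

/-- The full subcategory of finite-dimensional supercommutative `k`-superalgebras. -/
abbrev SAlgf (k : Type u) [Field k] := (SAlg.isFinite k).FullSubcategory

/-- A formal super `k`-functor is a functor from `SAlgf k` to sets. -/
abbrev SFFunt (k : Type u) [Field k] := SAlgf k ⥤ Type u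

/-- `SSpf A : B ↦ Hom(A, B)`, contravariantly in `A`. -/
abbrev SSpf (k : Type u) [Field k] : (SAlgf k)ᵒᵖ ⥤ SFFunt k := coyoneda

/-- A formal `k`-superscheme: a formal super `k`-functor isomorphic to the inductive limit, over a
(nonempty) directed set, of finite affine superschemes `SSpf A_λ` whose transition morphisms are
closed immersions, i.e. given by surjections `A_μ → A_λ` for `λ ≤ μ`. -/
def IsFormalSuperscheme (k : Type u) [Field k] : ObjectProperty (SFFunt k) := fun X =>
  ∃ (J : Type u) (_ : Preorder J) (_ : Nonempty J) (_ : IsDirectedOrder J)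
    (A : J ⥤ (SAlgf k)ᵒᵖ),
    (∀ (i j : J) (h : i ⟶ j), Function.Surjective (A.map h).unop.hom.toAlgHom) ∧
    Nonempty (X ≅ Limits.colimit (A ⋙ SSpf k))

/-- The category of formal `k`-superschemes, a full subcategory of formal super `k`-functors. -/
abbrev FormalSuperscheme (k : Type u) [Field k] := (IsFormalSuperscheme k).FullSubcategory

/-! ## Profinite superalgebras -/

/-- An open superideal of finite codimension in a superalgebra with a topology. (A graded left
ideal of a supercommutative superalgebra is two-sided.) -/
structure OpenSuperideal {k : Type u} [Field k] (A : SAlg k) [TopologicalSpace A.carrier] where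
  ideal : Ideal A.carrier
  homogeneous : ideal.IsHomogeneous A.gr
  isOpen : IsOpen (ideal : Set A.carrier)
  finite : FiniteDimensional k (A.carrier ⧸ ideal)

/-- A profinite `k`-superalgebra: a topological superalgebra `A` which is the inverse limit, both
algebraically and topologically, of its discrete finite-dimensional quotients `A ⧸ I`. -/
structure PSAlg (k : Type u) [Field k] where
  toSAlg : SAlg k
  [topology : TopologicalSpace toSAlg.carrier]
  [topologicalRing : IsTopologicalRing toSAlg.carrier]
  /-- The topology is the one induced by the quotients `A ⧸ I`: the `I` form a basis of
  neighbourhoods of zero. -/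
  basis : ∀ U ∈ nhds (0 : toSAlg.carrier),
    ∃ I : OpenSuperideal toSAlg, (I.ideal : Set toSAlg.carrier) ⊆ U
  /-- The canonical map from `A` to the inverse limit of the `A ⧸ I` is bijective. -/
  limit : ∀ x : (∀ I : OpenSuperideal toSAlg, toSAlg.carrier ⧸ I.ideal),
    (∀ (I J : OpenSuperideal toSAlg) (h : I.ideal ≤ J.ideal), Submodule.factor h (x I) = x J) →
    ∃! a : toSAlg.carrier, ∀ I, Submodule.Quotient.mk a = x I

attribute [instance] PSAlg.topology PSAlg.topologicalRing

namespace PSAlg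

variable {k : Type u} [Field k]

/-- Morphisms of profinite superalgebras: continuous morphisms of superalgebras. -/
@[ext]
structure Hom (A B : PSAlg k) where
  hom : A.toSAlg ⟶ B.toSAlg
  continuous : Continuous hom.toAlgHom

instance : Category (PSAlg k) where
  Hom A B := Hom A B
  id A := ⟨𝟙 A.toSAlg, continuous_id⟩
  comp f g := ⟨f.hom ≫ g.hom, g.continuous.comp f.continuous⟩

/-- A finite-dimensional superalgebra with the discrete topology. -/
def discreteObj (B : SAlgf k) : PSAlg k :=
  letI : TopologicalSpace B.obj.carrier := ⊥
  haveI : DiscreteTopology B.obj.carrier := ⟨rfl⟩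
  { toSAlg := B.obj
    basis := fun U hU => ⟨⟨⊥, Ideal.IsHomogeneous.bot _, isOpen_discrete _,
      have : FiniteDimensional k B.obj.carrier := B.property
      inferInstance⟩, by
        rintro x (rfl : x = 0)
        exact mem_of_mem_nhds hU⟩
    limit := fun x hx => by
      have : FiniteDimensional k B.obj.carrier := B.property
      let O : OpenSuperideal B.obj := ⟨⊥, Ideal.IsHomogeneous.bot _, isOpen_discrete _,
        inferInstance⟩
      obtain ⟨a, ha⟩ := Submodule.Quotient.mk_surjective _ (x O)
      refine ⟨a, fun I => ?_, fun b hb => ?_⟩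
      · rw [← hx O I bot_le, ← ha]; rfl
      · have := (hb O).trans ha.symm
        rw [Submodule.Quotient.eq] at this
        exact sub_eq_zero.1 this }

/-- The functor endowing a finite-dimensional superalgebra with the discrete topology. -/
def discrete (k : Type u) [Field k] : SAlgf k ⥤ PSAlg k where
  obj := discreteObj
  map {B C} f :=
    { hom := f.hom
      continuous := by
        let _ : TopologicalSpace B.obj.carrier := ⊥
        have : DiscreteTopology B.obj.carrier := ⟨rfl⟩
        let _ : TopologicalSpace C.obj.carrier := ⊥
        exact continuous_of_discreteTopology (f := f.hom.toAlgHom) }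

end PSAlg

/-- `PSSpf A : B ↦ Hom(A, B)`, the continuous morphisms of superalgebras from a profinite `A` to a
finite-dimensional `B` with the discrete topology; contravariantly in `A`. -/
def PSSpf (k : Type u) [Field k] : (PSAlg k)ᵒᵖ ⥤ SFFunt k :=
  coyoneda ⋙ (Functor.whiskeringLeft _ _ _).obj (PSAlg.discrete k)

/-! ## Super-coalgebras -/

/-- A (coassociative) super-cocommutative super-coalgebra: a coalgebra with a grading that is
preserved by the coproduct and the counit, such that `Δ = c ∘ Δ` for the twisting map `c`. -/
structure SCoalg (k : Type u) [Field k] where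
  carrier : Type u
  [addCommGroup : AddCommGroup carrier]
  [module : Module k carrier]
  [coalgebra : Coalgebra k carrier]
  gr : ZMod 2 → Submodule k carrier
  [decomposition : DirectSum.Decomposition gr]
  comul_mem : ∀ i, ∀ c ∈ gr i, Coalgebra.comul (R := k) c ∈ tensorGr gr gr i
  counit_odd : ∀ c ∈ gr 1, Coalgebra.counit (R := k) c = 0
  cocomm : twist gr gr ∘ₗ Coalgebra.comul (R := k) = Coalgebra.comul (R := k) (A := carrier)

attribute [instance] SCoalg.addCommGroup SCoalg.module SCoalg.coalgebra SCoalg.decomposition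

namespace SCoalg

variable {k : Type u} [Field k]

/-- Morphisms of super-coalgebras: coalgebra maps preserving the grading. -/
@[ext]
structure Hom (C D : SCoalg k) where
  toCoalgHom : C.carrier →ₗc[k] D.carrier
  map_gr : ∀ i, ∀ c ∈ C.gr i, toCoalgHom c ∈ D.gr i

instance : Category (SCoalg k) where
  Hom C D := Hom C D
  id C := ⟨CoalgHom.id k C.carrier, fun _ _ h => h⟩
  comp f g := ⟨g.toCoalgHom.comp f.toCoalgHom, fun i c h => g.map_gr i _ (f.map_gr i c h)⟩

end SCoalg

/-! ## Tensor products of supermodules over a superalgebra -/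

section TensorOver

variable {k : Type u} [Field k]

/-- The relations `x · r ⊗ y = x ⊗ r · y` in `M ⊗_k N` for supermodules `M`, `N` over a superalgebra
`R`, where the right action on `M` is `x · r = (-1)^{|x||r|} r · x` for homogeneous `x`, `r`. -/
def balanced (R : SAlg k) {M : Type u} [AddCommGroup M] [Module k M]
    [Module R.carrier M] (ℳ : ZMod 2 → Submodule k M) (N : Type u)
    [AddCommGroup N] [Module k N] [Module R.carrier N] : Submodule k (M ⊗[k] N) :=
  Submodule.span k {z | ∃ (i j : ZMod 2) (x : M) (y : N) (r : R.carrier),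
    x ∈ ℳ i ∧ r ∈ R.gr j ∧ z = (sgn k i j • (r • x)) ⊗ₜ[k] y - x ⊗ₜ[k] (r • y)}

/-- The tensor product `M ⊗_R N` of supermodules over a superalgebra `R`, as a vector space;
`ℳ` is the grading of `M`. -/
def TensorOver (R : SAlg k) {M : Type u} [AddCommGroup M] [Module k M]
    [Module R.carrier M] (ℳ : ZMod 2 → Submodule k M) (N : Type u)
    [AddCommGroup N] [Module k N] [Module R.carrier N] : Type u :=
  (M ⊗[k] N) ⧸ balanced R ℳ N

namespace TensorOver

variable {R S : SAlg k}
variable {M : Type u} [AddCommGroup M] [Module k M] [Module R.carrier M]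
variable {ℳ : ZMod 2 → Submodule k M}
variable {N : Type u} [AddCommGroup N] [Module k N] [Module R.carrier N]
variable {M' : Type u} [AddCommGroup M'] [Module k M'] [Module S.carrier M']
variable {ℳ' : ZMod 2 → Submodule k M'}
variable {N' : Type u} [AddCommGroup N'] [Module k N'] [Module S.carrier N']

instance : AddCommGroup (TensorOver R ℳ N) :=
  inferInstanceAs (AddCommGroup ((M ⊗[k] N) ⧸ balanced R ℳ N))

instance : Module k (TensorOver R ℳ N) :=
  inferInstanceAs (Module k ((M ⊗[k] N) ⧸ balanced R ℳ N))

variable (R ℳ N) in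
/-- The bilinear map `(x, y) ↦ x ⊗_R y`. -/
def mk : M →ₗ[k] N →ₗ[k] TensorOver R ℳ N :=
  (TensorProduct.mk k M N).compr₂ (balanced R ℳ N).mkQ

theorem balanced_le (φ : R ⟶ S) (f : M →ₗ[k] M') (g : N →ₗ[k] N')
    (hf : ∀ i, ∀ x ∈ ℳ i, f x ∈ ℳ' i)
    (hfs : ∀ (r : R.carrier) (x : M), f (r • x) = φ.toAlgHom r • f x)
    (hgs : ∀ (r : R.carrier) (y : N), g (r • y) = φ.toAlgHom r • g y) :
    balanced R ℳ N ≤ (balanced S ℳ' N').comap (TensorProduct.map f g) := by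
  refine Submodule.span_le.2 ?_
  rintro _ ⟨i, j, x, y, s, hx, hs, rfl⟩
  refine Submodule.subset_span ⟨i, j, f x, g y, φ.toAlgHom s, hf _ _ hx, φ.map_gr _ _ hs, ?_⟩
  simp [hfs, hgs]

/-- The map `x ⊗_R y ↦ f x ⊗_S g y` for maps `f`, `g` that are semilinear along `φ : R ⟶ S`. -/
theorem exists_map (φ : R ⟶ S) (f : M →ₗ[k] M') (g : N →ₗ[k] N')
    (hf : ∀ i, ∀ x ∈ ℳ i, f x ∈ ℳ' i)
    (hfs : ∀ (r : R.carrier) (x : M), f (r • x) = φ.toAlgHom r • f x)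
    (hgs : ∀ (r : R.carrier) (y : N), g (r • y) = φ.toAlgHom r • g y) :
    ∃ F : TensorOver R ℳ N →ₗ[k] TensorOver S ℳ' N',
      ∀ x y, F (mk R ℳ N x y) = mk S ℳ' N' (f x) (g y) :=
  ⟨(balanced R ℳ N).mapQ (balanced S ℳ' N') (TensorProduct.map f g)
    (balanced_le φ f g hf hfs hgs), fun _ _ => rfl⟩

end TensorOver

end TensorOver

/-! ## Group-like elements and the functor `Sp*` -/

section GroupLike

variable {k : Type u} [Field k]

/-- The underlying left `R`-module of the `R`-super-coalgebra `R ⊗ C`. -/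
abbrev BaseChange (R : SAlg k) (C : SCoalg k) : Type u := R.carrier ⊗[k] C.carrier

/-- The grading of `R ⊗ C`. -/
abbrev baseGr (R : SAlg k) (C : SCoalg k) : ZMod 2 → Submodule k (BaseChange R C) :=
  tensorGr R.gr C.gr

/-- The tensor product `(R ⊗ C) ⊗_R (R ⊗ C)`. -/
abbrev BaseSq (R : SAlg k) (C : SCoalg k) : Type u := TensorOver R (baseGr R C) (BaseChange R C)

/-- The element `x ⊗_R y` of `(R ⊗ C) ⊗_R (R ⊗ C)`, as a bilinear map. -/
abbrev baseMk (R : SAlg k) (C : SCoalg k) :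
    BaseChange R C →ₗ[k] BaseChange R C →ₗ[k] BaseSq R C :=
  TensorOver.mk R (baseGr R C) (BaseChange R C)

/-- The coproduct of `R ⊗ C`, the `R`-linear extension of that of `C`:
`r ⊗ c ↦ ∑ (r ⊗ c₁) ⊗_R (1 ⊗ c₂)`. -/
def baseComul (R : SAlg k) (C : SCoalg k) : BaseChange R C →ₗ[k] BaseSq R C :=
  TensorProduct.lift ((baseMk R C).compl₂ (TensorProduct.mk k R.carrier C.carrier 1)) ∘ₗ
    (TensorProduct.assoc k R.carrier C.carrier C.carrier).symm.toLinearMap ∘ₗ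
    (Coalgebra.comul (R := k)).lTensor R.carrier

/-- The counit of `R ⊗ C`, the `R`-linear extension of that of `C`: `r ⊗ c ↦ ε(c) r`. -/
def baseCounit (R : SAlg k) (C : SCoalg k) : BaseChange R C →ₗ[k] R.carrier :=
  (TensorProduct.rid k R.carrier).toLinearMap ∘ₗ (Coalgebra.counit (R := k)).lTensor R.carrier

/-- The group-like elements of `R ⊗ C`: even elements `u` with `Δ(u) = u ⊗_R u`, `ε(u) = 1`. -/
def IsGroupLike (R : SAlg k) (C : SCoalg k) (u : BaseChange R C) : Prop :=
  u ∈ baseGr R C 0 ∧ baseComul R C u = baseMk R C u u ∧ baseCounit R C u = 1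

/-- The map `φ ⊗ f : R ⊗ C → S ⊗ D`. -/
def baseMap {R S : SAlg k} {C D : SCoalg k} (φ : R ⟶ S) (f : C ⟶ D) :
    BaseChange R C →ₗ[k] BaseChange S D :=
  TensorProduct.map φ.toAlgHom.toLinearMap f.toCoalgHom.toLinearMap

theorem baseMap_smul {R S : SAlg k} {C D : SCoalg k} (φ : R ⟶ S) (f : C ⟶ D) (s : R.carrier)
    (x : BaseChange R C) : baseMap φ f (s • x) = φ.toAlgHom s • baseMap φ f x := by
  induction x using TensorProduct.induction_on with
  | zero => simp
  | add x y hx hy => rw [smul_add, map_add, hx, hy, map_add, smul_add]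
  | tmul r c =>
    rw [TensorProduct.smul_tmul']
    simp [baseMap, TensorProduct.smul_tmul']

theorem IsGroupLike.map {R S : SAlg k} {C D : SCoalg k} (φ : R ⟶ S) (f : C ⟶ D)
    {u : BaseChange R C} (hu : IsGroupLike R C u) : IsGroupLike S D (baseMap φ f u) := by
  refine ⟨map_mem_tensorGr φ.map_gr f.map_gr hu.1, ?_, ?_⟩
  · obtain ⟨F, hF⟩ := TensorOver.exists_map (ℳ := baseGr R C) (ℳ' := baseGr S D) φ
      (baseMap φ f) (baseMap φ f) (fun i x hx => map_mem_tensorGr φ.map_gr f.map_gr hx)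
      (baseMap_smul φ f) (baseMap_smul φ f)
    rw [← hF, ← hu.2.1]
    generalize u = x
    induction x using TensorProduct.induction_on with
    | zero => simp
    | add x y hx hy => simp only [map_add, hx, hy]
    | tmul r c =>
      have h := LinearMap.congr_fun f.toCoalgHom.map_comp_comul c
      simp only [LinearMap.comp_apply] at h
      simp only [baseComul, baseMap, LinearMap.comp_apply, TensorProduct.map_tmul,
        LinearMap.lTensor_tmul, ← h]
      generalize CoalgebraStruct.comul (R := k) c = z
      induction z using TensorProduct.induction_on with
      | zero => simp
      | add z w hz hw => simp only [map_add, TensorProduct.tmul_add, hz, hw]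
      | tmul a b =>
        simp [hF, baseMap]
  · have h : baseCounit S D ∘ₗ baseMap φ f = φ.toAlgHom.toLinearMap ∘ₗ baseCounit R C := by
      refine TensorProduct.ext' fun r c => ?_
      have h := LinearMap.congr_fun f.toCoalgHom.counit_comp c
      simp only [LinearMap.comp_apply] at h
      simp only [baseCounit, baseMap, LinearMap.comp_apply, TensorProduct.map_tmul,
        LinearMap.lTensor_tmul, h]
      simp
    have h' := LinearMap.congr_fun h u
    simp only [LinearMap.comp_apply] at h'
    rw [h', hu.2.2]
    simp

theorem baseMap_id (R : SAlg k) (C : SCoalg k) (x : BaseChange R C) :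
    baseMap (𝟙 R) (𝟙 C) x = x :=
  LinearMap.congr_fun (TensorProduct.map_id (R := k) (M := R.carrier) (N := C.carrier)) x

theorem baseMap_comp {R S T : SAlg k} {C D E : SCoalg k} (φ : R ⟶ S) (ψ : S ⟶ T) (f : C ⟶ D)
    (g : D ⟶ E) (x : BaseChange R C) :
    baseMap (φ ≫ ψ) (f ≫ g) x = baseMap ψ g (baseMap φ f x) :=
  LinearMap.congr_fun (TensorProduct.map_comp ψ.toAlgHom.toLinearMap
    g.toCoalgHom.toLinearMap φ.toAlgHom.toLinearMap f.toCoalgHom.toLinearMap) x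

/-- The formal super `k`-functor `Sp* C : R ↦ G_R(R ⊗ C)`. -/
def SpStarObj (C : SCoalg k) : SFFunt k where
  obj R := {u : BaseChange R.obj C // IsGroupLike R.obj C u}
  map φ := TypeCat.ofHom fun u => ⟨baseMap φ.hom (𝟙 C) u.1, u.2.map _ _⟩
  map_id R := by
    refine ConcreteCategory.hom_ext _ _ fun u => ?_
    exact Subtype.ext (baseMap_id R.obj C u.1)
  map_comp φ ψ := by
    refine ConcreteCategory.hom_ext _ _ fun u => ?_
    exact Subtype.ext (baseMap_comp φ.hom ψ.hom (𝟙 C) (𝟙 C) u.1)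

/-- The functor `C ↦ Sp* C` from super-cocommutative super-coalgebras to formal super
`k`-functors; a morphism `f` acts by `id ⊗ f`. -/
def SpStar (k : Type u) [Field k] : SCoalg k ⥤ SFFunt k where
  obj := SpStarObj
  map f :=
    { app := fun R => TypeCat.ofHom fun u => ⟨baseMap (𝟙 R.obj) f u.1, u.2.map _ _⟩
      naturality := fun R S φ => by
        refine ConcreteCategory.hom_ext _ _ fun u => ?_
        refine Subtype.ext ?_
        exact (baseMap_comp φ.hom (𝟙 _) (𝟙 _) f u.1).symm.trans
          (baseMap_comp (𝟙 _) φ.hom f (𝟙 _) u.1) }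
  map_id C := by
    refine NatTrans.ext (funext fun R => ConcreteCategory.hom_ext _ _ fun u => ?_)
    exact Subtype.ext (baseMap_id R.obj C u.1)
  map_comp f g := by
    refine NatTrans.ext (funext fun R => ConcreteCategory.hom_ext _ _ fun u => ?_)
    exact Subtype.ext (baseMap_comp (𝟙 R.obj) (𝟙 R.obj) f g u.1)

end GroupLike

/-! ## The dual of a finite-dimensional superalgebra -/

section DualGrading

variable {k : Type u} [Field k] {V : Type u} [AddCommGroup V] [Module k V]

/-- The grading of the dual: `f` has parity `i` if it vanishes on the component of the other
parity. -/
def dualGr (𝒱 : ZMod 2 → Submodule k V) (i : ZMod 2) : Submodule k (Module.Dual k V) where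
  carrier := {f | ∀ j, j ≠ i → ∀ v ∈ 𝒱 j, f v = 0}
  zero_mem' := by intro j _ v _; rfl
  add_mem' := by
    intro f g hf hg j hj v hv
    rw [LinearMap.add_apply, hf j hj v hv, hg j hj v hv, add_zero]
  smul_mem' := by
    intro c f hf j hj v hv
    rw [LinearMap.smul_apply, hf j hj v hv, smul_zero]

variable (𝒱 : ZMod 2 → Submodule k V) [DirectSum.Decomposition 𝒱]

theorem comp_proj_mem (f : Module.Dual k V) (i : ZMod 2) : f ∘ₗ proj 𝒱 i ∈ dualGr 𝒱 i := by
  intro j hj v hv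
  rw [LinearMap.comp_apply, proj_of_mem 𝒱 i hv, if_neg hj, map_zero]

theorem sum_comp_proj (f : Module.Dual k V) : ∑ i : ZMod 2, f ∘ₗ proj 𝒱 i = f := by
  ext v
  conv_rhs => rw [← sum_proj 𝒱 v]
  simp

theorem dualGr_isInternal : DirectSum.IsInternal (dualGr 𝒱) := by
  rw [DirectSum.isInternal_submodule_iff_isCompl (i := (0 : ZMod 2)) (j := 1) _ (by decide)
    (by ext i; revert i; decide)]
  constructor
  · rw [Submodule.disjoint_def]
    intro f h0 h1
    rw [← sum_comp_proj 𝒱 f]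
    refine Finset.sum_eq_zero fun i _ => ?_
    ext v
    by_cases hi : i = 0
    · subst hi; exact h1 0 (by decide) _ (proj_mem 𝒱 0 v)
    · exact h0 i hi _ (proj_mem 𝒱 i v)
  · rw [codisjoint_iff, eq_top_iff]
    intro f _
    rw [← sum_comp_proj 𝒱 f]
    refine Submodule.sum_mem _ fun i _ => ?_
    by_cases hi : i = 0
    · subst hi; exact Submodule.mem_sup_left (comp_proj_mem 𝒱 f 0)
    · have hi : i = 1 := by revert i; decide
      subst hi; exact Submodule.mem_sup_right (comp_proj_mem 𝒱 f 1)

instance dualDecomposition : DirectSum.Decomposition (dualGr 𝒱) :=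
  (dualGr_isInternal 𝒱).chooseDecomposition

theorem proj_dual (i : ZMod 2) (f : Module.Dual k V) :
    proj (dualGr 𝒱) i f = f ∘ₗ proj 𝒱 i := by
  conv_lhs => rw [← sum_comp_proj 𝒱 f, map_sum]
  rw [Finset.sum_eq_single i]
  · rw [proj_of_mem _ _ (comp_proj_mem 𝒱 f i), if_pos rfl]
  · intro j _ hj
    rw [proj_of_mem _ _ (comp_proj_mem 𝒱 f j), if_neg hj]
  · simp

theorem dualDistrib_map_proj (i j : ZMod 2) (z : Module.Dual k V ⊗[k] Module.Dual k V)
    (w : V ⊗[k] V) :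
    TensorProduct.dualDistrib k V V
        (TensorProduct.map (proj (dualGr 𝒱) i) (proj (dualGr 𝒱) j) z) w =
      TensorProduct.dualDistrib k V V z (TensorProduct.map (proj 𝒱 i) (proj 𝒱 j) w) := by
  induction z using TensorProduct.induction_on with
  | zero => simp
  | add x y hx hy => simp only [map_add, LinearMap.add_apply, hx, hy]
  | tmul f g =>
    induction w using TensorProduct.induction_on with
    | zero => simp
    | add x y hx hy => simp only [map_add, hx, hy]
    | tmul v w => simp [proj_dual]

theorem dualDistrib_koszul (z : Module.Dual k V ⊗[k] Module.Dual k V) (w : V ⊗[k] V) :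
    TensorProduct.dualDistrib k V V (koszul (dualGr 𝒱) (dualGr 𝒱) z) w =
      TensorProduct.dualDistrib k V V z (koszul 𝒱 𝒱 w) := by
  simp only [koszul, LinearMap.sum_apply, LinearMap.smul_apply, map_sum, map_smul,
    dualDistrib_map_proj]

theorem dualDistrib_comm (z : Module.Dual k V ⊗[k] Module.Dual k V) (v w : V) :
    TensorProduct.dualDistrib k V V (TensorProduct.comm k _ _ z) (v ⊗ₜ[k] w) =
      TensorProduct.dualDistrib k V V z (w ⊗ₜ[k] v) := by
  induction z using TensorProduct.induction_on with
  | zero => simp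
  | add x y hx hy => simp only [map_add, LinearMap.add_apply, hx, hy]
  | tmul f g => simp [mul_comm]

end DualGrading

section Dual

variable {k : Type u} [Field k]

/-- The map `a ⊗ b ↦ (-1)^{|a||b|} ab`. -/
def signedMul (A : SAlg k) : A.carrier ⊗[k] A.carrier →ₗ[k] A.carrier :=
  LinearMap.mul' k A.carrier ∘ₗ koszul A.gr A.gr

theorem signedMul_tmul (A : SAlg k) {i j : ZMod 2} {a b : A.carrier} (ha : a ∈ A.gr i)
    (hb : b ∈ A.gr j) : signedMul A (a ⊗ₜ[k] b) = sgn k i j • (a * b) := by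
  simp [signedMul, koszul_tmul A.gr A.gr ha hb]

theorem SAlg.induction (A : SAlg k) {p : A.carrier → Prop}
    (h : ∀ i, ∀ a ∈ A.gr i, p a) (hadd : ∀ a b, p a → p b → p (a + b)) (a : A.carrier) : p a :=
  DirectSum.Decomposition.inductionOn A.gr (h 0 0 (zero_mem _))
    (fun {i} m => h i m m.2) hadd a

theorem signedMul_assoc (A : SAlg k) (a b c : A.carrier) :
    signedMul A (signedMul A (a ⊗ₜ[k] b) ⊗ₜ[k] c) =
      signedMul A (a ⊗ₜ[k] signedMul A (b ⊗ₜ[k] c)) := by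
  induction a using A.induction with
  | hadd a a' h h' => simp only [TensorProduct.add_tmul, map_add, h, h']
  | h i a ha =>
  induction b using A.induction with
  | hadd a a' h h' => simp only [TensorProduct.add_tmul, TensorProduct.tmul_add, map_add, h, h']
  | h j b hb =>
  induction c using A.induction with
  | hadd a a' h h' => simp only [TensorProduct.tmul_add, map_add, h, h']
  | h l c hc =>
    rw [signedMul_tmul A ha hb, signedMul_tmul A hb hc, ← TensorProduct.smul_tmul', map_smul,
      TensorProduct.tmul_smul, map_smul, signedMul_tmul A (SetLike.mul_mem_graded ha hb) hc,
      signedMul_tmul A ha (SetLike.mul_mem_graded hb hc), smul_smul, smul_smul, sgn_cocycle,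
      mul_assoc]

theorem signedMul_one (A : SAlg k) (a : A.carrier) : signedMul A (a ⊗ₜ[k] 1) = a := by
  induction a using A.induction with
  | hadd a a' h h' => simp only [TensorProduct.add_tmul, map_add, h, h']
  | h i a ha =>
    rw [signedMul_tmul A ha (SetLike.one_mem_graded A.gr)]
    simp [sgn]

theorem one_signedMul (A : SAlg k) (a : A.carrier) : signedMul A (1 ⊗ₜ[k] a) = a := by
  induction a using A.induction with
  | hadd a a' h h' => simp only [TensorProduct.tmul_add, map_add, h, h']
  | h i a ha =>
    rw [signedMul_tmul A (SetLike.one_mem_graded A.gr) ha]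
    simp [sgn]

theorem signedMul_comm (A : SAlg k) (a b : A.carrier) :
    signedMul A (koszul A.gr A.gr (b ⊗ₜ[k] a)) = signedMul A (a ⊗ₜ[k] b) := by
  induction a using A.induction with
  | hadd a a' h h' => simp only [TensorProduct.add_tmul, TensorProduct.tmul_add, map_add, h, h']
  | h i a ha =>
  induction b using A.induction with
  | hadd a a' h h' => simp only [TensorProduct.add_tmul, TensorProduct.tmul_add, map_add, h, h']
  | h j b hb =>
    have key : sgn k j i • (b * a) = a * b := by
      have hij : ∀ i : ZMod 2, i = 0 ∨ i = 1 := by decide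
      rcases hij i with rfl | rfl
      · simp [sgn, A.even_central a ha b]
      rcases hij j with rfl | rfl
      · simp [sgn, A.even_central b hb a]
      have h := A.odd_sq (a + b) (add_mem ha hb)
      rw [add_mul, mul_add, mul_add, A.odd_sq a ha, A.odd_sq b hb, zero_add, add_zero] at h
      rw [eq_neg_of_add_eq_zero_left h]
      simp [sgn, ZMod.val_one]
    have hs : sgn k i j = sgn k j i := by rw [sgn, sgn, mul_comm]
    rw [koszul_tmul A.gr A.gr hb ha, map_smul, signedMul_tmul A hb ha, signedMul_tmul A ha hb,
      key, hs]

variable (A : SAlgf k)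

instance : FiniteDimensional k A.obj.carrier := A.property

theorem koszul_koszul (B : SAlg k) (w : B.carrier ⊗[k] B.carrier) :
    koszul B.gr B.gr (koszul B.gr B.gr w) = w := by
  induction w using TensorProduct.induction_on with
  | zero => simp
  | add x y hx hy => simp only [map_add, hx, hy]
  | tmul a b =>
  induction a using B.induction with
  | hadd a a' h h' => simp only [TensorProduct.add_tmul, map_add, h, h']
  | h i a ha =>
  induction b using B.induction with
  | hadd a a' h h' => simp only [TensorProduct.tmul_add, map_add, h, h']
  | h j b hb =>
    rw [koszul_tmul _ _ ha hb, map_smul, koszul_tmul _ _ ha hb, smul_smul, sgn, ← mul_pow]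
    simp

/-- The pairing of `A* ⊗ A*` with `A ⊗ A` satisfying
`⟨f ⊗ g, a ⊗ b⟩ = (-1)^{|g||a|} f(a) g(b)` for homogeneous `f`, `g`, `a`, `b`. (As `g(b) = 0` unless
`|g| = |b|`, the sign can be taken to be `(-1)^{|a||b|}`.) -/
def superPairing : Module.Dual k A.obj.carrier ⊗[k] Module.Dual k A.obj.carrier →ₗ[k]
    Module.Dual k (A.obj.carrier ⊗[k] A.obj.carrier) :=
  (koszul A.obj.gr A.obj.gr).dualMap ∘ₗ TensorProduct.dualDistrib k A.obj.carrier A.obj.carrier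

/-- The coproduct of `A*`, dual to the product of `A`: it is characterized by
`⟨Δ f, a ⊗ b⟩ = f (ab)` for the pairing `superPairing`, see `superPairing_dualComul`. -/
def dualComul : Module.Dual k A.obj.carrier →ₗ[k]
    Module.Dual k A.obj.carrier ⊗[k] Module.Dual k A.obj.carrier :=
  (TensorProduct.dualDistribEquiv k A.obj.carrier A.obj.carrier).symm.toLinearMap ∘ₗ
    (signedMul A.obj).dualMap

/-- The counit of `A*`: evaluation at `1`. -/
def dualCounit : Module.Dual k A.obj.carrier →ₗ[k] k := Module.Dual.eval k A.obj.carrier 1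

theorem dualDistrib_injective : Function.Injective
    (TensorProduct.dualDistrib k A.obj.carrier A.obj.carrier) :=
  (TensorProduct.dualDistribEquiv k A.obj.carrier A.obj.carrier).injective

theorem dualDistrib_dualComul (f : Module.Dual k A.obj.carrier)
    (w : A.obj.carrier ⊗[k] A.obj.carrier) :
    TensorProduct.dualDistrib k A.obj.carrier A.obj.carrier (dualComul A f) w =
      f (signedMul A.obj w) := by
  have h : TensorProduct.dualDistribEquiv k A.obj.carrier A.obj.carrier (dualComul A f) =
      (signedMul A.obj).dualMap f := LinearEquiv.apply_symm_apply _ _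
  exact LinearMap.congr_fun h w

theorem superPairing_dualComul (f : Module.Dual k A.obj.carrier) (a b : A.obj.carrier) :
    superPairing A (dualComul A f) (a ⊗ₜ[k] b) = f (a * b) := by
  change TensorProduct.dualDistrib k A.obj.carrier A.obj.carrier (dualComul A f)
    (koszul A.obj.gr A.obj.gr (a ⊗ₜ[k] b)) = _
  rw [dualDistrib_dualComul, signedMul, LinearMap.comp_apply, koszul_koszul, LinearMap.mul'_apply]

/-- The unsigned pairing of `A* ⊗ A* ⊗ A*` with `A ⊗ A ⊗ A`. -/
def triplePairing : Module.Dual k A.obj.carrier ⊗[k]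
    (Module.Dual k A.obj.carrier ⊗[k] Module.Dual k A.obj.carrier) ≃ₗ[k]
    Module.Dual k (A.obj.carrier ⊗[k] (A.obj.carrier ⊗[k] A.obj.carrier)) :=
  (TensorProduct.congr (LinearEquiv.refl k _)
    (TensorProduct.dualDistribEquiv k A.obj.carrier A.obj.carrier)) ≪≫ₗ
    TensorProduct.dualDistribEquiv k A.obj.carrier (A.obj.carrier ⊗[k] A.obj.carrier)

theorem triplePairing_tmul (f : Module.Dual k A.obj.carrier)
    (z : Module.Dual k A.obj.carrier ⊗[k] Module.Dual k A.obj.carrier) (a : A.obj.carrier)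
    (w : A.obj.carrier ⊗[k] A.obj.carrier) :
    triplePairing A (f ⊗ₜ[k] z) (a ⊗ₜ[k] w) =
      f a * TensorProduct.dualDistrib k A.obj.carrier A.obj.carrier z w := rfl

theorem triplePairing_assoc (z : Module.Dual k A.obj.carrier ⊗[k] Module.Dual k A.obj.carrier)
    (h : Module.Dual k A.obj.carrier) (a b c : A.obj.carrier) :
    triplePairing A (TensorProduct.assoc k _ _ _ (z ⊗ₜ[k] h)) (a ⊗ₜ[k] (b ⊗ₜ[k] c)) =
      TensorProduct.dualDistrib k A.obj.carrier A.obj.carrier z (a ⊗ₜ[k] b) * h c := by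
  induction z using TensorProduct.induction_on with
  | zero => simp
  | add x y hx hy =>
    simp only [TensorProduct.add_tmul, map_add, LinearMap.add_apply, hx, hy, add_mul]
  | tmul f g =>
    rw [TensorProduct.assoc_tmul, triplePairing_tmul]
    simp [mul_assoc]

theorem triplePairing_rTensor (z : Module.Dual k A.obj.carrier ⊗[k] Module.Dual k A.obj.carrier)
    (a b c : A.obj.carrier) :
    triplePairing A (TensorProduct.assoc k _ _ _ ((dualComul A).rTensor _ z))
      (a ⊗ₜ[k] (b ⊗ₜ[k] c)) =
      TensorProduct.dualDistrib k A.obj.carrier A.obj.carrier z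
        (signedMul A.obj (a ⊗ₜ[k] b) ⊗ₜ[k] c) := by
  induction z using TensorProduct.induction_on with
  | zero => simp
  | add x y hx hy => simp only [map_add, LinearMap.add_apply, hx, hy]
  | tmul f g =>
    rw [LinearMap.rTensor_tmul, triplePairing_assoc, dualDistrib_dualComul]
    simp

theorem triplePairing_lTensor (z : Module.Dual k A.obj.carrier ⊗[k] Module.Dual k A.obj.carrier)
    (a b c : A.obj.carrier) :
    triplePairing A ((dualComul A).lTensor _ z) (a ⊗ₜ[k] (b ⊗ₜ[k] c)) =
      TensorProduct.dualDistrib k A.obj.carrier A.obj.carrier z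
        (a ⊗ₜ[k] signedMul A.obj (b ⊗ₜ[k] c)) := by
  induction z using TensorProduct.induction_on with
  | zero => simp
  | add x y hx hy => simp only [map_add, LinearMap.add_apply, hx, hy]
  | tmul f g =>
    rw [LinearMap.lTensor_tmul, triplePairing_tmul, dualDistrib_dualComul]
    simp

theorem rTensor_dualCounit (z : Module.Dual k A.obj.carrier ⊗[k] Module.Dual k A.obj.carrier)
    (a : A.obj.carrier) :
    TensorProduct.lid k _ ((dualCounit A).rTensor _ z) a =
      TensorProduct.dualDistrib k A.obj.carrier A.obj.carrier z (1 ⊗ₜ[k] a) := by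
  induction z using TensorProduct.induction_on with
  | zero => simp
  | add x y hx hy => simp only [map_add, LinearMap.add_apply, hx, hy]
  | tmul f g => simp [dualCounit]

theorem lTensor_dualCounit (z : Module.Dual k A.obj.carrier ⊗[k] Module.Dual k A.obj.carrier)
    (a : A.obj.carrier) :
    TensorProduct.rid k _ ((dualCounit A).lTensor _ z) a =
      TensorProduct.dualDistrib k A.obj.carrier A.obj.carrier z (a ⊗ₜ[k] 1) := by
  induction z using TensorProduct.induction_on with
  | zero => simp
  | add x y hx hy => simp only [map_add, LinearMap.add_apply, hx, hy]
  | tmul f g => simp [dualCounit, mul_comm]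

/-- The coalgebra structure on `A*`. -/
@[reducible]
def dualCoalgebra : Coalgebra k (Module.Dual k A.obj.carrier) where
  comul := dualComul A
  counit := dualCounit A
  coassoc := by
    refine LinearMap.ext fun f => (triplePairing A).injective ?_
    refine TensorProduct.ext' fun a w => ?_
    induction w using TensorProduct.induction_on with
    | zero => simp
    | add x y hx hy => simp only [TensorProduct.tmul_add, map_add, hx, hy]
    | tmul b c =>
      simp only [LinearMap.comp_apply, LinearEquiv.coe_coe]
      rw [triplePairing_rTensor, triplePairing_lTensor, dualDistrib_dualComul,
        dualDistrib_dualComul, signedMul_assoc]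
  rTensor_counit_comp_comul := by
    refine LinearMap.ext fun f => (TensorProduct.lid k _).injective (LinearMap.ext fun a => ?_)
    simp only [LinearMap.comp_apply]
    rw [rTensor_dualCounit, dualDistrib_dualComul, one_signedMul]
    simp
  lTensor_counit_comp_comul := by
    refine LinearMap.ext fun f => (TensorProduct.rid k _).injective (LinearMap.ext fun a => ?_)
    simp only [LinearMap.comp_apply]
    rw [lTensor_dualCounit, dualDistrib_dualComul, signedMul_one]
    simp

theorem dualComul_mem (i : ZMod 2) (f : Module.Dual k A.obj.carrier)
    (hf : f ∈ dualGr A.obj.gr i) :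
    dualComul A f ∈ tensorGr (dualGr A.obj.gr) (dualGr A.obj.gr) i := by
  have hsum : ∀ z : Module.Dual k A.obj.carrier ⊗[k] Module.Dual k A.obj.carrier,
      z = ∑ j : ZMod 2, ∑ l : ZMod 2,
        TensorProduct.map (proj (dualGr A.obj.gr) j) (proj (dualGr A.obj.gr) l) z := by
    intro z
    induction z using TensorProduct.induction_on with
    | zero => simp
    | add x y hx hy =>
      simp only [map_add, Finset.sum_add_distrib]
      rw [← hx, ← hy]
    | tmul f g =>
      conv_lhs => rw [← sum_proj (dualGr A.obj.gr) f, ← sum_proj (dualGr A.obj.gr) g]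
      simp only [TensorProduct.sum_tmul, TensorProduct.tmul_sum, TensorProduct.map_tmul]
      exact Finset.sum_comm
  rw [hsum (dualComul A f)]
  refine Submodule.sum_mem _ fun j _ => Submodule.sum_mem _ fun l _ => ?_
  by_cases hjl : j + l = i
  · subst hjl
    generalize dualComul A f = z
    induction z using TensorProduct.induction_on with
    | zero => simp
    | add x y hx hy => rw [map_add]; exact add_mem hx hy
    | tmul f g => exact tmul_mem_tensorGr _ _ (proj_mem _ _ _) (proj_mem _ _ _)
  · convert zero_mem (tensorGr (dualGr A.obj.gr) (dualGr A.obj.gr) i)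
    refine dualDistrib_injective A (TensorProduct.ext' fun a b => ?_)
    rw [dualDistrib_map_proj, dualDistrib_dualComul, TensorProduct.map_tmul,
      signedMul_tmul A.obj (proj_mem _ j a) (proj_mem _ l b), map_smul,
      hf (j + l) hjl _ (SetLike.mul_mem_graded (proj_mem _ j a) (proj_mem _ l b))]
    simp

/-- The dual super-coalgebra `A*` of a finite-dimensional supercommutative superalgebra `A`. -/
def dualSCoalg : SCoalg k :=
  letI : Coalgebra k (Module.Dual k A.obj.carrier) := dualCoalgebra A
  { carrier := Module.Dual k A.obj.carrier
    gr := dualGr A.obj.gr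
    comul_mem := dualComul_mem A
    counit_odd := fun f hf => hf 0 (by decide) 1 (SetLike.one_mem_graded A.obj.gr)
    cocomm := by
      refine LinearMap.ext fun f => dualDistrib_injective A (TensorProduct.ext' fun a b => ?_)
      change TensorProduct.dualDistrib k _ _ (TensorProduct.comm k _ _
        (koszul (dualGr A.obj.gr) (dualGr A.obj.gr) (dualComul A f))) (a ⊗ₜ[k] b) =
        TensorProduct.dualDistrib k _ _ (dualComul A f) (a ⊗ₜ[k] b)
      rw [dualDistrib_comm, dualDistrib_koszul, dualDistrib_dualComul, dualDistrib_dualComul,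
        signedMul_comm] }

end Dual

end SuperGeom

end

noncomputable section

namespace SuperGeom

/-! ### Gradings described by their projections -/

section GradingTools

variable {k : Type u} [Field k] {V : Type u} [AddCommGroup V] [Module k V]

/-! All four statements rest on one notion, a `Presentation` of a functor X by a system (A_j):
compatible elements x_j in X(A_j) such that every element of X(B) is the image of some x_j, under a
morphism A_j → B that is unique once j is fixed. A formal superscheme is the same as a functor
presented by a nonempty directed system with surjective transitions. Morphisms out of X are then
compatible families of elements of the Y(A_j), and two functors presented by the same system are
isomorphic.

For (iv), a filtered colimit of corepresentable functors is left exact. The converse is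
Grothendieck's pro-representability argument. Call x in X(A) minimal if it comes from no proper
graded subalgebra. Counting dimensions, every element comes from a minimal one; equalizers show that
a minimal element determines the morphisms out of A; images make the transition maps between minimal
elements surjective; finite products make the system directed. Only superalgebras on the spaces kⁿ
are used, which keeps the index type small.

For (i), the quotients P/I present `PSSpf P`, and full faithfulness is the universal property of P =
lim P/I. Conversely a system A_j has an inverse limit P, which is profinite. The point that is not
formal is that P → A_j is onto; it is proved by linear duality in `exists_compatible_family`.

For (ii) and (iii), supercommutativity says (-1)^{|a||b|} ab = ba. Hence the signed coproduct of A*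
is, for the unsigned pairing, simply dual to the opposite multiplication (`signedMul_eq`), and most
signs disappear. Under R ⊗ C ≅ Hom(R*, C) the group-like elements become the super-coalgebra
morphisms R* → C (`isGroupLike_iff`), so Sp* C = Hom((-)*, C), and A ↦ A* is fully faithful. By the
fundamental theorem of coalgebras, C is the directed union of finite-dimensional
super-subcoalgebras, each of the form R*. These R present Sp* C, which yields full faithfulness. A
given system A_j is realized by the direct limit of the A_j*. Characteristic different from 2 serves
to make odd elements of C* square to zero. -/

theorem isInternal_of_proj (𝒱 : ZMod 2 → Submodule k V) (p : ZMod 2 → V → V)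
    (hmem : ∀ i v, p i v ∈ 𝒱 i) (hsum : ∀ v, p 0 v + p 1 v = v)
    (hne : ∀ i j, i ≠ j → ∀ v ∈ 𝒱 i, p j v = 0) : DirectSum.IsInternal 𝒱 := by
  rw [DirectSum.isInternal_submodule_iff_isCompl (i := (0 : ZMod 2)) (j := 1) _ (by decide)
    (by ext i; revert i; decide)]
  constructor
  · rw [Submodule.disjoint_def]
    intro v h0 h1
    rw [← hsum v, hne 0 1 (by decide) v h0, hne 1 0 (by decide) v h1, add_zero]
  · rw [codisjoint_iff, eq_top_iff]
    intro v _
    rw [← hsum v]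
    exact add_mem (Submodule.mem_sup_left (hmem 0 v)) (Submodule.mem_sup_right (hmem 1 v))

variable {W : Type u} [AddCommGroup W] [Module k W]
variable (𝒱 : ZMod 2 → Submodule k V) [DirectSum.Decomposition 𝒱]
variable (𝒲 : ZMod 2 → Submodule k W) [DirectSum.Decomposition 𝒲]

theorem proj_add_proj (v : V) : proj 𝒱 0 v + proj 𝒱 1 v = v := by
  have h := sum_proj 𝒱 v
  rwa [show (Finset.univ : Finset (ZMod 2)) = {0, 1} by decide,
    Finset.sum_pair (by decide)] at h

theorem mem_iff_proj_eq {i : ZMod 2} {v : V} : v ∈ 𝒱 i ↔ proj 𝒱 i v = v :=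
  ⟨fun h => by rw [proj_of_mem 𝒱 i h, if_pos rfl], fun h => h ▸ proj_mem 𝒱 i v⟩

theorem map_proj {f : V →ₗ[k] W} (hf : ∀ i, ∀ v ∈ 𝒱 i, f v ∈ 𝒲 i) (i : ZMod 2) (v : V) :
    f (proj 𝒱 i v) = proj 𝒲 i (f v) := by
  conv_rhs => rw [← sum_proj 𝒱 v, map_sum, map_sum]
  rw [Finset.sum_eq_single i]
  · rw [proj_of_mem 𝒲 i (hf i _ (proj_mem 𝒱 i v)), if_pos rfl]
  · intro j _ hj
    rw [proj_of_mem 𝒲 i (hf j _ (proj_mem 𝒱 j v)), if_neg hj]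
  · simp

/-- Commutation with projections is an equation between elements, so gradedness can be tested after
an injective map or a jointly injective family of maps. -/
theorem map_gr_of_map_proj {f : V →ₗ[k] W} (hf : ∀ i v, f (proj 𝒱 i v) = proj 𝒲 i (f v))
    (i : ZMod 2) (v : V) (hv : v ∈ 𝒱 i) : f v ∈ 𝒲 i := by
  rw [mem_iff_proj_eq] at hv ⊢
  rw [← hf, hv]

end GradingTools

/-! ### Subalgebras, products and quotients of superalgebras -/

namespace SAlg

variable {k : Type u} [Field k]

theorem Hom.map_proj {A B : SAlg k} (f : A ⟶ B) (i : ZMod 2) (a : A.carrier) :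
    f.toAlgHom (proj A.gr i a) = proj B.gr i (f.toAlgHom a) :=
  SuperGeom.map_proj (f := f.toAlgHom.toLinearMap) A.gr B.gr f.map_gr i a

theorem hom_ext {A B : SAlg k} {f g : A ⟶ B} (h : ∀ a, f.toAlgHom a = g.toAlgHom a) : f = g :=
  Hom.ext (AlgHom.ext h)

/-- The superalgebra structure on a graded subalgebra. -/
def sub (A : SAlg k) (S : Subalgebra k A.carrier)
    (hS : ∀ i, ∀ a ∈ S, proj A.gr i a ∈ S) : SAlg k :=
  let gr : ZMod 2 → Submodule k S := fun i => (A.gr i).comap S.val.toLinearMap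
  have hint : DirectSum.IsInternal gr := isInternal_of_proj gr
    (fun i a => ⟨proj A.gr i a, hS i a a.2⟩) (fun i a => proj_mem A.gr i a.1)
    (fun a => Subtype.ext (proj_add_proj A.gr a.1))
    (fun _ j hij _ ha => Subtype.ext ((proj_of_mem A.gr j ha).trans (if_neg hij)))
  { carrier := S
    gr := gr
    graded :=
      { toGradedMonoid :=
          { one_mem := SetLike.one_mem_graded A.gr
            mul_mem := fun _ _ _ _ ha hb => SetLike.mul_mem_graded (A := A.gr) ha hb }
        toDecomposition := hint.chooseDecomposition }
    even_central := fun a ha b => Subtype.ext (A.even_central a ha b)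
    odd_sq := fun a ha => Subtype.ext (A.odd_sq a ha) }

/-- The inclusion of a graded subalgebra. -/
def subι (A : SAlg k) (S : Subalgebra k A.carrier) (hS : ∀ i, ∀ a ∈ S, proj A.gr i a ∈ S) :
    A.sub S hS ⟶ A := ⟨S.val, fun _ _ h => h⟩

theorem subι_injective (A : SAlg k) (S : Subalgebra k A.carrier)
    (hS : ∀ i, ∀ a ∈ S, proj A.gr i a ∈ S) : Function.Injective (A.subι S hS).toAlgHom :=
  Subtype.val_injective

/-- A morphism with values in a graded subalgebra. -/
def subLift {A B : SAlg k} (S : Subalgebra k A.carrier) (hS : ∀ i, ∀ a ∈ S, proj A.gr i a ∈ S)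
    (f : B ⟶ A) (hf : ∀ b, f.toAlgHom b ∈ S) : B ⟶ A.sub S hS :=
  ⟨f.toAlgHom.codRestrict S hf, fun i b hb => f.map_gr i b hb⟩

theorem subLift_ι {A B : SAlg k} (S : Subalgebra k A.carrier)
    (hS : ∀ i, ∀ a ∈ S, proj A.gr i a ∈ S) (f : B ⟶ A) (hf : ∀ b, f.toAlgHom b ∈ S) :
    subLift S hS f hf ≫ A.subι S hS = f := rfl

/-- The product of a family of superalgebras. -/
def pi {J : Type u} (A : J → SAlg k) : SAlg k :=
  let gr : ZMod 2 → Submodule k (∀ j, (A j).carrier) :=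
    fun i => Submodule.pi Set.univ fun j => (A j).gr i
  have hint : DirectSum.IsInternal gr := isInternal_of_proj gr
    (fun i a j => proj (A j).gr i (a j)) (fun i a j _ => proj_mem (A j).gr i (a j))
    (fun a => funext fun j => proj_add_proj (A j).gr (a j))
    (fun _ i' hi _ ha => funext fun j =>
      (proj_of_mem (A j).gr i' (ha j (Set.mem_univ j))).trans (if_neg hi))
  { carrier := ∀ j, (A j).carrier
    gr := gr
    graded :=
      { toGradedMonoid :=
          { one_mem := fun j _ => SetLike.one_mem_graded (A j).gr
            mul_mem := fun _ _ _ _ ha hb j hj =>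
              SetLike.mul_mem_graded (A := (A j).gr) (ha j hj) (hb j hj) }
        toDecomposition := hint.chooseDecomposition }
    even_central := fun _ ha _ => funext fun j => (A j).even_central _ (ha j (Set.mem_univ j)) _
    odd_sq := fun _ ha => funext fun j => (A j).odd_sq _ (ha j (Set.mem_univ j)) }

/-- The projections of a product of superalgebras. -/
def piπ {J : Type u} (A : J → SAlg k) (j : J) : pi A ⟶ A j :=
  ⟨Pi.evalAlgHom k (fun j => (A j).carrier) j, fun _ _ h => h j (Set.mem_univ j)⟩

/-- The morphism to a product given by its components. -/
def piLift {J : Type u} {A : J → SAlg k} {B : SAlg k} (f : ∀ j, B ⟶ A j) : B ⟶ pi A :=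
  ⟨AlgHom.pi fun j => (f j).toAlgHom, fun i b hb j _ => (f j).map_gr i b hb⟩

theorem pi_proj_apply {J : Type u} (A : J → SAlg k) (i : ZMod 2) (a : (pi A).carrier) (j : J) :
    proj (pi A).gr i a j = proj (A j).gr i (a j) := Hom.map_proj (piπ A j) i a

theorem proj_mem_of_isHomogeneous {A : SAlg k} {I : Ideal A.carrier} (hI : I.IsHomogeneous A.gr)
    (i : ZMod 2) {a : A.carrier} (ha : a ∈ I) : proj A.gr i a ∈ I := hI i ha

theorem odd_mul_odd (A : SAlg k) {a b : A.carrier} (ha : a ∈ A.gr 1) (hb : b ∈ A.gr 1) :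
    a * b = -(b * a) := by
  have h := A.odd_sq (a + b) (add_mem ha hb)
  rw [add_mul, mul_add, mul_add, A.odd_sq a ha, A.odd_sq b hb, zero_add, add_zero] at h
  exact eq_neg_of_add_eq_zero_left h

/-- Split both factors into components. Even components are central and odd ones anticommute, so in
each product the factor from `I` can be moved to the right, up to sign. -/
theorem isTwoSided_of_isHomogeneous {A : SAlg k} {I : Ideal A.carrier}
    (hI : I.IsHomogeneous A.gr) : I.IsTwoSided := by
  refine ⟨fun {a} b ha => ?_⟩
  have h0 := proj_mem_of_isHomogeneous hI 0 ha
  have h1 := proj_mem_of_isHomogeneous hI 1 ha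
  rw [← proj_add_proj A.gr a, ← proj_add_proj A.gr b, add_mul, mul_add (proj A.gr 1 a)]
  refine add_mem ?_ (add_mem ?_ ?_)
  · rw [A.even_central _ (proj_mem A.gr 0 a)]
    exact I.mul_mem_left _ h0
  · rw [← A.even_central _ (proj_mem A.gr 0 b)]
    exact I.mul_mem_left _ h1
  · rw [A.odd_mul_odd (proj_mem A.gr 1 a) (proj_mem A.gr 1 b)]
    exact neg_mem (I.mul_mem_left _ h1)

/-- The quotient of a superalgebra by a graded ideal. -/
def quot (A : SAlg k) (I : Ideal A.carrier) (hI : I.IsHomogeneous A.gr) : SAlg k :=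
  haveI := isTwoSided_of_isHomogeneous hI
  let π : A.carrier →ₐ[k] A.carrier ⧸ I := Ideal.Quotient.mkₐ k I
  let gr : ZMod 2 → Submodule k (A.carrier ⧸ I) := fun i => (A.gr i).map π.toLinearMap
  have hI' : ∀ i, I.restrictScalars k ≤ (I.restrictScalars k).comap (proj A.gr i) :=
    fun i a ha => proj_mem_of_isHomogeneous hI i ha
  have hint : DirectSum.IsInternal gr := isInternal_of_proj gr
    (fun i => (I.restrictScalars k).mapQ (I.restrictScalars k) (proj A.gr i) (hI' i))
    (fun i a => by
      obtain ⟨a, rfl⟩ := Ideal.Quotient.mk_surjective a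
      exact ⟨proj A.gr i a, proj_mem A.gr i a, rfl⟩)
    (fun a => by
      obtain ⟨a, rfl⟩ := Ideal.Quotient.mk_surjective a
      exact congrArg π (proj_add_proj A.gr a))
    (fun i j hij a ha => by
      obtain ⟨a, ha, rfl⟩ := ha
      exact (congrArg π ((proj_of_mem A.gr j ha).trans (if_neg hij))).trans (map_zero π))
  { carrier := A.carrier ⧸ I
    gr := gr
    graded :=
      { toGradedMonoid :=
          { one_mem := ⟨1, SetLike.one_mem_graded A.gr, map_one π⟩
            mul_mem := by
              rintro i j _ _ ⟨a, ha, rfl⟩ ⟨b, hb, rfl⟩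
              exact ⟨a * b, SetLike.mul_mem_graded ha hb, map_mul π a b⟩ }
        toDecomposition := hint.chooseDecomposition }
    even_central := by
      rintro _ ⟨a, ha, rfl⟩ b
      obtain ⟨b, rfl⟩ := Ideal.Quotient.mk_surjective b
      exact congrArg π (A.even_central a ha b)
    odd_sq := by
      rintro _ ⟨a, ha, rfl⟩
      exact (congrArg π (A.odd_sq a ha)).trans (map_zero π) }

/-- The projection to the quotient by a graded ideal. -/
def quotπ (A : SAlg k) (I : Ideal A.carrier) (hI : I.IsHomogeneous A.gr) : A ⟶ A.quot I hI :=
  haveI := isTwoSided_of_isHomogeneous hI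
  ⟨Ideal.Quotient.mkₐ k I, fun _ a ha => ⟨a, ha, rfl⟩⟩

theorem quotπ_surjective (A : SAlg k) (I : Ideal A.carrier) (hI : I.IsHomogeneous A.gr) :
    Function.Surjective (A.quotπ I hI).toAlgHom :=
  have := isTwoSided_of_isHomogeneous hI
  Ideal.Quotient.mk_surjective

theorem quotπ_eq_zero_iff {A : SAlg k} {I : Ideal A.carrier} (hI : I.IsHomogeneous A.gr)
    {a : A.carrier} : (A.quotπ I hI).toAlgHom a = 0 ↔ a ∈ I := by
  have := isTwoSided_of_isHomogeneous hI
  exact Ideal.Quotient.eq_zero_iff_mem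

/-- A morphism that vanishes on a kernel of a surjection factors through the surjection. -/
theorem exists_factor {A B C : SAlg k} (p : A ⟶ B) (hp : Function.Surjective p.toAlgHom)
    (f : A ⟶ C) (hf : ∀ a, p.toAlgHom a = 0 → f.toAlgHom a = 0) : ∃ g : B ⟶ C, p ≫ g = f := by
  have hg : ∀ a, f.toAlgHom (Function.surjInv hp (p.toAlgHom a)) = f.toAlgHom a := fun a => by
    rw [← sub_eq_zero, ← map_sub]
    exact hf _ (by rw [map_sub, Function.surjInv_eq hp, sub_self])
  let g : B.carrier →ₐ[k] C.carrier :=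
    { toFun := fun b => f.toAlgHom (Function.surjInv hp b)
      map_one' := by rw [← map_one p.toAlgHom, hg, map_one]
      map_zero' := by rw [← map_zero p.toAlgHom, hg, map_zero]
      map_mul' := hp.forall₂.2 fun a b => by rw [← map_mul, hg, hg, hg, map_mul]
      map_add' := hp.forall₂.2 fun a b => by rw [← map_add, hg, hg, hg, map_add]
      commutes' := fun c => by rw [← AlgHom.commutes p.toAlgHom, hg, AlgHom.commutes] }
  refine ⟨⟨g, fun i b hb => ?_⟩, hom_ext hg⟩
  obtain ⟨a, rfl⟩ := hp b
  rw [mem_iff_proj_eq, ← Hom.map_proj] at hb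
  rw [← hb]
  change f.toAlgHom (Function.surjInv hp _) ∈ _
  rw [hg]
  exact f.map_gr i _ (proj_mem A.gr i a)

theorem hom_eq_of_surjective {A B C : SAlg k} (p : A ⟶ B) (hp : Function.Surjective p.toAlgHom)
    {f g : B ⟶ C} (h : p ≫ f = p ≫ g) : f = g :=
  hom_ext fun b => by
    obtain ⟨a, rfl⟩ := hp b
    exact congrArg (fun q : A ⟶ C => q.toAlgHom a) h

end SAlg

/-! ### Presentations of formal superschemes -/

section Presentations

variable {k : Type u} [Field k]

/-- A diagram of finite-dimensional superalgebras `A_λ` with surjective transition maps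
`A_μ → A_λ` for `λ ≤ μ`. -/
def SurjectiveTransitions {J : Type u} [Preorder J] (A : J ⥤ (SAlgf k)ᵒᵖ) : Prop :=
  ∀ (i j : J) (h : i ⟶ j), Function.Surjective (A.map h).unop.hom.toAlgHom

/-- An inductive presentation `X = ⋃ SSpf A_λ` of a formal super functor, in terms of the elements
of `X(A_λ)` that correspond to the inclusions. -/
structure Presentation (X : SFFunt k) {J : Type u} [Preorder J] (A : J ⥤ (SAlgf k)ᵒᵖ) where
  elt : ∀ j, X.obj (A.obj j).unop
  map_elt : ∀ (i j : J) (h : i ⟶ j), X.map (A.map h).unop (elt j) = elt i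
  exists_map : ∀ (B : SAlgf k) (y : X.obj B),
    ∃ (j : J) (φ : (A.obj j).unop ⟶ B), X.map φ (elt j) = y
  map_inj : ∀ (j : J) (B : SAlgf k) (φ ψ : (A.obj j).unop ⟶ B),
    X.map φ (elt j) = X.map ψ (elt j) → φ = ψ

theorem map_comp_apply' (X : SFFunt k) {A B C : SAlgf k} (f : A ⟶ B) (g : B ⟶ C) (x : X.obj A) :
    X.map (f ≫ g) x = X.map g (X.map f x) := by simp

theorem naturality_apply' {X Y : SFFunt k} (η : X ⟶ Y) {A B : SAlgf k} (f : A ⟶ B) (x : X.obj A) :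
    η.app B (X.map f x) = Y.map f (η.app A x) := NatTrans.naturality_apply η f x

namespace Presentation

variable {X Y : SFFunt k} {J : Type u} [Preorder J] {A : J ⥤ (SAlgf k)ᵒᵖ}

theorem hom_ext (P : Presentation X A) {η θ : X ⟶ Y}
    (h : ∀ j, η.app _ (P.elt j) = θ.app _ (P.elt j)) : η = θ := by
  refine NatTrans.ext (funext fun B => ConcreteCategory.hom_ext _ _ fun x => ?_)
  obtain ⟨j, φ, rfl⟩ := P.exists_map B x
  rw [naturality_apply', naturality_apply', h]

/-- Transport of a presentation along an isomorphism. -/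
def ofIso (P : Presentation X A) (e : X ≅ Y) : Presentation Y A where
  elt j := e.hom.app _ (P.elt j)
  map_elt i j h := by rw [← naturality_apply', P.map_elt]
  exists_map B y := by
    obtain ⟨j, φ, h⟩ := P.exists_map B (e.inv.app _ y)
    refine ⟨j, φ, ?_⟩
    rw [← naturality_apply', h]
    simp
  map_inj j B φ ψ h := by
    rw [← naturality_apply', ← naturality_apply'] at h
    refine P.map_inj j B φ ψ ?_
    simpa using congrArg (e.inv.app B) h

variable [IsDirectedOrder J]

/-- Over a common upper bound `l` of `i` and `j`, the composites of `φ` and `ψ` with the transition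
maps agree by `map_inj`, so any compatible family takes equal values along them. This makes `desc`
independent of its choices. -/
theorem map_eq_of_map_elt_eq (P : Presentation X A) {y : ∀ j, Y.obj (A.obj j).unop}
    (hy : ∀ (i j : J) (h : i ⟶ j), Y.map (A.map h).unop (y j) = y i) {i j : J} {B : SAlgf k}
    (φ : (A.obj i).unop ⟶ B) (ψ : (A.obj j).unop ⟶ B)
    (h : X.map φ (P.elt i) = X.map ψ (P.elt j)) : Y.map φ (y i) = Y.map ψ (y j) := by
  obtain ⟨l, hi, hj⟩ := exists_ge_ge i j
  have := P.map_inj l B ((A.map (homOfLE hi)).unop ≫ φ) ((A.map (homOfLE hj)).unop ≫ ψ) (by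
    rw [map_comp_apply', map_comp_apply', P.map_elt, P.map_elt, h])
  rw [← hy i l (homOfLE hi), ← hy j l (homOfLE hj), ← map_comp_apply', ← map_comp_apply', this]

/-- The morphism out of a formal super functor given by a compatible family. -/
def desc (P : Presentation X A) (y : ∀ j, Y.obj (A.obj j).unop)
    (hy : ∀ (i j : J) (h : i ⟶ j), Y.map (A.map h).unop (y j) = y i) : X ⟶ Y where
  app B := TypeCat.ofHom fun x =>
    Y.map (P.exists_map B x).choose_spec.choose (y (P.exists_map B x).choose)
  naturality B C f := by
    refine ConcreteCategory.hom_ext _ _ fun x => ?_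
    change Y.map _ _ = Y.map f (Y.map _ _)
    rw [← map_comp_apply']
    apply P.map_eq_of_map_elt_eq hy
    rw [map_comp_apply', (P.exists_map B x).choose_spec.choose_spec,
      (P.exists_map C (X.map f x)).choose_spec.choose_spec]

theorem desc_elt (P : Presentation X A) (y : ∀ j, Y.obj (A.obj j).unop)
    (hy : ∀ (i j : J) (h : i ⟶ j), Y.map (A.map h).unop (y j) = y i) (j : J) :
    (P.desc y hy).app _ (P.elt j) = y j := by
  have := P.map_eq_of_map_elt_eq hy (P.exists_map _ (P.elt j)).choose_spec.choose (𝟙 _)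
    (by rw [(P.exists_map _ (P.elt j)).choose_spec.choose_spec]; simp)
  exact this.trans (by simp)

/-- Two formal super functors presented by the same system are isomorphic. -/
def iso (P : Presentation X A) (Q : Presentation Y A) : X ≅ Y where
  hom := P.desc Q.elt Q.map_elt
  inv := Q.desc P.elt P.map_elt
  hom_inv_id := P.hom_ext fun j => by simp [desc_elt]
  inv_hom_id := Q.hom_ext fun j => by simp [desc_elt]

variable (A) in
/-- The presentation of an inductive limit of a surjective system. -/
theorem nonempty_colimit [Nonempty J] (hA : SurjectiveTransitions A) :
    Nonempty (Presentation (Limits.colimit (A ⋙ SSpf k)) A) := by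
  let F := A ⋙ SSpf k
  -- Colimits of functors are computed pointwise, so the description of filtered colimits of sets
  -- applies at each `B`.
  have hc : ∀ B : SAlgf k, Limits.IsColimit (((evaluation _ _).obj B).mapCocone
      (Limits.colimit.cocone F)) := fun B =>
    Limits.isColimitOfPreserves _ (Limits.colimit.isColimit F)
  have hι : ∀ (j : J) {B C : SAlgf k} (f : (A.obj j).unop ⟶ B) (g : B ⟶ C),
      (Limits.colimit F).map g ((Limits.colimit.ι F j).app B f) =
        (Limits.colimit.ι F j).app C (f ≫ g) := fun j B C f g =>
    (naturality_apply' (Limits.colimit.ι F j) g f).symm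
  refine ⟨⟨fun j => (Limits.colimit.ι F j).app _ (𝟙 (A.obj j).unop), fun i j h => ?_,
    fun B y => ?_, fun j B φ ψ h => ?_⟩⟩
  · rw [hι, Category.id_comp, ← Limits.colimit.w F h]
    change _ = (Limits.colimit.ι F j).app _ ((A.map h).unop ≫ 𝟙 _)
    rw [Category.comp_id]
  · obtain ⟨j, φ, rfl⟩ := Limits.Types.jointly_surjective_of_isColimit (hc B) y
    exact ⟨j, φ, by rw [hι, Category.id_comp]; rfl⟩
  · rw [hι, hι, Category.id_comp, Category.id_comp] at h
    -- Two elements of one term that agree in a filtered colimit agree at a later term `l`; there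
    -- the surjective transition map can be cancelled.
    obtain ⟨l, f, hl⟩ := (Limits.Types.FilteredColimit.isColimit_eq_iff' (hc B) _ _).1 h
    change (A.map f).unop ≫ φ = (A.map f).unop ≫ ψ at hl
    have hl' := congrArg (fun q => q.hom) hl
    exact ObjectProperty.hom_ext _ (SAlg.hom_eq_of_surjective _ (hA _ _ f) hl')

end Presentation

/-- This replaces the colimit by its elements; later arguments about systems use only the right-hand
side. -/
theorem isFormalSuperscheme_iff (X : SFFunt k) :
    IsFormalSuperscheme k X ↔ ∃ (J : Type u) (_ : Preorder J) (_ : Nonempty J)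
      (_ : IsDirectedOrder J) (A : J ⥤ (SAlgf k)ᵒᵖ),
      SurjectiveTransitions A ∧ Nonempty (Presentation X A) := by
  constructor
  · rintro ⟨J, _, _, _, A, hA, ⟨e⟩⟩
    obtain ⟨P⟩ := Presentation.nonempty_colimit A hA
    exact ⟨J, _, ‹_›, ‹_›, A, hA, ⟨P.ofIso e.symm⟩⟩
  · rintro ⟨J, _, _, _, A, hA, ⟨P⟩⟩
    obtain ⟨Q⟩ := Presentation.nonempty_colimit A hA
    exact ⟨J, _, ‹_›, ‹_›, A, hA, ⟨P.iso Q⟩⟩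

/-- Corepresentable functors preserve limits, and filtered colimits of sets commute with finite
limits. -/
theorem IsFormalSuperscheme.preservesFiniteLimits {X : SFFunt k} (hX : IsFormalSuperscheme k X) :
    Limits.PreservesFiniteLimits X := by
  obtain ⟨J, _, _, _, A, -, ⟨e⟩⟩ := hX
  let F := A ⋙ SSpf k
  have : Limits.PreservesFiniteLimits F.flip := by
    refine ⟨fun K _ _ => Limits.preservesLimitsOfShape_of_evaluation _ _ fun j => ?_⟩
    exact inferInstanceAs (Limits.PreservesLimitsOfShape K (coyoneda.obj (A.obj j)))
  have e' : F.flip ⋙ Limits.colim ≅ X := (Limits.colimitIsoFlipCompColim F).symm ≪≫ e.symm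
  exact Limits.preservesFiniteLimits_of_natIso e'

end Presentations

/-! ### A small set of models for finite-dimensional superalgebras -/

section SmallModels

variable {k : Type u} [Field k]

/-- The set `kⁿ`, without any algebraic structure. -/
def Tuple (k : Type u) (n : ℕ) : Type u := Fin n → k

/-- Superalgebra structures on the sets `kⁿ`. -/
structure StandardSAlg (k : Type u) [Field k] where
  n : ℕ
  ring : Ring (Tuple k n)
  algebra : Algebra k (Tuple k n)
  gr : ZMod 2 → Submodule k (Tuple k n)
  graded : GradedAlgebra gr
  even_central : ∀ a ∈ gr 0, ∀ b : Tuple k n, a * b = b * a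
  odd_sq : ∀ a ∈ gr 1, a * a = 0
  finite : FiniteDimensional k (Tuple k n)

/-- The superalgebra given by a superalgebra structure on `kⁿ`. -/
def StandardSAlg.toSAlgf (S : StandardSAlg k) : SAlgf k :=
  letI := S.ring
  letI := S.algebra
  letI := S.graded
  ⟨⟨Tuple k S.n, S.gr, S.even_central, S.odd_sq⟩, S.finite⟩

/-- An isomorphism of superalgebras from a bijective morphism. -/
def SAlgf.isoOfBijective {A B : SAlgf k} (f : A ⟶ B) (hf : Function.Bijective f.hom.toAlgHom) :
    A ≅ B :=
  let e := AlgEquiv.ofBijective f.hom.toAlgHom hf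
  have he : ∀ i, ∀ b ∈ B.obj.gr i, e.symm b ∈ A.obj.gr i := fun i b hb => by
    rw [mem_iff_proj_eq] at hb ⊢
    apply hf.1
    rw [SAlg.Hom.map_proj]
    have : f.hom.toAlgHom (e.symm b) = b := e.apply_symm_apply b
    rw [this, hb]
  { hom := f
    inv := ⟨⟨e.symm.toAlgHom, he⟩⟩
    hom_inv_id := ObjectProperty.hom_ext _ (SAlg.hom_ext fun a => e.symm_apply_apply a)
    inv_hom_id := ObjectProperty.hom_ext _ (SAlg.hom_ext fun b => e.apply_symm_apply b) }

/-- A basis transports the structure to kⁿ. Superalgebras of universe `u` do not form a type in `u`,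
but structures on the sets kⁿ do, and an index set is required to lie in `u`. -/
theorem StandardSAlg.exists_iso (A : SAlgf k) :
    ∃ S : StandardSAlg k, Nonempty (S.toSAlgf ≅ A) := by
  let n := Module.finrank k A.obj.carrier
  let e : Tuple k n ≃ A.obj.carrier :=
    (Module.finBasis k A.obj.carrier).equivFun.symm.toEquiv
  let _ : Ring (Tuple k n) := e.ring
  let _ : Algebra k (Tuple k n) := e.algebra k
  let E : Tuple k n ≃ₐ[k] A.obj.carrier := e.algEquiv k
  let gr : ZMod 2 → Submodule k (Tuple k n) := fun i => (A.obj.gr i).comap E.toLinearMap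
  have hgr : ∀ {i a}, a ∈ gr i → E a ∈ A.obj.gr i := fun h => h
  have hint : DirectSum.IsInternal gr := isInternal_of_proj gr
    (fun i a => E.symm (proj A.obj.gr i (E a)))
    (fun i a => by
      change E (E.symm (proj A.obj.gr i (E a))) ∈ A.obj.gr i
      rw [E.apply_symm_apply]
      exact proj_mem _ _ _)
    (fun a => by rw [← map_add, proj_add_proj, E.symm_apply_apply])
    (fun i j hij a ha => by
      rw [(proj_of_mem A.obj.gr j (hgr ha)).trans (if_neg hij), map_zero])
  let S : StandardSAlg k :=
    { n := n
      ring := inferInstance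
      algebra := inferInstance
      gr := gr
      graded :=
        { toGradedMonoid :=
            { one_mem := by
                change E 1 ∈ A.obj.gr 0
                rw [map_one]
                exact SetLike.one_mem_graded A.obj.gr
              mul_mem := fun i j a b ha hb => by
                change E (a * b) ∈ A.obj.gr (i + j)
                rw [map_mul]
                exact SetLike.mul_mem_graded (A := A.obj.gr) ha hb }
          toDecomposition := hint.chooseDecomposition }
      even_central := fun a ha b => E.injective (by
        rw [map_mul, map_mul, A.obj.even_central _ (hgr ha)])
      odd_sq := fun a ha => E.injective (by
        rw [map_mul, map_zero, A.obj.odd_sq _ (hgr ha)])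
      finite := Module.Finite.equiv E.symm.toLinearEquiv }
  let f : S.toSAlgf ⟶ A := ⟨⟨E.toAlgHom, fun _ _ h => h⟩⟩
  exact ⟨S, ⟨SAlgf.isoOfBijective f E.bijective⟩⟩

end SmallModels

/-! ### Products and equalizers under a left exact functor -/

section LeftExact

variable {k : Type u} [Field k]

/-- The image of a morphism of superalgebras. -/
theorem SAlg.exists_image {A B : SAlg k} (f : B ⟶ A) : ∃ (C : SAlg k) (g : B ⟶ C) (ι : C ⟶ A),
    Function.Injective ι.toAlgHom ∧ g ≫ ι = f ∧
      ∀ a, (∃ c, ι.toAlgHom c = a) ↔ ∃ b, f.toAlgHom b = a := by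
  have hS : ∀ i, ∀ a ∈ f.toAlgHom.range, proj A.gr i a ∈ f.toAlgHom.range := by
    rintro i _ ⟨b, rfl⟩
    exact ⟨proj B.gr i b, Hom.map_proj f i b⟩
  refine ⟨A.sub _ hS, subLift _ hS f fun b => ⟨b, rfl⟩, A.subι _ hS, subι_injective _ _ _,
    subLift_ι _ _ _ _, fun a => ⟨?_, ?_⟩⟩
  · rintro ⟨⟨_, b, rfl⟩, rfl⟩
    exact ⟨b, rfl⟩
  · rintro ⟨b, rfl⟩
    exact ⟨⟨_, b, rfl⟩, rfl⟩

theorem SAlgf.finite_of_injective {A : SAlg k} {B : SAlgf k} (f : A ⟶ B.obj)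
    (hf : Function.Injective f.toAlgHom) : FiniteDimensional k A.carrier :=
  Module.Finite.of_injective f.toAlgHom.toLinearMap hf

variable (X : SFFunt k) [Limits.PreservesFiniteLimits X]

/-- A finite product of finite-dimensional superalgebras is their categorical product, and X
preserves it. The empty family is allowed and gives the zero algebra. -/
theorem exists_pi_lift {J : Type u} [Finite J] (A : J → SAlgf k) (x : ∀ j, X.obj (A j)) :
    ∃ (B : SAlgf k) (π : ∀ j, B ⟶ A j) (z : X.obj B), ∀ j, X.map (π j) z = x j := by
  have := Fintype.ofFinite J
  classical
  let B : SAlgf k := ⟨SAlg.pi fun j => (A j).obj,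
    (inferInstance : FiniteDimensional k (∀ j, (A j).obj.carrier))⟩
  let π : ∀ j, B ⟶ A j := fun j => ⟨SAlg.piπ _ j⟩
  let c : Limits.Cone (Discrete.functor A) := Limits.Fan.mk B π
  have hc : Limits.IsLimit c := Limits.Fan.IsLimit.mk _ (fun s => ⟨SAlg.piLift fun j => (s.proj j).hom⟩)
    (fun _ _ => rfl) (fun s m hm => ObjectProperty.hom_ext _ (SAlg.hom_ext fun b => funext fun j =>
      congrArg (fun q : _ ⟶ A j => q.hom.toAlgHom b) (hm j)))
  let e := Limits.Types.isLimitEquivSections (Limits.isLimitOfPreserves X hc)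
  let s : (Discrete.functor A ⋙ X).sections := ⟨fun j => x j.as, by
    rintro ⟨i⟩ ⟨j⟩ ⟨⟨h⟩⟩
    obtain rfl : i = j := h
    exact congrArg (fun f => f (x i)) (X.map_id (A i))⟩
  refine ⟨B, π, e.symm s, fun j => ?_⟩
  exact Limits.Types.isLimitEquivSections_symm_apply (Limits.isLimitOfPreserves X hc) s ⟨j⟩

/-- The equalizer of two morphisms is a graded subalgebra, and X turns it into an equalizer of sets.
-/
theorem exists_equalizer_lift {A B : SAlgf k} (f g : A ⟶ B) (x : X.obj A)
    (h : X.map f x = X.map g x) : ∃ (E : SAlgf k) (ι : E ⟶ A) (z : X.obj E),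
      Function.Injective ι.hom.toAlgHom ∧ ι ≫ f = ι ≫ g ∧ X.map ι z = x := by
  let S : Subalgebra k A.obj.carrier := AlgHom.equalizer f.hom.toAlgHom g.hom.toAlgHom
  have hS : ∀ i, ∀ a ∈ S, proj A.obj.gr i a ∈ S := fun i a ha => by
    change f.hom.toAlgHom _ = g.hom.toAlgHom _
    rw [SAlg.Hom.map_proj, SAlg.Hom.map_proj, (ha : f.hom.toAlgHom a = g.hom.toAlgHom a)]
  let E : SAlgf k := ⟨A.obj.sub S hS,
    SAlgf.finite_of_injective (A.obj.subι S hS) (A.obj.subι_injective S hS)⟩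
  let ι : E ⟶ A := ⟨A.obj.subι S hS⟩
  have hι : ι ≫ f = ι ≫ g := ObjectProperty.hom_ext _ (SAlg.hom_ext fun a => a.2)
  have hc : Limits.IsLimit (Limits.Fork.ofι ι hι) := Limits.Fork.IsLimit.mk _
    (fun s => ⟨SAlg.subLift S hS s.ι.hom fun b =>
      congrArg (fun q : s.pt ⟶ B => q.hom.toAlgHom b) s.condition⟩)
    (fun _ => rfl) (fun s m hm => ObjectProperty.hom_ext _ (SAlg.hom_ext fun b =>
      Subtype.ext (congrArg (fun q : s.pt ⟶ A => q.hom.toAlgHom b) hm)))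
  have hc' := Limits.isLimitForkMapOfIsLimit X hι hc
  obtain ⟨z, hz⟩ := (Limits.Types.type_equalizer_iff_unique _ _).1 ⟨hc'⟩ x h
  exact ⟨E, ι, z, A.obj.subι_injective S hS, hι, hz.1⟩

end LeftExact

/-! ### Left exact functors are formal superschemes -/

section ProRepresentability

variable {k : Type u} [Field k] {X : SFFunt k}

/-- An element of `X(A)` that does not come from a proper subalgebra of `A`. -/
def IsMinimalElt {A : SAlgf k} (x : X.obj A) : Prop :=
  ∀ (B : SAlgf k) (ι : B ⟶ A) (y : X.obj B), Function.Injective ι.hom.toAlgHom →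
    X.map ι y = x → Function.Surjective ι.hom.toAlgHom

/-- Among all pairs mapping to `x`, one of least dimension is minimal: an injection into it cannot
lower the dimension, hence is onto. -/
theorem exists_isMinimalElt {A : SAlgf k} (x : X.obj A) :
    ∃ (B : SAlgf k) (ι : B ⟶ A) (y : X.obj B), IsMinimalElt y ∧ X.map ι y = x := by
  classical
  have hex : ∃ n : ℕ, ∃ (B : SAlgf k) (ι : B ⟶ A) (y : X.obj B),
      X.map ι y = x ∧ Module.finrank k B.obj.carrier = n :=
    ⟨_, A, 𝟙 A, x, by simp, rfl⟩
  obtain ⟨B, ι, y, h, hn⟩ := Nat.find_spec hex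
  refine ⟨B, ι, y, fun C κ z hκ hz => ?_, h⟩
  have hle := Nat.find_min' hex ⟨C, κ ≫ ι, z, by rw [map_comp_apply', hz, h], rfl⟩
  rw [← hn] at hle
  exact (LinearMap.injective_iff_surjective_of_finrank_eq_finrank (f := κ.hom.toAlgHom.toLinearMap)
    (le_antisymm (LinearMap.finrank_le_finrank_of_injective (f := κ.hom.toAlgHom.toLinearMap) hκ)
      hle)).1 hκ

/-- The element `x` also comes from the image of `f`, which by minimality is all of `A`. -/
theorem IsMinimalElt.surjective {A B : SAlgf k} {x : X.obj A} (hx : IsMinimalElt x) (f : B ⟶ A)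
    (y : X.obj B) (h : X.map f y = x) : Function.Surjective f.hom.toAlgHom := by
  obtain ⟨C, g, ι, hι, hf, hr⟩ := SAlg.exists_image f.hom
  let C' : SAlgf k := ⟨C, SAlgf.finite_of_injective ι hι⟩
  let g' : B ⟶ C' := ⟨g⟩
  let ι' : C' ⟶ A := ⟨ι⟩
  have hf' : g' ≫ ι' = f := ObjectProperty.hom_ext _ hf
  exact fun a => (hr a).1 (hx C' ι' (X.map g' y) hι (by rw [← map_comp_apply', hf', h]) a)

theorem IsMinimalElt.of_iso {A B : SAlgf k} {x : X.obj A} (hx : IsMinimalElt x) (e : A ≅ B) :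
    IsMinimalElt (X.map e.hom x) := by
  intro C ι y hι hy
  have hsurj := hx.surjective (ι ≫ e.inv) y (by rw [map_comp_apply', hy, ← map_comp_apply', e.hom_inv_id]; simp)
  intro b
  obtain ⟨c, hc⟩ := hsurj (e.inv.hom.toAlgHom b)
  refine ⟨c, ?_⟩
  have := congrArg e.hom.hom.toAlgHom hc
  have h1 : ∀ b, e.hom.hom.toAlgHom (e.inv.hom.toAlgHom b) = b := fun b =>
    congrArg (fun q : B ⟶ B => q.hom.toAlgHom b) e.inv_hom_id
  exact (h1 _).symm.trans (this.trans (h1 _))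

/-- By left exactness `x` comes from the equalizer of `f` and `g`, which is therefore all of `A`. -/
theorem IsMinimalElt.hom_eq [Limits.PreservesFiniteLimits X] {A B : SAlgf k} {x : X.obj A}
    (hx : IsMinimalElt x) (f g : A ⟶ B) (h : X.map f x = X.map g x) : f = g := by
  obtain ⟨E, ι, z, hι, hfg, hz⟩ := exists_equalizer_lift X f g x h
  exact ObjectProperty.hom_ext _ (SAlg.hom_eq_of_surjective ι.hom (hx E ι z hι hz)
    (congrArg (fun q => q.hom) hfg))

variable (X) in
/-- The minimal elements of `X`, on superalgebras with underlying space `kⁿ`. -/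
structure MinimalPair where
  model : StandardSAlg k
  elt : X.obj model.toSAlgf
  isMinimal : IsMinimalElt elt

theorem exists_minimalPair {A : SAlgf k} (x : X.obj A) :
    ∃ (p : MinimalPair X) (f : p.model.toSAlgf ⟶ A), X.map f p.elt = x := by
  obtain ⟨B, ι, y, hy, rfl⟩ := exists_isMinimalElt x
  obtain ⟨S, ⟨e⟩⟩ := StandardSAlg.exists_iso B
  exact ⟨⟨S, X.map e.inv y, hy.of_iso e.symm⟩, e.hom ≫ ι, by
    rw [← map_comp_apply', e.inv_hom_id_assoc]⟩

/-- The morphism runs against the order: a larger pair has the larger algebra, as in a system of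
surjections A_μ → A_λ for λ ≤ μ. -/
instance : Preorder (MinimalPair X) where
  le p q := ∃ f : q.model.toSAlgf ⟶ p.model.toSAlgf, X.map f q.elt = p.elt
  le_refl p := ⟨𝟙 _, by simp⟩
  le_trans := by
    rintro p q r ⟨f, hf⟩ ⟨g, hg⟩
    exact ⟨g ≫ f, by rw [map_comp_apply', hg, hf]⟩

theorem isFormalSuperscheme_of_preservesFiniteLimits [Limits.PreservesFiniteLimits X] :
    IsFormalSuperscheme k X := by
  -- A morphism between minimal pairs is unique by `hom_eq`, so the chosen transition maps are
  -- automatically functorial.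
  let A : MinimalPair X ⥤ (SAlgf k)ᵒᵖ :=
    { obj p := Opposite.op p.model.toSAlgf
      map h := (leOfHom h).choose.op
      map_id p := congrArg Quiver.Hom.op
        (p.isMinimal.hom_eq _ (𝟙 _) (by rw [(leOfHom (𝟙 p)).choose_spec]; simp))
      map_comp {p q r} f g := congrArg Quiver.Hom.op
        (r.isMinimal.hom_eq _ ((leOfHom g).choose ≫ (leOfHom f).choose) (by
          rw [(leOfHom (f ≫ g)).choose_spec, map_comp_apply', (leOfHom g).choose_spec,
            (leOfHom f).choose_spec])) }
  refine (isFormalSuperscheme_iff X).2 ⟨MinimalPair X, inferInstance, ?_, ⟨fun p q => ?_⟩, A,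
    fun p q h => p.isMinimal.surjective _ q.elt (leOfHom h).choose_spec,
    ⟨⟨fun p => p.elt, fun p q h => (leOfHom h).choose_spec, fun B y => ?_,
      fun p B φ ψ h => p.isMinimal.hom_eq φ ψ h⟩⟩⟩
  -- Nonemptiness of the index set: the empty product supplies an element of X at the terminal
  -- superalgebra.
  · obtain ⟨B, -, z, -⟩ := exists_pi_lift X (J := PEmpty) (fun j => j.elim) (fun j => j.elim)
    obtain ⟨p, -⟩ := exists_minimalPair z
    exact ⟨p⟩
  -- Directedness: the two elements combine to one over the product algebra, and a minimal pair
  -- mapping to it dominates both.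
  · obtain ⟨B, π, z, hz⟩ := exists_pi_lift X (J := ULift Bool)
      (fun b => bif b.down then p.model.toSAlgf else q.model.toSAlgf)
      (fun b => by
        rcases b with ⟨_ | _⟩
        · exact q.elt
        · exact p.elt)
    obtain ⟨r, f, hf⟩ := exists_minimalPair z
    refine ⟨r, ⟨f ≫ π ⟨true⟩, ?_⟩, ⟨f ≫ π ⟨false⟩, ?_⟩⟩
    · rw [map_comp_apply', hf]
      exact hz ⟨true⟩
    · rw [map_comp_apply', hf]
      exact hz ⟨false⟩
  · exact exists_minimalPair y

theorem isFormalSuperscheme_iff_preservesFiniteLimits (X : SFFunt k) :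
    IsFormalSuperscheme k X ↔ Limits.PreservesFiniteLimits X :=
  ⟨fun h => h.preservesFiniteLimits, fun _ => isFormalSuperscheme_of_preservesFiniteLimits⟩

end ProRepresentability

/-! ### Surjectivity of projections from an inverse limit -/

section LinearInverseLimits

variable {k : Type u} [Field k] {J : Type u} [Preorder J] [IsDirectedOrder J]

/-- In an inverse system of finite-dimensional spaces with surjective transition maps, indexed by a
directed set, the projections of the inverse limit are surjective. -/
theorem exists_compatible_family (V : J → Type u) [∀ j, AddCommGroup (V j)] [∀ j, Module k (V j)]
    [∀ j, FiniteDimensional k (V j)] (f : ∀ i j, i ≤ j → V j →ₗ[k] V i)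
    (hf : ∀ i j h, Function.Surjective (f i j h)) (hid : ∀ i v, f i i le_rfl v = v)
    (hcomp : ∀ i j l hij hjl v, f i j hij (f j l hjl v) = f i l (hij.trans hjl) v)
    (j₀ : J) (v : V j₀) :
    ∃ a : ∀ j, V j, (∀ i j h, f i j h (a j) = a i) ∧ a j₀ = v := by
  classical
  -- The dual spaces form a direct system with injective transitions, so each embeds in the direct
  -- limit. No countability of `J` is needed.
  let D : J → Type u := fun j => Module.Dual k (V j)
  let _ : ∀ j, AddCommGroup (D j) := fun j => inferInstanceAs (AddCommGroup (Module.Dual k (V j)))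
  let _ : ∀ j, Module k (D j) := fun j => inferInstanceAs (Module k (Module.Dual k (V j)))
  let d : ∀ i j, i ≤ j → D i →ₗ[k] D j := fun i j h => (f i j h).dualMap
  have hd : ∀ i j h, Function.Injective (d i j h) := fun i j h =>
    LinearMap.dualMap_injective_of_surjective (hf i j h)
  have : DirectedSystem D fun i j h => d i j h :=
    ⟨fun i ξ => LinearMap.ext fun v => congrArg ξ (hid i v),
      fun i j l hlj hji ξ => LinearMap.ext fun v => congrArg ξ (hcomp l j i hlj hji v)⟩
  let ι : ∀ j, D j →ₗ[k] Module.DirectLimit D d := fun j => Module.DirectLimit.of k J D d j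
  have hι : LinearMap.ker (ι j₀) = ⊥ := by
    rw [LinearMap.ker_eq_bot']
    intro ξ hξ
    obtain ⟨l, hl, h0⟩ := Module.DirectLimit.of.zero_exact hξ
    exact hd _ _ hl (h0.trans (map_zero _).symm)
  -- A linear retraction extends evaluation at `v` to a functional `g` on the whole direct limit.
  -- Its restriction to the dual of `V j` is evaluation at a unique `a j`, because `V j` is
  -- finite-dimensional.
  obtain ⟨r, hr⟩ := (ι j₀).exists_leftInverse_of_injective hι
  let g := Module.Dual.eval k (V j₀) v ∘ₗ r
  let a : ∀ j, V j := fun j => (Module.evalEquiv k (V j)).symm (g ∘ₗ ι j)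
  have ha : ∀ j (ξ : D j), ξ (a j) = g (ι j ξ) := fun j ξ => by
    change ξ ((Module.evalEquiv k (V j)).symm (g ∘ₗ ι j)) = _
    rw [Module.apply_evalEquiv_symm_apply]
    rfl
  refine ⟨a, fun i j h => ?_, ?_⟩
  · refine Module.eval_apply_injective k (LinearMap.ext fun ξ => ?_)
    change ξ _ = ξ _
    rw [ha, ← Module.DirectLimit.of_f (hij := h)]
    exact ha j (d i j h ξ)
  · refine Module.eval_apply_injective k (LinearMap.ext fun ξ => ?_)
    change ξ _ = ξ _
    rw [ha]
    exact congrArg (Module.Dual.eval k (V j₀) v) (LinearMap.congr_fun hr ξ)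

end LinearInverseLimits

/-! ### Profinite superalgebras and their finite quotients -/

namespace PSAlg

variable {k : Type u} [Field k]

/-- A morphism of superalgebras to a finite-dimensional superalgebra is continuous if it vanishes
on an open superideal. -/
def homOfVanishing {P : PSAlg k} {B : SAlgf k} (f : P.toSAlg ⟶ B.obj)
    (I : OpenSuperideal P.toSAlg) (hf : ∀ a ∈ I.ideal, f.toAlgHom a = 0) : P ⟶ discreteObj B where
  hom := f
  continuous := by
    let _ : TopologicalSpace B.obj.carrier := ⊥
    have : DiscreteTopology B.obj.carrier := ⟨rfl⟩
    change Continuous f.toAlgHom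
    refine continuous_of_continuousAt_zero f.toAlgHom ?_
    rw [ContinuousAt, map_zero, nhds_discrete B.obj.carrier, Filter.tendsto_pure]
    exact Filter.mem_of_superset (I.isOpen.mem_nhds I.ideal.zero_mem) hf

/-- The kernel of a continuous morphism to a finite-dimensional superalgebra. -/
def openKernel {P : PSAlg k} {B : SAlgf k} (f : P ⟶ discreteObj B) :
    OpenSuperideal P.toSAlg where
  ideal := RingHom.ker f.hom.toAlgHom
  homogeneous := fun i a ha => by
    change f.hom.toAlgHom (proj P.toSAlg.gr i a) = 0
    rw [SAlg.Hom.map_proj, (ha : f.hom.toAlgHom a = 0), map_zero]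
  isOpen := by
    let _ : TopologicalSpace B.obj.carrier := ⊥
    have : DiscreteTopology B.obj.carrier := ⟨rfl⟩
    have h : Continuous f.hom.toAlgHom := f.continuous
    exact IsOpen.preimage h (isOpen_discrete ({0} : Set B.obj.carrier))
  finite := by
    let K := (RingHom.ker f.hom.toAlgHom).restrictScalars k
    let g : (P.toSAlg.carrier ⧸ K) →ₗ[k] B.obj.carrier :=
      K.liftQ f.hom.toAlgHom.toLinearMap fun a ha => ha
    have hg : Function.Injective g := by
      rw [← LinearMap.ker_eq_bot]
      exact Submodule.ker_liftQ_eq_bot _ _ _ fun a ha => ha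
    exact Module.Finite.of_injective g hg

/-- The open superideals, ordered by reverse inclusion. -/
instance (A : SAlg k) [TopologicalSpace A.carrier] : Preorder (OpenSuperideal A) where
  le I J := J.ideal ≤ I.ideal
  le_refl _ := le_rfl
  le_trans _ _ _ h h' := le_trans h' h

section Quotients

variable (P : PSAlg k)

/-- The finite-dimensional quotient by an open superideal. -/
def quot (I : OpenSuperideal P.toSAlg) : SAlgf k :=
  ⟨P.toSAlg.quot I.ideal I.homogeneous, I.finite⟩

/-- The projection to the quotient by an open superideal. -/
def quotπ (I : OpenSuperideal P.toSAlg) : P ⟶ discreteObj (P.quot I) :=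
  homOfVanishing (B := P.quot I) (P.toSAlg.quotπ I.ideal I.homogeneous) I
    fun _ ha => (SAlg.quotπ_eq_zero_iff I.homogeneous).2 ha

theorem quotπ_surjective (I : OpenSuperideal P.toSAlg) :
    Function.Surjective (P.quotπ I).hom.toAlgHom :=
  P.toSAlg.quotπ_surjective I.ideal I.homogeneous

theorem quotπ_eq_zero_iff (I : OpenSuperideal P.toSAlg) {a : P.toSAlg.carrier} :
    (P.quotπ I).hom.toAlgHom a = 0 ↔ a ∈ I.ideal :=
  SAlg.quotπ_eq_zero_iff I.homogeneous

theorem exists_quot_trans {I J : OpenSuperideal P.toSAlg} (h : I ≤ J) :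
    ∃ f : P.quot J ⟶ P.quot I,
      ∀ a, f.hom.toAlgHom ((P.quotπ J).hom.toAlgHom a) = (P.quotπ I).hom.toAlgHom a := by
  obtain ⟨g, hg⟩ := SAlg.exists_factor (P.quotπ J).hom (P.quotπ_surjective J) (P.quotπ I).hom
    fun a ha => (P.quotπ_eq_zero_iff I).2 (h ((P.quotπ_eq_zero_iff J).1 ha))
  exact ⟨⟨g⟩, fun a => congrArg (fun f => f.toAlgHom a) hg⟩

theorem quot_hom_ext {I : OpenSuperideal P.toSAlg} {B : SAlgf k} {f g : P.quot I ⟶ B}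
    (h : ∀ a, f.hom.toAlgHom ((P.quotπ I).hom.toAlgHom a) =
      g.hom.toAlgHom ((P.quotπ I).hom.toAlgHom a)) : f = g :=
  ObjectProperty.hom_ext _ (SAlg.hom_eq_of_surjective (P.quotπ I).hom (P.quotπ_surjective I)
    (SAlg.hom_ext h))

/-- The system of finite-dimensional discrete quotients of a profinite superalgebra. -/
def quotSystem : OpenSuperideal P.toSAlg ⥤ (SAlgf k)ᵒᵖ where
  obj I := Opposite.op (P.quot I)
  map h := (P.exists_quot_trans (leOfHom h)).choose.op
  map_id I := congrArg Quiver.Hom.op (P.quot_hom_ext (g := 𝟙 _)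
    (P.exists_quot_trans (leOfHom (𝟙 I))).choose_spec)
  map_comp f g := congrArg Quiver.Hom.op (P.quot_hom_ext
    (g := (P.exists_quot_trans (leOfHom g)).choose ≫ (P.exists_quot_trans (leOfHom f)).choose) (by
      intro a
      rw [(P.exists_quot_trans (leOfHom (f ≫ g))).choose_spec,
        ← (P.exists_quot_trans (leOfHom f)).choose_spec,
        ← (P.exists_quot_trans (leOfHom g)).choose_spec]
      rfl))

theorem quotπ_quotSystem {I J : OpenSuperideal P.toSAlg} (h : I ⟶ J) :
    P.quotπ J ≫ (discrete k).map (P.quotSystem.map h).unop = P.quotπ I :=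
  Hom.ext (SAlg.hom_ext (P.exists_quot_trans (leOfHom h)).choose_spec)

instance : Nonempty (OpenSuperideal P.toSAlg) := by
  obtain ⟨I, -⟩ := P.basis Set.univ Filter.univ_mem
  exact ⟨I⟩

instance : IsDirectedOrder (OpenSuperideal P.toSAlg) := ⟨fun I J => by
  obtain ⟨L, hL⟩ := P.basis ((I.ideal : Set P.toSAlg.carrier) ∩ J.ideal)
    (Filter.inter_mem (I.isOpen.mem_nhds I.ideal.zero_mem)
      (J.isOpen.mem_nhds J.ideal.zero_mem))
  exact ⟨L, fun a ha => (hL ha).1, fun a ha => (hL ha).2⟩⟩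

variable {P}

/-- A cofinal system of finite-dimensional discrete quotients of `P` presents `PSSpf P`. -/
def presentation {J : Type u} [Preorder J] (A : J ⥤ (SAlgf k)ᵒᵖ)
    (π : ∀ j, P ⟶ discreteObj (A.obj j).unop)
    (hπ : ∀ (i j : J) (h : i ⟶ j), π j ≫ (discrete k).map (A.map h).unop = π i)
    (hsurj : ∀ j, Function.Surjective (π j).hom.toAlgHom)
    (hker : ∀ I : OpenSuperideal P.toSAlg, ∃ j, openKernel (π j) ≥ I) :
    Presentation ((PSSpf k).obj (Opposite.op P)) A where
  elt := π
  map_elt := hπ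
  exists_map B y := by
    obtain ⟨j, hj⟩ := hker (openKernel (P := P) (B := B) y)
    -- The order on open superideals is reverse inclusion, so `hj` says that the kernel of `π j`
    -- lies in that of `y`.
    obtain ⟨g, hg⟩ := SAlg.exists_factor (π j).hom (hsurj j) (Hom.hom y) fun a ha => hj ha
    exact ⟨j, ⟨g⟩, Hom.ext hg⟩
  map_inj j B φ ψ h := ObjectProperty.hom_ext _
    (SAlg.hom_eq_of_surjective (π j).hom (hsurj j) (congrArg Hom.hom h))

variable (P) in
/-- The presentation of `PSSpf P` by all finite-dimensional discrete quotients of `P`. -/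
def quotPresentation : Presentation ((PSSpf k).obj (Opposite.op P)) P.quotSystem :=
  presentation P.quotSystem P.quotπ (fun _ _ h => P.quotπ_quotSystem h) P.quotπ_surjective
    fun I => ⟨I, fun _ ha => (P.quotπ_eq_zero_iff I).1 ha⟩

theorem quotSystem_surjectiveTransitions : SurjectiveTransitions P.quotSystem := by
  intro I J h b
  obtain ⟨a, rfl⟩ := P.quotπ_surjective I b
  exact ⟨(P.quotπ J).hom.toAlgHom a,
    congrArg (fun f => (Hom.hom f).toAlgHom a) (P.quotπ_quotSystem h)⟩

theorem isFormalSuperscheme_PSSpf (P : (PSAlg k)ᵒᵖ) :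
    IsFormalSuperscheme k ((PSSpf k).obj P) :=
  (isFormalSuperscheme_iff _).2 ⟨OpenSuperideal P.unop.toSAlg, inferInstance, inferInstance,
    inferInstance, P.unop.quotSystem, quotSystem_surjectiveTransitions, ⟨P.unop.quotPresentation⟩⟩

theorem existsUnique_of_compatible (x : ∀ I, (P.quot I).obj.carrier)
    (hx : ∀ (I J : OpenSuperideal P.toSAlg) (h : I ⟶ J),
      (P.quotSystem.map h).unop.hom.toAlgHom (x J) = x I) :
    ∃! a : P.toSAlg.carrier, ∀ I, (P.quotπ I).hom.toAlgHom a = x I := by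
  refine P.limit x fun I J h => ?_
  obtain ⟨a, ha⟩ := P.quotπ_surjective I (x I)
  rw [← hx J I (homOfLE h), ← ha]
  exact (congrArg (fun f => (Hom.hom f).toAlgHom a) (P.quotπ_quotSystem (homOfLE h))).symm

theorem quotπ_quotSystem_apply {I J : OpenSuperideal P.toSAlg} (h : I ⟶ J) (a : P.toSAlg.carrier) :
    (P.quotSystem.map h).unop.hom.toAlgHom ((P.quotπ J).hom.toAlgHom a) =
      (P.quotπ I).hom.toAlgHom a :=
  congrArg (fun f => (Hom.hom f).toAlgHom a) (P.quotπ_quotSystem h)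

/-- This is the uniqueness half of the limit condition: the open superideals separate points. -/
theorem eq_of_quotπ_eq {a b : P.toSAlg.carrier}
    (h : ∀ I, (P.quotπ I).hom.toAlgHom a = (P.quotπ I).hom.toAlgHom b) : a = b :=
  (existsUnique_of_compatible (fun I => (P.quotπ I).hom.toAlgHom b)
    fun _ _ h => quotπ_quotSystem_apply h b).unique h fun _ => rfl

/-- The universal property of a profinite superalgebra as an inverse limit of its quotients. -/
theorem exists_lift {Q : PSAlg k} (y : ∀ I, Q ⟶ discreteObj (P.quot I))
    (hy : ∀ (I J : OpenSuperideal P.toSAlg) (h : I ⟶ J),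
      y J ≫ (discrete k).map (P.quotSystem.map h).unop = y I) :
    ∃ f : Q ⟶ P, ∀ I, f ≫ P.quotπ I = y I := by
  have hex := fun q : Q.toSAlg.carrier => (existsUnique_of_compatible
    (fun I => (y I).hom.toAlgHom q)
    fun I J h => congrArg (fun f => (Hom.hom f).toAlgHom q) (hy I J h)).exists
  choose F hF using hex
  let f : Q.toSAlg.carrier →ₐ[k] P.toSAlg.carrier :=
    { toFun := F
      map_one' := eq_of_quotπ_eq fun I => by rw [hF, map_one, map_one]
      map_zero' := eq_of_quotπ_eq fun I => by rw [hF, map_zero, map_zero]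
      map_mul' := fun a b => eq_of_quotπ_eq fun I => by rw [map_mul, hF, hF, hF, map_mul]
      map_add' := fun a b => eq_of_quotπ_eq fun I => by rw [map_add, hF, hF, hF, map_add]
      commutes' := fun c => eq_of_quotπ_eq fun I => by
        rw [hF, AlgHom.commutes, AlgHom.commutes] }
  have hgr : ∀ i, ∀ q ∈ Q.toSAlg.gr i, f q ∈ P.toSAlg.gr i :=
    map_gr_of_map_proj (f := f.toLinearMap) Q.toSAlg.gr P.toSAlg.gr fun i q =>
      eq_of_quotπ_eq fun I => by
        change (P.quotπ I).hom.toAlgHom (F _) = (P.quotπ I).hom.toAlgHom (proj _ i (F q))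
        rw [hF, SAlg.Hom.map_proj, SAlg.Hom.map_proj, hF]
  refine ⟨⟨⟨f, hgr⟩, ?_⟩, fun I => Hom.ext (SAlg.hom_ext fun q => hF q I)⟩
  change Continuous f
  refine continuous_of_continuousAt_zero f ?_
  rw [ContinuousAt, map_zero]
  intro U hU
  -- A neighbourhood of zero contains some open superideal `I`, and the preimage of `I` under `f` is
  -- the open kernel of `y I`.
  obtain ⟨I, hI⟩ := P.basis U hU
  have hK := (openKernel (y I)).isOpen.mem_nhds (openKernel (y I)).ideal.zero_mem
  refine Filter.mem_map.2 (Filter.mem_of_superset hK fun q hq => hI ?_)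
  exact (P.quotπ_eq_zero_iff I).1 ((hF q I).trans hq)

end Quotients

/-- Evaluating the natural transformations at the projections P → P/I shows that the two morphisms
agree modulo every `I`. -/
instance : (PSSpf k).Faithful where
  map_injective {P Q} f g h := by
    refine Quiver.Hom.unop_inj (Hom.ext (SAlg.hom_ext fun a => eq_of_quotπ_eq fun I => ?_))
    have h1 := congrArg (fun η => η.app (P.unop.quot I) (P.unop.quotπ I)) h
    exact congrArg (fun q => (Hom.hom q).toAlgHom a) h1

/-- The images under `η` of the projections P → P/I form a compatible family of morphisms Q → P/I,
hence a morphism Q → P; it induces `η` because the projections generate `PSSpf P`. -/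
instance : (PSSpf k).Full where
  map_surjective {P Q} η := by
    obtain ⟨f, hf⟩ := exists_lift (P := P.unop) (Q := Q.unop)
      (fun I => η.app (P.unop.quot I) (P.unop.quotπ I)) (fun I J h => by
        have := naturality_apply' η (P.unop.quotSystem.map h).unop (P.unop.quotπ J)
        rw [← P.unop.quotπ_quotSystem h]
        exact this.symm)
    exact ⟨f.op, P.unop.quotPresentation.hom_ext hf⟩

end PSAlg

/-! ### Inverse limits of systems of finite-dimensional superalgebras -/

section TransitionMaps

variable {k : Type u} [Field k] {J : Type u} [Preorder J] (A : J ⥤ (SAlgf k)ᵒᵖ)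

/-- The transition map `A_j → A_i` of a system of superalgebras, as an algebra homomorphism. -/
def trans {i j : J} (h : i ≤ j) : (A.obj j).unop.obj.carrier →ₐ[k] (A.obj i).unop.obj.carrier :=
  (A.map (homOfLE h)).unop.hom.toAlgHom

theorem trans_refl (i : J) (a : (A.obj i).unop.obj.carrier) : trans A (le_refl i) a = a := by
  change (A.map (𝟙 i)).unop.hom.toAlgHom a = a
  rw [A.map_id]
  rfl

theorem trans_trans {i j l : J} (hij : i ≤ j) (hjl : j ≤ l) (a : (A.obj l).unop.obj.carrier) :
    trans A hij (trans A hjl a) = trans A (hij.trans hjl) a := by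
  change _ = (A.map (homOfLE hij ≫ homOfLE hjl)).unop.hom.toAlgHom a
  rw [A.map_comp]
  rfl

theorem trans_proj {i j : J} (h : i ≤ j) (p : ZMod 2) (a : (A.obj j).unop.obj.carrier) :
    trans A h (proj (A.obj j).unop.obj.gr p a) = proj (A.obj i).unop.obj.gr p (trans A h a) :=
  SAlg.Hom.map_proj _ p a

end TransitionMaps

namespace PSAlg

section InverseLimit

variable {k : Type u} [Field k] {J : Type u} [Preorder J] (A : J ⥤ (SAlgf k)ᵒᵖ)

/-- The compatible families in the product of a system of superalgebras. -/
def compatible : Subalgebra k (∀ j, (A.obj j).unop.obj.carrier) where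
  carrier := {a | ∀ i j (h : i ≤ j), trans A h (a j) = a i}
  mul_mem' ha hb i j h := by simp [ha i j h, hb i j h]
  add_mem' ha hb i j h := by simp [ha i j h, hb i j h]
  algebraMap_mem' c i j h := by simp

/-- The inverse limit of a system of superalgebras. -/
def invLimit : SAlg k :=
  (SAlg.pi fun j => (A.obj j).unop.obj).sub (compatible A) fun p a ha i j h => by
    refine (congrArg (trans A h)
      (SAlg.pi_proj_apply (fun j => (A.obj j).unop.obj) p a j)).trans ?_
    refine (trans_proj A h p (a j)).trans ?_
    rw [ha i j h]
    exact (SAlg.pi_proj_apply (fun j => (A.obj j).unop.obj) p a i).symm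

/-- The projections of the inverse limit. -/
def invLimitπ (j : J) : invLimit A ⟶ (A.obj j).unop.obj :=
  SAlg.subι _ _ _ ≫ SAlg.piπ (fun j => (A.obj j).unop.obj) j

theorem invLimit_ext {a b : (invLimit A).carrier}
    (h : ∀ j, (invLimitπ A j).toAlgHom a = (invLimitπ A j).toAlgHom b) : a = b :=
  Subtype.ext (funext h)

theorem trans_invLimitπ {i j : J} (h : i ≤ j) (a : (invLimit A).carrier) :
    trans A h ((invLimitπ A j).toAlgHom a) = (invLimitπ A i).toAlgHom a := a.2 i j h

theorem exists_invLimit (a : ∀ j, (A.obj j).unop.obj.carrier)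
    (ha : ∀ i j (h : i ≤ j), trans A h (a j) = a i) :
    ∃ b : (invLimit A).carrier, ∀ j, (invLimitπ A j).toAlgHom b = a j :=
  ⟨⟨a, ha⟩, fun _ => rfl⟩

/-- The topology of the inverse limit of discrete superalgebras. -/
instance invLimitTopology : TopologicalSpace (invLimit A).carrier :=
  letI : ∀ j, TopologicalSpace (A.obj j).unop.obj.carrier := fun _ => ⊥
  inferInstanceAs (TopologicalSpace (compatible A))

instance : IsTopologicalRing (invLimit A).carrier := by
  let _ : ∀ j, TopologicalSpace (A.obj j).unop.obj.carrier := fun _ => ⊥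
  have : ∀ j, DiscreteTopology (A.obj j).unop.obj.carrier := fun _ => ⟨rfl⟩
  exact inferInstanceAs (IsTopologicalRing (compatible A).toSubring)

theorem isOpen_ker_invLimitπ (j : J) :
    IsOpen {a : (invLimit A).carrier | (invLimitπ A j).toAlgHom a = 0} := by
  let _ : ∀ j, TopologicalSpace (A.obj j).unop.obj.carrier := fun _ => ⊥
  have : ∀ j, DiscreteTopology (A.obj j).unop.obj.carrier := fun _ => ⟨rfl⟩
  have h : Continuous fun a : compatible A => a.1 j :=
    (continuous_apply j).comp continuous_subtype_val
  exact IsOpen.preimage h (isOpen_discrete ({0} : Set (A.obj j).unop.obj.carrier))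

/-- A basic neighbourhood in the product restricts finitely many coordinates. An upper bound `j` of
their indices works, since vanishing at `j` forces vanishing at all smaller indices. -/
theorem exists_ker_invLimitπ_subset [IsDirectedOrder J] [Nonempty J]
    {U : Set (invLimit A).carrier} (hU : U ∈ nhds 0) :
    ∃ j, ∀ a, (invLimitπ A j).toAlgHom a = 0 → a ∈ U := by
  let _ : ∀ j, TopologicalSpace (A.obj j).unop.obj.carrier := fun _ => ⊥
  have : ∀ j, DiscreteTopology (A.obj j).unop.obj.carrier := fun _ => ⟨rfl⟩
  have hU' : (U : Set (compatible A)) ∈ nhds (0 : compatible A) := hU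
  rw [nhds_subtype_eq_comap] at hU'
  obtain ⟨V, hV, hVU⟩ := hU'
  rw [nhds_pi, Filter.mem_pi'] at hV
  obtain ⟨F, t, ht, hF⟩ := hV
  obtain ⟨j, hj⟩ := F.exists_le
  refine ⟨j, fun a ha => hVU (hF fun i hi => ?_)⟩
  have h0 : a.1 i = 0 := by
    have := trans_invLimitπ A (hj i hi) a
    rw [ha, map_zero] at this
    exact this.symm
  change a.1 i ∈ t i
  rw [h0]
  exact mem_of_mem_nhds (ht i)

/-- The kernel of a projection of the inverse limit. -/
def kerInvLimitπ (j : J) : OpenSuperideal (invLimit A) where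
  ideal := RingHom.ker (invLimitπ A j).toAlgHom
  homogeneous := fun i a ha => by
    change (invLimitπ A j).toAlgHom (proj (invLimit A).gr i a) = 0
    rw [SAlg.Hom.map_proj, (ha : (invLimitπ A j).toAlgHom a = 0), map_zero]
  isOpen := isOpen_ker_invLimitπ A j
  finite := by
    let K := (RingHom.ker (invLimitπ A j).toAlgHom).restrictScalars k
    let g : ((invLimit A).carrier ⧸ K) →ₗ[k] (A.obj j).unop.obj.carrier :=
      K.liftQ (invLimitπ A j).toAlgHom.toLinearMap fun a ha => ha
    have hg : Function.Injective g := by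
      rw [← LinearMap.ker_eq_bot]
      exact Submodule.ker_liftQ_eq_bot _ _ _ fun a ha => ha
    exact Module.Finite.of_injective g hg

/-- The kernels of the projections are cofinal among the open superideals, so a compatible family
modulo all of them is determined by its values modulo these kernels, and those values define a
compatible family in the A_j. -/
theorem invLimit_existsUnique [IsDirectedOrder J] [Nonempty J]
    (x : ∀ I : OpenSuperideal (invLimit A), (invLimit A).carrier ⧸ I.ideal)
    (hx : ∀ (I K : OpenSuperideal (invLimit A)) (h : I.ideal ≤ K.ideal),
      Submodule.factor h (x I) = x K) :
    ∃! a : (invLimit A).carrier, ∀ I, Submodule.Quotient.mk a = x I := by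
  choose r hr using fun I => Submodule.Quotient.mk_surjective _ (x I)
  have hle : ∀ {i j} (h : i ≤ j), (kerInvLimitπ A j).ideal ≤ (kerInvLimitπ A i).ideal := by
    intro i j h a ha
    change (invLimitπ A i).toAlgHom a = 0
    rw [← trans_invLimitπ A h, (ha : (invLimitπ A j).toAlgHom a = 0), map_zero]
  have hr' : ∀ (I K : OpenSuperideal (invLimit A)), I.ideal ≤ K.ideal → r I - r K ∈ K.ideal := by
    intro I K h
    rw [← Submodule.Quotient.eq, hr K, ← hx I K h, ← hr I]
    rfl
  obtain ⟨a, ha⟩ := exists_invLimit A (fun j => (invLimitπ A j).toAlgHom (r (kerInvLimitπ A j)))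
    fun i j h => by
      rw [trans_invLimitπ, ← sub_eq_zero, ← map_sub]
      exact hr' _ _ (hle h)
  refine ⟨a, fun I => ?_, fun b hb => invLimit_ext A fun j => ?_⟩
  · obtain ⟨j, hj⟩ := exists_ker_invLimitπ_subset A (I.isOpen.mem_nhds I.ideal.zero_mem)
    have hj' : (kerInvLimitπ A j).ideal ≤ I.ideal := hj
    -- Compare `a` and the representative for `I` through the representative for a kernel contained
    -- in `I`.
    rw [← hr I, Submodule.Quotient.eq, ← sub_add_sub_cancel a (r (kerInvLimitπ A j)) (r I)]
    refine add_mem (hj _ ?_) (hr' _ _ hj')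
    rw [map_sub, ha, sub_self]
  · have := hb (kerInvLimitπ A j)
    rw [← hr, Submodule.Quotient.eq] at this
    rw [ha, ← sub_eq_zero, ← map_sub]
    exact this

/-- The inverse limit of a directed system of finite-dimensional superalgebras, as a profinite
superalgebra. -/
def ofSystem [IsDirectedOrder J] [Nonempty J] : PSAlg k where
  toSAlg := invLimit A
  basis U hU := by
    obtain ⟨j, hj⟩ := exists_ker_invLimitπ_subset A hU
    exact ⟨kerInvLimitπ A j, hj⟩
  limit := invLimit_existsUnique A

theorem invLimitπ_surjective [IsDirectedOrder J] (hA : SurjectiveTransitions A) (j : J) :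
    Function.Surjective (invLimitπ A j).toAlgHom := by
  intro b
  obtain ⟨a, ha, hb⟩ := exists_compatible_family (k := k)
    (fun j => (A.obj j).unop.obj.carrier) (fun i j h => (trans A h).toLinearMap)
    (fun _ _ h => hA _ _ (homOfLE h)) (trans_refl A) (fun i j l => trans_trans A) j b
  obtain ⟨c, hc⟩ := exists_invLimit A a ha
  exact ⟨c, (hc j).trans hb⟩

/-- The presentation of `PSSpf` of an inverse limit by the given system. -/
def ofSystemPresentation [IsDirectedOrder J] [Nonempty J] (hA : SurjectiveTransitions A) :
    Presentation ((PSSpf k).obj (Opposite.op (ofSystem A))) A :=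
  presentation A
    (fun j => homOfVanishing (P := ofSystem A) (invLimitπ A j) (kerInvLimitπ A j) fun _ h => h)
    (fun _ _ h => Hom.ext (SAlg.hom_ext fun a => trans_invLimitπ A (leOfHom h) a))
    (invLimitπ_surjective A hA)
    (fun I => exists_ker_invLimitπ_subset A (I.isOpen.mem_nhds I.ideal.zero_mem))

end InverseLimit

variable {k : Type u} [Field k]

/-- A system presenting X also presents `PSSpf` of its inverse limit. -/
theorem exists_iso_PSSpf {X : SFFunt k} (hX : IsFormalSuperscheme k X) :
    ∃ P : PSAlg k, Nonempty ((PSSpf k).obj (Opposite.op P) ≅ X) := by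
  obtain ⟨J, _, _, _, A, hA, ⟨Q⟩⟩ := (isFormalSuperscheme_iff X).1 hX
  exact ⟨ofSystem A, ⟨(ofSystemPresentation A hA).iso Q⟩⟩

theorem isEquivalence_PSSpf (h : ∀ A : (PSAlg k)ᵒᵖ, IsFormalSuperscheme k ((PSSpf k).obj A)) :
    ((IsFormalSuperscheme k).lift (PSSpf k) h : (PSAlg k)ᵒᵖ ⥤ FormalSuperscheme k).IsEquivalence :=
  { essSurj := ⟨fun X => by
      obtain ⟨P, ⟨e⟩⟩ := exists_iso_PSSpf X.property
      exact ⟨Opposite.op P, ⟨(IsFormalSuperscheme k).isoMk e⟩⟩⟩ }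

end PSAlg

/-! ### The signed product is the opposite product -/

section SignedMul

variable {k : Type u} [Field k]

/-- The Koszul sign in front of ab is exactly the one produced by exchanging the factors in a
supercommutative algebra. Hence `dualComul` is dual to (a, b) ↦ ba for the unsigned pairing, and
signs need not be tracked further for it. -/
theorem signedMul_eq (A : SAlg k) (a b : A.carrier) : signedMul A (a ⊗ₜ[k] b) = b * a := by
  rw [← signedMul_comm, signedMul, LinearMap.comp_apply, koszul_koszul, LinearMap.mul'_apply]

theorem SAlg.mul_comm_sgn (A : SAlg k) {i j : ZMod 2} {a b : A.carrier} (ha : a ∈ A.gr i)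
    (hb : b ∈ A.gr j) : b * a = sgn k i j • (a * b) := by
  rw [← signedMul_eq, signedMul_tmul A ha hb]

theorem sgn_zero_left (i : ZMod 2) : sgn k 0 i = 1 := by simp [sgn]

theorem sgn_zero_right (i : ZMod 2) : sgn k i 0 = 1 := by simp [sgn]

end SignedMul

theorem TensorOver.exists_lift {k : Type u} [Field k] {R : SAlg k} {M N W : Type u}
    [AddCommGroup M] [Module k M] [Module R.carrier M] {ℳ : ZMod 2 → Submodule k M}
    [AddCommGroup N] [Module k N] [Module R.carrier N] [AddCommGroup W] [Module k W]
    (F : M ⊗[k] N →ₗ[k] W) (hF : balanced R ℳ N ≤ LinearMap.ker F) :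
    ∃ L : TensorOver R ℳ N →ₗ[k] W, ∀ x y, L (TensorOver.mk R ℳ N x y) = F (x ⊗ₜ[k] y) :=
  ⟨(balanced R ℳ N).liftQ F hF, fun _ _ => rfl⟩

/-! ### The group-like equation inside R ⊗ C ⊗ C -/

section RightAction

variable {k : Type u} [Field k] (R : SAlg k) (C : SCoalg k)

/-- The bilinear map `(x, b ⊗ d) ↦ (b • x) ⊗ d`. -/
def actTensor : BaseChange R C →ₗ[k] BaseChange R C →ₗ[k]
    R.carrier ⊗[k] (C.carrier ⊗[k] C.carrier) :=
  LinearMap.flip (TensorProduct.lift (LinearMap.mk₂ k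
    (fun b d => (TensorProduct.assoc k R.carrier C.carrier C.carrier).toLinearMap ∘ₗ
      (TensorProduct.mk k (BaseChange R C) C.carrier).flip d ∘ₗ
      LinearMap.lsmul k (BaseChange R C) 1 ∘ₗ
      (LinearMap.mulLeft k b).rTensor C.carrier)
    (fun b b' d => by ext; simp [add_mul, TensorProduct.add_tmul])
    (fun c b d => by ext; simp [TensorProduct.smul_tmul'])
    (fun b d d' => by ext; simp)
    (fun c b d => by ext; simp)))

theorem actTensor_tmul (x : BaseChange R C) (b : R.carrier) (d : C.carrier) :
    actTensor R C x (b ⊗ₜ[k] d) =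
      TensorProduct.assoc k R.carrier C.carrier C.carrier ((b • x) ⊗ₜ[k] d) := by
  induction x using TensorProduct.induction_on with
  | zero => simp
  | add x y hx hy => simp only [map_add, LinearMap.add_apply, smul_add, TensorProduct.add_tmul,
      hx, hy]
  | tmul a c => simp [actTensor, TensorProduct.smul_tmul']

theorem actTensor_tmul_tmul (a b : R.carrier) (c d : C.carrier) :
    actTensor R C (a ⊗ₜ[k] c) (b ⊗ₜ[k] d) = (b * a) ⊗ₜ[k] (c ⊗ₜ[k] d) := by
  rw [actTensor_tmul, TensorProduct.smul_tmul', smul_eq_mul, TensorProduct.assoc_tmul]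

theorem smul_mem_baseGr {i j : ZMod 2} {r : R.carrier} {x : BaseChange R C} (hr : r ∈ R.gr j)
    (hx : x ∈ baseGr R C i) : r • x ∈ baseGr R C (i + j) := by
  have h : baseGr R C i ≤ (baseGr R C (i + j)).comap
      ((LinearMap.mulLeft k r).rTensor C.carrier) := by
    refine iSup_le fun l => Submodule.map₂_le.2 fun a ha c hc => ?_
    have := tmul_mem_tensorGr R.gr C.gr (SetLike.mul_mem_graded hr ha) hc
    rw [show j + l + (i - l) = i + j by ring] at this
    exact this
  have hs : ∀ x : BaseChange R C, r • x = (LinearMap.mulLeft k r).rTensor C.carrier x := fun x => by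
    induction x using TensorProduct.induction_on with
    | zero => simp
    | add x y hx hy => rw [smul_add, map_add, hx, hy]
    | tmul a c => rw [TensorProduct.smul_tmul']; rfl
  rw [hs]
  exact h hx

theorem baseChange_mem_span_homogeneous (y : BaseChange R C) :
    y ∈ Submodule.span k {z | ∃ i, ∃ b ∈ R.gr i, ∃ d : C.carrier, z = b ⊗ₜ[k] d} := by
  induction y using TensorProduct.induction_on with
  | zero => exact zero_mem _
  | add x y hx hy => exact add_mem hx hy
  | tmul b d =>
    rw [← proj_add_proj R.gr b, TensorProduct.add_tmul]
    exact add_mem (Submodule.subset_span ⟨0, _, proj_mem _ _ _, d, rfl⟩)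
      (Submodule.subset_span ⟨1, _, proj_mem _ _ _, d, rfl⟩)

/-- Only the factor from `R` is taken homogeneous: the sign of the right action involves the parity
of `b` and not that of `d`. -/
theorem baseChange_linearMap_ext {W : Type u} [AddCommGroup W] [Module k W]
    {f g : BaseChange R C →ₗ[k] W}
    (h : ∀ i, ∀ b ∈ R.gr i, ∀ d : C.carrier, f (b ⊗ₜ[k] d) = g (b ⊗ₜ[k] d)) : f = g := by
  refine LinearMap.ext fun y => ?_
  refine LinearMap.eqOn_span (R := k) ?_ (baseChange_mem_span_homogeneous R C y)
  rintro _ ⟨i, b, hb, d, rfl⟩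
  exact h i b hb d

/-- The parity involution of `R ⊗ C`. -/
def parity : BaseChange R C →ₗ[k] BaseChange R C :=
  TensorProduct.map (proj R.gr 0 - proj R.gr 1) (proj C.gr 0 - proj C.gr 1)

/-- The involution encodes the sign (-1)^{|x|} of moving `x` past an odd scalar as a linear map, so
that `rightAct` is defined on all `x`, homogeneous or not. -/
theorem parity_apply {i : ZMod 2} {x : BaseChange R C} (hx : x ∈ baseGr R C i) :
    parity R C x = sgn k i 1 • x := by
  have h : baseGr R C i ≤ LinearMap.eqLocus (parity R C) (sgn k i 1 • LinearMap.id) := by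
    refine iSup_le fun l => Submodule.map₂_le.2 fun a ha c hc => ?_
    change parity R C (a ⊗ₜ[k] c) = sgn k i 1 • (a ⊗ₜ[k] c)
    simp only [parity, TensorProduct.map_tmul, LinearMap.sub_apply, proj_of_mem _ _ ha,
      proj_of_mem _ _ hc]
    have h01 : ∀ i : ZMod 2, i = 0 ∨ i = 1 := by decide
    have e1 : (0 : ZMod 2) - 1 = 1 := by decide
    rcases h01 l with rfl | rfl <;> rcases h01 i with rfl | rfl <;>
      simp [sgn, ZMod.val_one, e1, TensorProduct.neg_tmul, TensorProduct.tmul_neg] <;>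
      exact (neg_one_smul k (a ⊗ₜ[k] c)).symm
  exact h hx

/-- The map `x ⊗ (b ⊗ d) ↦ x · b ⊗ d` for the signed right action. -/
def rightAct : BaseChange R C ⊗[k] BaseChange R C →ₗ[k]
    R.carrier ⊗[k] (C.carrier ⊗[k] C.carrier) :=
  TensorProduct.lift ((actTensor R C).compl₂ ((proj R.gr 0).rTensor C.carrier) +
    (actTensor R C ∘ₗ parity R C).compl₂ ((proj R.gr 1).rTensor C.carrier))

theorem rightAct_tmul {i j : ZMod 2} {x : BaseChange R C} (hx : x ∈ baseGr R C i) {b : R.carrier}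
    (hb : b ∈ R.gr j) (d : C.carrier) : rightAct R C (x ⊗ₜ[k] (b ⊗ₜ[k] d)) =
      sgn k i j • actTensor R C x (b ⊗ₜ[k] d) := by
  have h01 : ∀ i : ZMod 2, i = 0 ∨ i = 1 := by decide
  simp only [rightAct, TensorProduct.lift.tmul, LinearMap.add_apply, LinearMap.add_apply, LinearMap.compl₂_apply,
    LinearMap.rTensor_tmul, LinearMap.comp_apply, proj_of_mem _ _ hb, parity_apply R C hx]
  rcases h01 j with rfl | rfl
  · simp [sgn_zero_right]
  · simp

/-- Applied to the two sides of a relation, `rightAct` gives multiples of (br)x ⊗ d and (rb)x ⊗ d.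
Rewriting rb as ± br leaves an identity between signs, which is `sgn_cocycle`. -/
theorem balanced_le_ker_rightAct :
    balanced R (baseGr R C) (BaseChange R C) ≤ LinearMap.ker (rightAct R C) := by
  refine Submodule.span_le.2 ?_
  rintro _ ⟨i, j, x, y, r, hx, hr, rfl⟩
  change rightAct R C _ = 0
  rw [map_sub, sub_eq_zero]
  have h : rightAct R C ∘ₗ TensorProduct.mk k _ _ (sgn k i j • (r • x)) =
      rightAct R C ∘ₗ TensorProduct.mk k _ _ x ∘ₗ (LinearMap.mulLeft k r).rTensor C.carrier := by
    refine baseChange_linearMap_ext R C fun l b hb d => ?_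
    have hs : ∀ (c : k) (z : BaseChange R C),
        TensorProduct.assoc k R.carrier C.carrier C.carrier ((c • z) ⊗ₜ[k] d) =
          c • TensorProduct.assoc k R.carrier C.carrier C.carrier (z ⊗ₜ[k] d) := fun c z => by
      rw [← TensorProduct.smul_tmul', LinearEquiv.map_smul]
    simp only [LinearMap.comp_apply, TensorProduct.mk_apply, LinearMap.rTensor_tmul,
      LinearMap.mulLeft_apply]
    rw [rightAct_tmul R C (Submodule.smul_mem _ _ (smul_mem_baseGr R C hr hx)) hb,
      rightAct_tmul R C hx (SetLike.mul_mem_graded hr hb), map_smul, LinearMap.smul_apply,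
      actTensor_tmul, actTensor_tmul, R.mul_comm_sgn hb hr, smul_assoc (sgn k l j),
      hs (sgn k l j), smul_smul b r x, smul_smul, smul_smul]
    congr 1
    rw [mul_comm (sgn k (i + j) l), sgn_cocycle, mul_comm]
    congr 1
    rw [sgn, sgn, mul_comm]
  have hy : r • y = (LinearMap.mulLeft k r).rTensor C.carrier y := by
    induction y using TensorProduct.induction_on with
    | zero => simp
    | add x y hx hy => rw [smul_add, map_add, hx, hy]
    | tmul a c => rw [TensorProduct.smul_tmul']; rfl
  rw [hy]
  exact LinearMap.congr_fun h y

/-- The map `r ⊗ (c ⊗ d) ↦ (r ⊗ c) ⊗_R (1 ⊗ d)`. -/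
def toBaseSq : R.carrier ⊗[k] (C.carrier ⊗[k] C.carrier) →ₗ[k] BaseSq R C :=
  TensorProduct.lift ((baseMk R C).compl₂ (TensorProduct.mk k R.carrier C.carrier 1)) ∘ₗ
    (TensorProduct.assoc k R.carrier C.carrier C.carrier).symm.toLinearMap

/-- The map `rightAct` descends to the tensor product over `R` and gives a left inverse there: since
1 is even, it moves across without a sign. -/
theorem toBaseSq_injective : Function.Injective (toBaseSq R C) := by
  obtain ⟨L, hL⟩ := TensorOver.exists_lift (rightAct R C) (balanced_le_ker_rightAct R C)
  have h : L ∘ₗ toBaseSq R C = LinearMap.id := by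
    refine TensorProduct.ext' fun r z => ?_
    induction z using TensorProduct.induction_on with
    | zero => simp
    | add x y hx hy => simp only [TensorProduct.tmul_add, map_add, hx, hy]
    | tmul c d =>
      change L (baseMk R C (r ⊗ₜ[k] c) ((1 : R.carrier) ⊗ₜ[k] d)) = _
      have h1 : (1 : R.carrier) ∈ R.gr 0 := SetLike.one_mem_graded R.gr
      rw [hL, rightAct, TensorProduct.lift.tmul, LinearMap.add_apply, LinearMap.add_apply, LinearMap.compl₂_apply,
        LinearMap.compl₂_apply, LinearMap.rTensor_tmul, LinearMap.rTensor_tmul,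
        proj_of_mem _ _ h1, proj_of_mem _ _ h1, if_pos rfl, if_neg (by decide),
        TensorProduct.zero_tmul, map_zero, add_zero, actTensor_tmul_tmul, one_mul]
      rfl
  exact Function.LeftInverse.injective (LinearMap.congr_fun h)

/-- For even `u` the right and left actions of `b` on `u` coincide, so this is one defining relation
of the tensor product over `R`, with sign 1. -/
theorem toBaseSq_actTensor {u : BaseChange R C} (hu : u ∈ baseGr R C 0) (v : BaseChange R C) :
    toBaseSq R C (actTensor R C u v) = baseMk R C u v := by
  have h : toBaseSq R C ∘ₗ actTensor R C u = baseMk R C u := by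
    refine baseChange_linearMap_ext R C fun j b hb d => ?_
    rw [LinearMap.comp_apply, actTensor_tmul, toBaseSq, LinearMap.comp_apply,
      LinearEquiv.coe_coe, LinearEquiv.symm_apply_apply, TensorProduct.lift.tmul,
      LinearMap.compl₂_apply, TensorProduct.mk_apply]
    refine (Submodule.Quotient.eq _).2 (Submodule.subset_span
      ⟨0, j, u, (1 : R.carrier) ⊗ₜ[k] d, b, hu, hb, ?_⟩)
    rw [sgn_zero_left, one_smul, TensorProduct.smul_tmul', smul_eq_mul, mul_one]
    rfl
  exact LinearMap.congr_fun h v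

/-- Both sides of the group-like equation are images under the injective map `toBaseSq`; this
removes the tensor product over `R`. -/
theorem baseComul_eq_iff {u : BaseChange R C} (hu : u ∈ baseGr R C 0) :
    baseComul R C u = baseMk R C u u ↔
      (Coalgebra.comul (R := k)).lTensor R.carrier u = actTensor R C u u := by
  rw [← toBaseSq_actTensor R C hu]
  exact (toBaseSq_injective R C).eq_iff

end RightAction

/-! ### Group-like elements as linear maps R* → C -/

section Contraction

variable {k : Type u} [Field k] (R : SAlgf k)

/-- The isomorphism `R ⊗ N ≃ Hom(R*, N)` for finite-dimensional `R`. -/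
def contract (N : Type u) [AddCommGroup N] [Module k N] :
    R.obj.carrier ⊗[k] N ≃ₗ[k] (Module.Dual k R.obj.carrier →ₗ[k] N) :=
  TensorProduct.congr (Module.evalEquiv k R.obj.carrier) (LinearEquiv.refl k N) ≪≫ₗ
    dualTensorHomEquiv k (Module.Dual k R.obj.carrier) N

variable {N : Type u} [AddCommGroup N] [Module k N]

theorem contract_tmul (r : R.obj.carrier) (n : N) (f : Module.Dual k R.obj.carrier) :
    contract R N (r ⊗ₜ[k] n) f = f r • n := by
  simp [contract, dualTensorHom_apply]

theorem contract_lTensor {N' : Type u} [AddCommGroup N'] [Module k N'] (g : N →ₗ[k] N')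
    (u : R.obj.carrier ⊗[k] N) (f : Module.Dual k R.obj.carrier) :
    contract R N' (g.lTensor _ u) f = g (contract R N u f) := by
  induction u using TensorProduct.induction_on with
  | zero => simp
  | add x y hx hy => simp only [map_add, LinearMap.add_apply, hx, hy]
  | tmul r n => rw [LinearMap.lTensor_tmul, contract_tmul, contract_tmul, map_smul]

theorem contract_rTensor {S : SAlgf k} (φ : R.obj.carrier →ₗ[k] S.obj.carrier)
    (u : R.obj.carrier ⊗[k] N) (f : Module.Dual k S.obj.carrier) :
    contract S N (φ.rTensor _ u) f = contract R N u (f ∘ₗ φ) := by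
  induction u using TensorProduct.induction_on with
  | zero => simp
  | add x y hx hy => simp only [map_add, LinearMap.add_apply, hx, hy]
  | tmul r n => rw [LinearMap.rTensor_tmul, contract_tmul, contract_tmul, LinearMap.comp_apply]

theorem contract_eq_iff {u v : R.obj.carrier ⊗[k] N} :
    u = v ↔ ∀ f, contract R N u f = contract R N v f :=
  ⟨fun h _ => by rw [h], fun h => (contract R N).injective (LinearMap.ext h)⟩

theorem contract_mem {𝒩 : ZMod 2 → Submodule k N} {i : ZMod 2}
    {u : R.obj.carrier ⊗[k] N} (hu : u ∈ tensorGr R.obj.gr 𝒩 0)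
    {f : Module.Dual k R.obj.carrier} (hf : f ∈ dualGr R.obj.gr i) :
    contract R N u f ∈ 𝒩 i := by
  have h : tensorGr R.obj.gr 𝒩 0 ≤ (𝒩 i).comap
      ((contract R N).toLinearMap.flip f) := by
    refine iSup_le fun l => Submodule.map₂_le.2 fun r hr n hn => ?_
    change contract R N (r ⊗ₜ[k] n) f ∈ 𝒩 i
    rw [contract_tmul]
    by_cases hl : l = i
    · subst hl
      rw [(by decide : ∀ l : ZMod 2, 0 - l = l) l] at hn
      exact Submodule.smul_mem _ _ hn
    · rw [hf l hl r hr, zero_smul]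
      exact zero_mem _
  exact h hu

/-- Projecting the `R`-factor to parity i already forces parity i on the other factor, so `u` is the
sum of its (i, i) components, which are even because i + i = 0. -/
theorem mem_tensorGr_zero_of_contract_mem {𝒩 : ZMod 2 → Submodule k N}
    [DirectSum.Decomposition 𝒩] {u : R.obj.carrier ⊗[k] N}
    (hu : ∀ i, ∀ f ∈ dualGr R.obj.gr i, contract R N u f ∈ 𝒩 i) :
    u ∈ tensorGr R.obj.gr 𝒩 0 := by
  have h : u = ∑ i, TensorProduct.map (proj R.obj.gr i) (proj 𝒩 i) u := by
    rw [contract_eq_iff]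
    intro f
    have hmap : ∀ i, contract R N (TensorProduct.map (proj R.obj.gr i) (proj 𝒩 i) u) f =
        contract R N u (f ∘ₗ proj R.obj.gr i) := fun i => by
      rw [← LinearMap.lTensor_comp_rTensor, LinearMap.comp_apply, contract_lTensor,
        contract_rTensor]
      exact (mem_iff_proj_eq 𝒩).1 (hu i _ (comp_proj_mem R.obj.gr f i))
    rw [map_sum, LinearMap.sum_apply, Finset.sum_congr rfl fun i _ => hmap i, ← map_sum,
      sum_comp_proj]
  rw [h]
  refine Submodule.sum_mem _ fun i _ => ?_
  generalize u = v
  induction v using TensorProduct.induction_on with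
  | zero => simp
  | add x y hx hy => rw [map_add]; exact add_mem hx hy
  | tmul r n =>
    have := tmul_mem_tensorGr R.obj.gr 𝒩 (proj_mem R.obj.gr i r) (proj_mem 𝒩 i n)
    rwa [(by decide : ∀ i : ZMod 2, i + i = 0) i] at this

/-- The order of multiplication in `actTensor` is that of `signedMul`, to which `dualComul` is dual,
so no sign appears. -/
theorem contract_actTensor (C : SCoalg k) (u v : BaseChange R.obj C)
    (f : Module.Dual k R.obj.carrier) :
    contract R (C.carrier ⊗[k] C.carrier) (actTensor R.obj C u v) f =
      TensorProduct.map (contract R C.carrier u) (contract R C.carrier v) (dualComul R f) := by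
  induction u using TensorProduct.induction_on with
  | zero => simp
  | add x y hx hy => simp only [map_add, LinearMap.add_apply, TensorProduct.map_add_left, hx, hy]
  | tmul a c =>
  induction v using TensorProduct.induction_on with
  | zero => simp
  | add x y hx hy => simp only [map_add, LinearMap.add_apply, TensorProduct.map_add_right, hx, hy]
  | tmul b d =>
    have h : ∀ z, TensorProduct.map (contract R C.carrier (a ⊗ₜ[k] c))
        (contract R C.carrier (b ⊗ₜ[k] d)) z =
          TensorProduct.dualDistrib k _ _ z (a ⊗ₜ[k] b) • (c ⊗ₜ[k] d) := fun z => by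
      induction z using TensorProduct.induction_on with
      | zero => simp
      | add x y hx hy => simp only [map_add, LinearMap.add_apply, add_smul, hx, hy]
      | tmul f g =>
        rw [TensorProduct.map_tmul, contract_tmul, contract_tmul, TensorProduct.smul_tmul_smul,
          TensorProduct.dualDistrib_apply]
    rw [h, actTensor_tmul_tmul, contract_tmul, dualDistrib_dualComul, signedMul_eq]

theorem apply_baseCounit (C : SCoalg k) (u : BaseChange R.obj C)
    (f : Module.Dual k R.obj.carrier) :
    f (baseCounit R.obj C u) = Coalgebra.counit (R := k) (contract R C.carrier u f) := by
  induction u using TensorProduct.induction_on with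
  | zero => simp
  | add x y hx hy => simp only [map_add, LinearMap.add_apply, hx, hy]
  | tmul a c => simp [baseCounit, contract_tmul, mul_comm]

/-- Evenness of `u`, the coproduct equation and the counit equation translate, in turn, into the
three conditions for `contract` of `u` to be a morphism of super-coalgebras. -/
theorem isGroupLike_iff (C : SCoalg k) (u : BaseChange R.obj C) : IsGroupLike R.obj C u ↔
    (∀ i, ∀ f ∈ dualGr R.obj.gr i, contract R C.carrier u f ∈ C.gr i) ∧
    (∀ f, Coalgebra.comul (R := k) (contract R C.carrier u f) =
      TensorProduct.map (contract R C.carrier u) (contract R C.carrier u) (dualComul R f)) ∧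
    (∀ f, Coalgebra.counit (R := k) (contract R C.carrier u f) = f 1) := by
  have h1 : u ∈ baseGr R.obj C 0 ↔
      ∀ i, ∀ f ∈ dualGr R.obj.gr i, contract R C.carrier u f ∈ C.gr i :=
    ⟨fun h i f hf => contract_mem R h hf, mem_tensorGr_zero_of_contract_mem R⟩
  have h3' : baseCounit R.obj C u = 1 ↔
      ∀ f, Coalgebra.counit (R := k) (contract R C.carrier u f) = f 1 := by
    constructor
    · intro h f
      rw [← apply_baseCounit, h]
    · intro h
      exact Module.eval_apply_injective k (LinearMap.ext fun f => (apply_baseCounit R C u f).trans (h f))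
  rw [IsGroupLike, h3', h1]
  refine and_congr_right fun h => and_congr_left fun _ => ?_
  rw [baseComul_eq_iff R.obj C (h1.2 h), contract_eq_iff]
  refine forall_congr' fun f => ?_
  rw [contract_lTensor, contract_actTensor]

end Contraction

/-! ### Full faithfulness of duality and Sp* C = Hom((-)*, C) -/

section DualFunctor

variable {k : Type u} [Field k]

theorem SCoalg.hom_ext {C D : SCoalg k} {f g : C ⟶ D}
    (h : ∀ c, f.toCoalgHom c = g.toCoalgHom c) : f = g :=
  SCoalg.Hom.ext (CoalgHom.ext h)

/-- A morphism of super-coalgebras out of the dual of a superalgebra. -/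
def ofDual {R : SAlgf k} {C : SCoalg k} (g : Module.Dual k R.obj.carrier →ₗ[k] C.carrier)
    (hgr : ∀ i, ∀ f ∈ dualGr R.obj.gr i, g f ∈ C.gr i)
    (hcomul : ∀ f, Coalgebra.comul (R := k) (g f) = TensorProduct.map g g (dualComul R f))
    (hcounit : ∀ f, Coalgebra.counit (R := k) (g f) = f 1) : dualSCoalg R ⟶ C where
  toCoalgHom :=
    letI : Coalgebra k (Module.Dual k R.obj.carrier) := dualCoalgebra R
    { g with
      counit_comp := LinearMap.ext hcounit
      map_comp_comul := LinearMap.ext fun f => (hcomul f).symm }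
  map_gr := hgr

/-- The linear map underlying a morphism of super-coalgebras out of the dual of a superalgebra. -/
def ofDualLinear {R : SAlgf k} {C : SCoalg k} (g : dualSCoalg R ⟶ C) :
    Module.Dual k R.obj.carrier →ₗ[k] C.carrier :=
  g.toCoalgHom.toLinearMap

theorem ofDualLinear_comul {R : SAlgf k} {C : SCoalg k} (g : dualSCoalg R ⟶ C)
    (f : Module.Dual k R.obj.carrier) : Coalgebra.comul (R := k) (ofDualLinear g f) =
      TensorProduct.map (ofDualLinear g) (ofDualLinear g) (dualComul R f) :=
  (LinearMap.congr_fun g.toCoalgHom.map_comp_comul f).symm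

theorem ofDualLinear_counit {R : SAlgf k} {C : SCoalg k} (g : dualSCoalg R ⟶ C)
    (f : Module.Dual k R.obj.carrier) :
    Coalgebra.counit (R := k) (ofDualLinear g f) = f 1 :=
  LinearMap.congr_fun g.toCoalgHom.counit_comp f

theorem ofDualLinear_injective {R : SAlgf k} {C : SCoalg k} :
    Function.Injective (ofDualLinear : (dualSCoalg R ⟶ C) → _) := fun _ _ h =>
  SCoalg.hom_ext fun c => LinearMap.congr_fun h c

/-- The group-like elements of `R ⊗ C` are the morphisms `R* → C`. -/
def groupLikeEquiv (R : SAlgf k) (C : SCoalg k) :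
    (SpStarObj C).obj R ≃ (dualSCoalg R ⟶ C) where
  toFun u := ofDual (contract R C.carrier u.1) ((isGroupLike_iff R C u.1).1 u.2).1
    ((isGroupLike_iff R C u.1).1 u.2).2.1 ((isGroupLike_iff R C u.1).1 u.2).2.2
  invFun g := ⟨(contract R C.carrier).symm (ofDualLinear g), (isGroupLike_iff R C _).2 (by
    rw [LinearEquiv.apply_symm_apply]
    exact ⟨g.map_gr, ofDualLinear_comul g, ofDualLinear_counit g⟩)⟩
  left_inv u := Subtype.ext ((contract R C.carrier).symm_apply_apply u.1)
  right_inv g := ofDualLinear_injective ((contract R C.carrier).apply_symm_apply (ofDualLinear g))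

theorem dualComul_comp {A B : SAlgf k} (φ : A ⟶ B) (f : Module.Dual k B.obj.carrier) :
    dualComul A (f ∘ₗ φ.hom.toAlgHom.toLinearMap) =
      TensorProduct.map φ.hom.toAlgHom.toLinearMap.dualMap φ.hom.toAlgHom.toLinearMap.dualMap
        (dualComul B f) := by
  refine dualDistrib_injective A (TensorProduct.ext' fun a b => ?_)
  have h : ∀ z, TensorProduct.dualDistrib k _ _ (TensorProduct.map
      φ.hom.toAlgHom.toLinearMap.dualMap φ.hom.toAlgHom.toLinearMap.dualMap z) (a ⊗ₜ[k] b) =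
      TensorProduct.dualDistrib k _ _ z (φ.hom.toAlgHom a ⊗ₜ[k] φ.hom.toAlgHom b) := fun z => by
    induction z using TensorProduct.induction_on with
    | zero => simp
    | add x y hx hy => simp only [map_add, LinearMap.add_apply, hx, hy]
    | tmul f g => rfl
  rw [h, dualDistrib_dualComul, dualDistrib_dualComul, signedMul_eq, signedMul_eq]
  simp

/-- The transpose `B* → A*` of a morphism `A → B`. -/
def dualHom {A B : SAlgf k} (φ : A ⟶ B) : dualSCoalg B ⟶ dualSCoalg A :=
  ofDual (C := dualSCoalg A) φ.hom.toAlgHom.toLinearMap.dualMap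
    (fun _ _ hf j hj a ha => hf j hj _ (φ.hom.map_gr j a ha)) (dualComul_comp φ)
    (fun f => congrArg f (map_one φ.hom.toAlgHom))

theorem dualHom_id (A : SAlgf k) : dualHom (𝟙 A) = 𝟙 (dualSCoalg A) := rfl

theorem dualHom_comp {A B C : SAlgf k} (φ : A ⟶ B) (ψ : B ⟶ C) :
    dualHom (φ ≫ ψ) = dualHom ψ ≫ dualHom φ := rfl

theorem dualHom_injective {A B : SAlgf k} :
    Function.Injective (dualHom : (A ⟶ B) → (dualSCoalg B ⟶ dualSCoalg A)) := by
  intro φ ψ h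
  refine ObjectProperty.hom_ext _ (SAlg.hom_ext fun a => ?_)
  refine Module.eval_apply_injective k (LinearMap.ext fun f => ?_)
  have : f ∘ₗ φ.hom.toAlgHom.toLinearMap = f ∘ₗ ψ.hom.toAlgHom.toLinearMap :=
    congrArg (fun g => ofDualLinear g f) h
  exact LinearMap.congr_fun this a

/-- Transpose `g` and use that B is its own bidual to obtain F with f(F a) = (g f)(a). Functionals
separate the points of B, so multiplicativity, unit and grading of F follow from the corresponding
properties of `g`. -/
theorem dualHom_surjective {A B : SAlgf k} :
    Function.Surjective (dualHom : (A ⟶ B) → (dualSCoalg B ⟶ dualSCoalg A)) := by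
  intro g
  let G : Module.Dual k B.obj.carrier →ₗ[k] Module.Dual k A.obj.carrier := ofDualLinear g
  let F : A.obj.carrier →ₗ[k] B.obj.carrier :=
    (Module.evalEquiv k B.obj.carrier).symm.toLinearMap ∘ₗ G.dualMap ∘ₗ
      Module.Dual.eval k A.obj.carrier
  have hF : ∀ f a, f (F a) = G f a := fun f a => by
    change f ((Module.evalEquiv k B.obj.carrier).symm (G.dualMap (Module.Dual.eval k _ a))) = _
    rw [Module.apply_evalEquiv_symm_apply]
    rfl
  have hsep : ∀ b b' : B.obj.carrier, (∀ f : Module.Dual k B.obj.carrier, f b = f b') → b = b' :=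
    fun b b' h => Module.eval_apply_injective k (LinearMap.ext h)
  have hone : F 1 = 1 := hsep _ _ fun f => (hF f 1).trans (ofDualLinear_counit g f)
  have hmul : ∀ a b, F (a * b) = F a * F b := fun a b => hsep _ _ fun f => by
    -- The factors are swapped because the coproduct is dual to the opposite product.
    have h : ∀ z, TensorProduct.dualDistrib k _ _ (TensorProduct.map G G z) (b ⊗ₜ[k] a) =
        TensorProduct.dualDistrib k _ _ z (F b ⊗ₜ[k] F a) := fun z => by
      induction z using TensorProduct.induction_on with
      | zero => simp
      | add x y hx hy => simp only [map_add, LinearMap.add_apply, hx, hy]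
      | tmul f g => simp [hF]
    have h' : dualComul A (G f) = TensorProduct.map G G (dualComul B f) := ofDualLinear_comul g f
    rw [hF, ← signedMul_eq, ← dualDistrib_dualComul, h', h, dualDistrib_dualComul, signedMul_eq]
  have hgr : ∀ i, ∀ a ∈ A.obj.gr i, F a ∈ B.obj.gr i :=
    map_gr_of_map_proj A.obj.gr B.obj.gr fun i a => hsep _ _ fun f => by
      have hp : G (f ∘ₗ proj B.obj.gr i) = G f ∘ₗ proj A.obj.gr i := by
        rw [← proj_dual, ← proj_dual]
        exact map_proj (f := G) (dualGr B.obj.gr) (dualGr A.obj.gr) g.map_gr i f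
      have := hF (f ∘ₗ proj B.obj.gr i) a
      rw [hp] at this
      rw [hF]
      exact this.symm
  exact ⟨⟨⟨AlgHom.ofLinearMap F hone hmul, hgr⟩⟩,
    ofDualLinear_injective (LinearMap.ext fun f => LinearMap.ext fun a => hF f a)⟩

/-- Together with `groupLikeEquiv_comp` this is the naturality of the bijection in both variables,
so that `Sp*` can be studied through morphisms out of duals. -/
theorem groupLikeEquiv_map {R S : SAlgf k} (C : SCoalg k) (φ : R ⟶ S)
    (u : (SpStarObj C).obj R) :
    groupLikeEquiv S C ((SpStarObj C).map φ u) = dualHom φ ≫ groupLikeEquiv R C u := by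
  refine ofDualLinear_injective (LinearMap.ext fun f => ?_)
  exact contract_rTensor R φ.hom.toAlgHom.toLinearMap u.1 f

theorem groupLikeEquiv_comp (R : SAlgf k) {C D : SCoalg k} (g : C ⟶ D)
    (u : (SpStarObj C).obj R) :
    groupLikeEquiv R D (((SpStar k).map g).app R u) = groupLikeEquiv R C u ≫ g := by
  refine ofDualLinear_injective (LinearMap.ext fun f => ?_)
  exact contract_lTensor R g.toCoalgHom.toLinearMap u.1 f

end DualFunctor

/-! ### Super-coalgebras as unions of duals -/

section DualSystems

variable {k : Type u} [Field k]

/-- Over a field `f` has a linear retraction `r`, and `r ⊗ r` is a retraction of `f ⊗ f`. -/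
theorem map_map_injective {V W : Type u} [AddCommGroup V] [Module k V] [AddCommGroup W]
    [Module k W] (f : V →ₗ[k] W) (hf : Function.Injective f) :
    Function.Injective (TensorProduct.map f f) := by
  obtain ⟨r, hr⟩ := f.exists_leftInverse_of_injective (LinearMap.ker_eq_bot.2 hf)
  have h : TensorProduct.map r r ∘ₗ TensorProduct.map f f = LinearMap.id := by
    rw [← TensorProduct.map_comp, hr, TensorProduct.map_id]
  exact Function.LeftInverse.injective (LinearMap.congr_fun h)

namespace SCoalg

theorem Hom.map_proj {C D : SCoalg k} (f : C ⟶ D) (i : ZMod 2) (c : C.carrier) :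
    f.toCoalgHom (proj C.gr i c) = proj D.gr i (f.toCoalgHom c) :=
  SuperGeom.map_proj (f := f.toCoalgHom.toLinearMap) C.gr D.gr f.map_gr i c

theorem Hom.map_comul {C D : SCoalg k} (f : C ⟶ D) (c : C.carrier) :
    TensorProduct.map f.toCoalgHom.toLinearMap f.toCoalgHom.toLinearMap
      (Coalgebra.comul (R := k) c) = Coalgebra.comul (R := k) (f.toCoalgHom c) :=
  LinearMap.congr_fun f.toCoalgHom.map_comp_comul c

theorem Hom.map_counit {C D : SCoalg k} (f : C ⟶ D) (c : C.carrier) :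
    Coalgebra.counit (R := k) (f.toCoalgHom c) = Coalgebra.counit (R := k) c :=
  LinearMap.congr_fun f.toCoalgHom.counit_comp c

/-- A morphism whose image lies in that of an injective morphism factors through it. -/
theorem exists_factor {C D E : SCoalg k} (f : D ⟶ C) (hf : Function.Injective f.toCoalgHom)
    (g : E ⟶ C) (h : ∀ x, ∃ y, f.toCoalgHom y = g.toCoalgHom x) : ∃ g' : E ⟶ D, g' ≫ f = g := by
  choose F hF using h
  let L : E.carrier →ₗ[k] D.carrier :=
    { toFun := F
      map_add' := fun x y => hf (by rw [hF, map_add, map_add, hF, hF])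
      map_smul' := fun c x => hf (by rw [hF, map_smul, map_smul, hF]; rfl) }
  have hL : f.toCoalgHom.toLinearMap ∘ₗ L = g.toCoalgHom.toLinearMap := LinearMap.ext hF
  refine ⟨⟨⟨L, LinearMap.ext fun x => ?_, LinearMap.ext fun x => ?_⟩, ?_⟩, hom_ext hF⟩
  · change Coalgebra.counit (R := k) (F x) = _
    rw [← Hom.map_counit f, hF, Hom.map_counit g]
  · refine map_map_injective f.toCoalgHom.toLinearMap hf ?_
    change TensorProduct.map _ _ (TensorProduct.map L L (Coalgebra.comul (R := k) x)) =
      TensorProduct.map _ _ (Coalgebra.comul (R := k) (F x))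
    rw [Hom.map_comul f, hF, ← Hom.map_comul g, ← LinearMap.comp_apply, ← TensorProduct.map_comp,
      hL]
  · refine map_gr_of_map_proj (f := L) E.gr D.gr fun i x => hf ?_
    change f.toCoalgHom (F _) = f.toCoalgHom (proj _ i (F x))
    rw [hF, Hom.map_proj, Hom.map_proj, hF]

end SCoalg

/-- A presentation of a super-coalgebra as the union of the duals of a system of finite-dimensional
superalgebras. -/
structure DualSystem (C : SCoalg k) {J : Type u} [Preorder J] (A : J ⥤ (SAlgf k)ᵒᵖ) where
  ι : ∀ j, dualSCoalg (A.obj j).unop ⟶ C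
  injective : ∀ j, Function.Injective (ι j).toCoalgHom
  compat : ∀ (i j : J) (h : i ⟶ j), dualHom (A.map h).unop ≫ ι j = ι i
  cover : ∀ c : C.carrier, ∃ j f, (ι j).toCoalgHom f = c

namespace DualSystem

variable {C D : SCoalg k} {J : Type u} [Preorder J] {A : J ⥤ (SAlgf k)ᵒᵖ}

/-- The transposed transition maps are injective, being first factors of the injective maps `S.ι i`;
over a field the transition maps are then surjective. -/
theorem surjectiveTransitions (S : DualSystem C A) : SurjectiveTransitions A := by
  intro i j h
  have hinj : Function.Injective (A.map h).unop.hom.toAlgHom.toLinearMap.dualMap := by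
    intro f g hfg
    refine S.injective i ?_
    rw [← S.compat i j h]
    exact congrArg (S.ι j).toCoalgHom hfg
  exact LinearMap.dualMap_injective_iff.1 hinj

theorem hom_ext (S : DualSystem C A) {f g : C ⟶ D} (h : ∀ j, S.ι j ≫ f = S.ι j ≫ g) : f = g :=
  SCoalg.hom_ext fun c => by
    obtain ⟨j, x, rfl⟩ := S.cover c
    exact congrArg (fun q => ofDualLinear q x) (h j)

theorem compat_apply (S : DualSystem C A) {i j : J} (h : i ⟶ j)
    (f : (dualSCoalg (A.obj i).unop).carrier) :
    (S.ι j).toCoalgHom ((dualHom (A.map h).unop).toCoalgHom f) = (S.ι i).toCoalgHom f :=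
  congrArg (fun q => ofDualLinear q f) (S.compat i j h)

variable [IsDirectedOrder J]

/-- The images of finitely many basis vectors lie in the terms of finitely many indices, which have
a common upper bound. -/
theorem exists_cover_of_finite [Nonempty J] (S : DualSystem C A) {V : Type u} [AddCommGroup V]
    [Module k V] [FiniteDimensional k V] (g : V →ₗ[k] C.carrier) :
    ∃ j, ∀ v, ∃ f, (S.ι j).toCoalgHom f = g v := by
  let b := Module.finBasis k V
  choose j f hf using fun n => S.cover (g (b n))
  obtain ⟨l, hl⟩ := Finite.exists_le j
  have hle : LinearMap.range g ≤ LinearMap.range (S.ι l).toCoalgHom.toLinearMap := by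
    rw [LinearMap.range_eq_map, ← b.span_eq, Submodule.map_span, Submodule.span_le]
    rintro _ ⟨_, ⟨n, rfl⟩, rfl⟩
    exact ⟨(dualHom (A.map (homOfLE (hl n))).unop).toCoalgHom (f n),
      (S.compat_apply (homOfLE (hl n)) (f n)).trans (hf n)⟩
  exact ⟨l, fun v => hle ⟨v, rfl⟩⟩

/-- The presentation of `Sp* C` by the given system of superalgebras. -/
def presentation [Nonempty J] (S : DualSystem C A) : Presentation ((SpStar k).obj C) A where
  elt j := (groupLikeEquiv (A.obj j).unop C).symm (S.ι j)
  map_elt i j h := by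
    refine (groupLikeEquiv _ C).injective ?_
    refine (groupLikeEquiv_map C _ _).trans ?_
    rw [Equiv.apply_symm_apply, Equiv.apply_symm_apply, S.compat]
  exists_map B y := by
    let g := groupLikeEquiv B C y
    -- As B* is finite-dimensional, its image lies in a single term of the union. The resulting
    -- morphism between duals comes from a morphism of superalgebras because duality is full.
    obtain ⟨j, hj⟩ := S.exists_cover_of_finite (ofDualLinear g)
    obtain ⟨g', hg'⟩ := SCoalg.exists_factor (S.ι j) (S.injective j) g hj
    obtain ⟨φ, hφ⟩ := dualHom_surjective g'
    refine ⟨j, φ, (groupLikeEquiv _ C).injective ?_⟩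
    refine (groupLikeEquiv_map C _ _).trans ?_
    rw [Equiv.apply_symm_apply, hφ, hg']
  map_inj j B φ ψ h := by
    refine dualHom_injective (ofDualLinear_injective (LinearMap.ext fun f => S.injective j ?_))
    have h' := congrArg (groupLikeEquiv _ C) h
    have h1 := groupLikeEquiv_map C φ ((groupLikeEquiv (A.obj j).unop C).symm (S.ι j))
    have h2 := groupLikeEquiv_map C ψ ((groupLikeEquiv (A.obj j).unop C).symm (S.ι j))
    rw [Equiv.apply_symm_apply] at h1 h2
    exact congrArg (fun q => ofDualLinear q f) (h1.symm.trans (h'.trans h2))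

/-- The universal property of `C` as the inductive limit of the duals of a system. -/
theorem exists_desc (S : DualSystem C A) (t : ∀ j, dualSCoalg (A.obj j).unop ⟶ D)
    (ht : ∀ (i j : J) (h : i ⟶ j), dualHom (A.map h).unop ≫ t j = t i) :
    ∃ g : C ⟶ D, ∀ j, S.ι j ≫ g = t j := by
  have ht' : ∀ {i j : J} (h : i ⟶ j) (f : (dualSCoalg (A.obj i).unop).carrier),
      (t j).toCoalgHom ((dualHom (A.map h).unop).toCoalgHom f) = (t i).toCoalgHom f :=
    fun h f => congrArg (fun q => ofDualLinear q f) (ht _ _ h)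
  choose n r hr using S.cover
  -- Two representatives of one element of C become equal at a common later stage, because the map
  -- from that stage to C is injective.
  have hwd : ∀ {i j : J} (f : (dualSCoalg (A.obj i).unop).carrier)
      (f' : (dualSCoalg (A.obj j).unop).carrier),
      (S.ι i).toCoalgHom f = (S.ι j).toCoalgHom f' → (t i).toCoalgHom f = (t j).toCoalgHom f' := by
    intro i j f f' h
    obtain ⟨l, hi, hj⟩ := exists_ge_ge i j
    rw [← ht' (homOfLE hi), ← ht' (homOfLE hj)]
    congr 1
    apply S.injective l
    rw [S.compat_apply, S.compat_apply, h]
  let F : C.carrier → D.carrier := fun c => (t (n c)).toCoalgHom (r c)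
  have hF : ∀ j f, F ((S.ι j).toCoalgHom f) = (t j).toCoalgHom f := fun j f => hwd _ _ (hr _)
  have hcommon : ∀ c c' : C.carrier, ∃ j f f',
      (S.ι j).toCoalgHom f = c ∧ (S.ι j).toCoalgHom f' = c' := by
    intro c c'
    obtain ⟨l, hi, hj⟩ := exists_ge_ge (n c) (n c')
    exact ⟨l, _, _, (S.compat_apply (homOfLE hi) (r c)).trans (hr c),
      (S.compat_apply (homOfLE hj) (r c')).trans (hr c')⟩
  let L : C.carrier →ₗ[k] D.carrier :=
    { toFun := F
      map_add' := fun c c' => by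
        obtain ⟨j, f, f', rfl, rfl⟩ := hcommon c c'
        rw [← map_add, hF, hF, hF, map_add]
      map_smul' := fun a c => by
        obtain ⟨j, f, rfl⟩ := S.cover c
        rw [← map_smul, hF, hF, map_smul]
        rfl }
  have hL : ∀ j, L ∘ₗ (S.ι j).toCoalgHom.toLinearMap = (t j).toCoalgHom.toLinearMap := fun j =>
    LinearMap.ext fun f => hF j f
  refine ⟨⟨⟨L, LinearMap.ext fun c => ?_, LinearMap.ext fun c => ?_⟩, ?_⟩,
    fun j => SCoalg.hom_ext fun f => hF j f⟩
  · obtain ⟨j, f, rfl⟩ := S.cover c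
    change Coalgebra.counit (R := k) (F _) = _
    rw [hF, SCoalg.Hom.map_counit, SCoalg.Hom.map_counit]
  · obtain ⟨j, f, rfl⟩ := S.cover c
    change TensorProduct.map L L (Coalgebra.comul (R := k) _) = Coalgebra.comul (R := k) (F _)
    rw [hF, ← SCoalg.Hom.map_comul (t j), ← SCoalg.Hom.map_comul (S.ι j), ← LinearMap.comp_apply,
      ← TensorProduct.map_comp, hL]
  · refine map_gr_of_map_proj (f := L) C.gr D.gr fun i c => ?_
    obtain ⟨j, f, rfl⟩ := S.cover c
    change F _ = proj _ i (F _)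
    rw [← SCoalg.Hom.map_proj, hF, hF, SCoalg.Hom.map_proj]

/-- On the element of Sp* C given by `S.ι j`, the map Sp* f returns the composite `S.ι j ≫ f`, and
these composites determine `f`. -/
theorem map_SpStar_injective [Nonempty J] (S : DualSystem C A) {f g : C ⟶ D}
    (h : (SpStar k).map f = (SpStar k).map g) : f = g := by
  refine S.hom_ext fun j => ?_
  have h1 := groupLikeEquiv_comp _ f (S.presentation.elt j)
  have h2 := groupLikeEquiv_comp _ g (S.presentation.elt j)
  rw [presentation, Equiv.apply_symm_apply] at h1 h2
  rw [← h1, ← h2, h]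

/-- Applying `η` to the elements given by the `S.ι j` yields compatible morphisms from the terms to
`D`, which glue to a morphism on C. -/
theorem map_SpStar_surjective [Nonempty J] (S : DualSystem C A)
    (η : (SpStar k).obj C ⟶ (SpStar k).obj D) : ∃ f, (SpStar k).map f = η := by
  obtain ⟨f, hf⟩ := S.exists_desc
    (fun j => groupLikeEquiv _ D (η.app _ (S.presentation.elt j))) fun i j h => by
      rw [← S.presentation.map_elt i j h, naturality_apply']
      exact (groupLikeEquiv_map D _ _).symm
  refine ⟨f, S.presentation.hom_ext fun j => (groupLikeEquiv _ D).injective ?_⟩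
  refine (groupLikeEquiv_comp _ f (S.presentation.elt j)).trans ?_
  rw [← hf j]
  congr 1
  exact (groupLikeEquiv _ C).apply_symm_apply _

end DualSystem

/-- The one-term system of a finite-dimensional superalgebra presents its dual. -/
def constDualSystem (A : SAlgf k) :
    DualSystem (dualSCoalg A) ((Functor.const PUnit.{u + 1}).obj (Opposite.op A)) where
  ι _ := 𝟙 (dualSCoalg A)
  injective _ _ _ h := h
  compat _ _ _ := rfl
  cover c := ⟨PUnit.unit, c, rfl⟩

/-- The one-term system of a finite-dimensional superalgebra presents `SSpf A`. -/
def constPresentation (A : SAlgf k) : Presentation ((SSpf k).obj (Opposite.op A))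
    ((Functor.const PUnit.{u + 1}).obj (Opposite.op A)) where
  elt _ := 𝟙 A
  map_elt _ _ _ := Category.comp_id (𝟙 A)
  exists_map B y := ⟨PUnit.unit, y, Category.id_comp (show A ⟶ B from y)⟩
  map_inj _ _ φ ψ h := (Category.id_comp φ).symm.trans (h.trans (Category.id_comp ψ))

/-- Both functors are presented by the same one-term system. -/
theorem nonempty_SSpf_iso_SpStar_dual (A : SAlgf k) :
    Nonempty ((SSpf k).obj (Opposite.op A) ≅ (SpStar k).obj (dualSCoalg A)) :=
  ⟨(constPresentation A).iso (constDualSystem A).presentation⟩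

end DualSystems

/-! ### The dual superalgebra and local finiteness of super-coalgebras -/

namespace SCoalg

variable {k : Type u} [Field k] (C : SCoalg k)

/-- The map `a ⊗ b ↦ f(b) a`. -/
def evalRight (f : Module.Dual k C.carrier) : C.carrier ⊗[k] C.carrier →ₗ[k] C.carrier :=
  (TensorProduct.rid k C.carrier).toLinearMap ∘ₗ f.lTensor C.carrier

@[simp] theorem evalRight_tmul (f : Module.Dual k C.carrier) (a b : C.carrier) :
    C.evalRight f (a ⊗ₜ[k] b) = f b • a := by simp [evalRight]

/-- The action `c ↦ ∑ f(c₂) c₁` of the dual on a coalgebra. -/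
def hit (f : Module.Dual k C.carrier) : C.carrier →ₗ[k] C.carrier :=
  C.evalRight f ∘ₗ Coalgebra.comul

theorem hit_apply (f : Module.Dual k C.carrier) (c : C.carrier) :
    C.hit f c = C.evalRight f (Coalgebra.comul c) := rfl

theorem evalRight_add (f g : Module.Dual k C.carrier) :
    C.evalRight (f + g) = C.evalRight f + C.evalRight g :=
  TensorProduct.ext' fun a b => by simp [add_smul]

theorem evalRight_smul (r : k) (f : Module.Dual k C.carrier) :
    C.evalRight (r • f) = r • C.evalRight f :=
  TensorProduct.ext' fun a b => by simp [mul_smul]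

theorem hit_add (f g : Module.Dual k C.carrier) : C.hit (f + g) = C.hit f + C.hit g := by
  rw [hit, evalRight_add]; rfl

theorem hit_smul (r : k) (f : Module.Dual k C.carrier) : C.hit (r • f) = r • C.hit f := by
  rw [hit, evalRight_smul]; rfl

theorem hit_zero : C.hit 0 = 0 := by simpa using C.hit_smul 0 0

theorem hit_counit : C.hit Coalgebra.counit = LinearMap.id := by
  refine LinearMap.ext fun c => ?_
  rw [hit_apply, evalRight, LinearMap.comp_apply, Coalgebra.lTensor_counit_comul]
  simp

theorem counit_hit (f : Module.Dual k C.carrier) (c : C.carrier) :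
    Coalgebra.counit (R := k) (C.hit f c) = f c := by
  have h : ∀ z : C.carrier ⊗[k] C.carrier, Coalgebra.counit (R := k) (C.evalRight f z) =
      f (TensorProduct.lid k _ ((Coalgebra.counit (R := k)).rTensor _ z)) := fun z => by
    induction z using TensorProduct.induction_on with
    | zero => simp
    | add x y hx hy => simp only [map_add, hx, hy]
    | tmul a b => simp [mul_comm]
  rw [hit_apply, h, Coalgebra.rTensor_counit_comul]
  simp

/-- This is coassociativity evaluated on two functionals. It makes `hit` an action and the product
of the dual, (fg)(c) = g(hit f c), associative. -/
theorem hit_hit (f g : Module.Dual k C.carrier) (c : C.carrier) :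
    C.hit (g ∘ₗ C.hit f) c = C.hit g (C.hit f c) := by
  have h1 : ∀ z : C.carrier ⊗[k] C.carrier, C.evalRight (g ∘ₗ C.hit f) z =
      C.evalRight g ((C.evalRight f).lTensor C.carrier
        ((Coalgebra.comul (R := k)).lTensor C.carrier z)) := fun z => by
    induction z using TensorProduct.induction_on with
    | zero => simp
    | add x y hx hy => simp only [map_add, hx, hy]
    | tmul a b => simp [hit_apply]
  have h2 : ∀ z : C.carrier ⊗[k] C.carrier, C.hit g (C.evalRight f z) =
      C.evalRight g ((C.evalRight f).lTensor C.carrier (TensorProduct.assoc k _ _ _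
        ((Coalgebra.comul (R := k)).rTensor C.carrier z))) := fun z => by
    induction z using TensorProduct.induction_on with
    | zero => simp
    | add x y hx hy => simp only [map_add, hx, hy]
    | tmul a b =>
      rw [evalRight_tmul, map_smul, hit_apply, LinearMap.rTensor_tmul]
      generalize Coalgebra.comul (R := k) a = w
      induction w using TensorProduct.induction_on with
      | zero => simp
      | add x y hx hy => simp only [map_add, smul_add, TensorProduct.add_tmul, hx, hy]
      | tmul p q => simp
  rw [hit_apply, h1, ← Coalgebra.coassoc_apply, ← h2, ← hit_apply]

/-- In total parity i, the left factor has parity j exactly when the right one has parity i - j. -/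
theorem evalRight_proj {i : ZMod 2} {z : C.carrier ⊗[k] C.carrier} (hz : z ∈ tensorGr C.gr C.gr i)
    (f : Module.Dual k C.carrier) (j : ZMod 2) :
    proj C.gr j (C.evalRight f z) = C.evalRight (f ∘ₗ proj C.gr (i - j)) z := by
  have h : tensorGr C.gr C.gr i ≤ LinearMap.eqLocus (proj C.gr j ∘ₗ C.evalRight f)
      (C.evalRight (f ∘ₗ proj C.gr (i - j))) := by
    refine iSup_le fun l => Submodule.map₂_le.2 fun a ha b hb => ?_
    change proj C.gr j (C.evalRight f (a ⊗ₜ[k] b)) = C.evalRight _ (a ⊗ₜ[k] b)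
    rw [evalRight_tmul, evalRight_tmul, map_smul, proj_of_mem _ _ ha, LinearMap.comp_apply,
      proj_of_mem _ _ hb]
    by_cases hlj : l = j
    · rw [if_pos hlj, if_pos (by rw [hlj])]
    · rw [if_neg hlj, if_neg (fun h => hlj (sub_right_injective h)), map_zero, smul_zero, zero_smul]
  exact h hz

theorem proj_hit {i : ZMod 2} {c : C.carrier} (hc : c ∈ C.gr i) (f : Module.Dual k C.carrier)
    (j : ZMod 2) : proj C.gr j (C.hit f c) = C.hit (f ∘ₗ proj C.gr (i - j)) c :=
  C.evalRight_proj (C.comul_mem i c hc) f j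

/-- Super-cocommutativity read on functionals: applying the twist before `f` and `g` exchanges them,
up to the sign for the parities on which they do not vanish. It gives supercommutativity of the
dual. -/
theorem apply_hit_of_mem {i j : ZMod 2} {f g : Module.Dual k C.carrier}
    (hf : f ∈ dualGr C.gr i) (hg : g ∈ dualGr C.gr j) (c : C.carrier) :
    f (C.hit g c) = sgn k i j * g (C.hit f c) := by
  have h : ∀ z, f (C.evalRight g (TensorProduct.comm k _ _ (koszul C.gr C.gr z))) =
      sgn k i j * g (C.evalRight f z) := fun z => by
    induction z using TensorProduct.induction_on with
    | zero => simp
    | add x y hx hy => simp only [map_add, mul_add, hx, hy]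
    | tmul a b =>
      rw [← sum_proj C.gr a, ← sum_proj C.gr b]
      simp only [TensorProduct.sum_tmul, TensorProduct.tmul_sum, map_sum, Finset.mul_sum]
      refine Finset.sum_congr rfl fun l _ => Finset.sum_congr rfl fun m _ => ?_
      rw [koszul_tmul _ _ (proj_mem _ _ _) (proj_mem _ _ _), map_smul, TensorProduct.comm_tmul,
        map_smul, evalRight_tmul, evalRight_tmul, map_smul, map_smul, map_smul]
      simp only [smul_eq_mul]
      by_cases hm : m = j
      · by_cases hl : l = i
        · rw [hm, hl, show sgn k j i = sgn k i j by rw [sgn, sgn, mul_comm]]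
          ring
        · rw [hf l hl _ (proj_mem _ _ _)]
          ring
      · rw [hg m hm _ (proj_mem _ _ _)]
        ring
  have h' := LinearMap.congr_fun C.cocomm c
  rw [hit_apply, hit_apply, ← h]
  exact congrArg (fun z => f (C.evalRight g z)) h'.symm

theorem hit_mem_dualGr {i j : ZMod 2} {f g : Module.Dual k C.carrier}
    (hf : f ∈ dualGr C.gr i) (hg : g ∈ dualGr C.gr j) : g ∘ₗ C.hit f ∈ dualGr C.gr (i + j) := by
  intro l hl c hc
  have h1 : g (C.hit f c) = g (proj C.gr j (C.hit f c)) := by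
    conv_lhs => rw [← sum_proj C.gr (C.hit f c), map_sum]
    refine Finset.sum_eq_single j (fun m _ hm => hg m hm _ (proj_mem _ _ _)) (by simp)
  have h2 : f ∘ₗ proj C.gr (l - j) = 0 := LinearMap.ext fun d =>
    hf _ (fun h => hl (by rw [← h, sub_add_cancel])) _ (proj_mem _ _ _)
  rw [LinearMap.comp_apply, h1, C.proj_hit hc, h2]
  rw [hit_zero, LinearMap.zero_apply, map_zero]

/-- The dual space of a super-coalgebra, as the underlying space of its dual superalgebra. -/
def DualAlg : Type u := Module.Dual k C.carrier

instance : AddCommGroup C.DualAlg := inferInstanceAs (AddCommGroup (Module.Dual k C.carrier))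

instance : Module k C.DualAlg := inferInstanceAs (Module k (Module.Dual k C.carrier))

/-- The linear form underlying an element of the dual superalgebra. -/
def DualAlg.form : C.DualAlg ≃ₗ[k] Module.Dual k C.carrier := LinearEquiv.refl k _

instance : Ring C.DualAlg :=
  { (inferInstance : AddCommGroup C.DualAlg) with
    mul := fun f g => (DualAlg.form C g ∘ₗ C.hit (DualAlg.form C f) : Module.Dual k C.carrier)
    one := (Coalgebra.counit : Module.Dual k C.carrier)
    mul_assoc := fun f g h => LinearMap.ext fun c => congrArg (DualAlg.form C h) (C.hit_hit f g c)
    one_mul := fun f => LinearMap.ext fun c => congrArg (DualAlg.form C f) (LinearMap.congr_fun C.hit_counit c)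
    mul_one := fun f => LinearMap.ext fun c => C.counit_hit f c
    left_distrib := fun f g h => rfl
    right_distrib := fun f g h => LinearMap.ext fun c =>
      (congrArg (DualAlg.form C h) (LinearMap.congr_fun (C.hit_add f g) c)).trans (map_add _ _ _)
    zero_mul := fun f => LinearMap.ext fun c =>
      (congrArg (DualAlg.form C f) (LinearMap.congr_fun C.hit_zero c)).trans (map_zero _)
    mul_zero := fun f => rfl }

instance : Algebra k C.DualAlg := Algebra.ofModule
  (fun r f g => LinearMap.ext fun c =>
    (congrArg (DualAlg.form C g) (LinearMap.congr_fun (C.hit_smul r (DualAlg.form C f)) c)).trans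
      (map_smul _ _ _))
  (fun _ _ _ => rfl)

/-- The dual superalgebra of a super-coalgebra. -/
def dualSAlg (h2 : (2 : k) ≠ 0) : SAlg k :=
  let gr : ZMod 2 → Submodule k C.DualAlg := dualGr C.gr
  letI : DirectSum.Decomposition gr := dualDecomposition C.gr
  have hcomm : ∀ {i j}, ∀ f ∈ gr i, ∀ g ∈ gr j, g * f = sgn k i j • (f * g) :=
    fun {i j} f hf g hg => LinearMap.ext fun c => by
      change DualAlg.form C f (C.hit (DualAlg.form C g) c) =
        sgn k i j * DualAlg.form C g (C.hit (DualAlg.form C f) c)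
      exact C.apply_hit_of_mem hf hg c
  { carrier := C.DualAlg
    gr := gr
    graded :=
      { toGradedMonoid :=
          { one_mem := fun j hj c hc => by
              have hj : j = 1 := (by decide : ∀ j : ZMod 2, j ≠ 0 → j = 1) j hj
              subst hj
              exact C.counit_odd c hc
            mul_mem := fun _ _ _ _ hf hg => C.hit_mem_dualGr hf hg }
        toDecomposition := inferInstance }
    even_central := fun f hf g => by
      rw [← sum_proj gr g, Finset.mul_sum, Finset.sum_mul]
      refine Finset.sum_congr rfl fun i _ => ?_
      rw [hcomm f hf _ (proj_mem gr i g), sgn_zero_left, one_smul]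
    odd_sq := fun f hf => by
      -- For odd `f` this reads ff = -ff, so ff vanishes once 2 is invertible.
      have h := hcomm f hf f hf
      rw [show sgn k 1 1 = -1 by simp [sgn, ZMod.val_one], neg_one_smul, eq_neg_iff_add_eq_zero,
        ← two_smul k] at h
      exact (smul_eq_zero.1 h).resolve_left h2 }

/-- The finite-dimensional graded subspaces of a super-coalgebra that are stable under the action
of the dual, that is, the finite-dimensional super-subcoalgebras. -/
@[ext]
structure FiniteSub where
  space : Submodule k C.carrier
  finite : FiniteDimensional k space
  proj_mem : ∀ i, ∀ c ∈ space, proj C.gr i c ∈ space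
  hit_mem : ∀ f, ∀ c ∈ space, C.hit f c ∈ space

instance : PartialOrder C.FiniteSub :=
  PartialOrder.lift FiniteSub.space fun _ _ h => FiniteSub.ext h

instance : Nonempty C.FiniteSub :=
  ⟨⟨⊥, inferInstance, fun i c hc => by simp [(Submodule.mem_bot k).1 hc],
    fun f c hc => by simp [(Submodule.mem_bot k).1 hc]⟩⟩

/-- The sum of two finite-dimensional super-subcoalgebras. -/
def FiniteSub.sup {C : SCoalg k} (E F : C.FiniteSub) : C.FiniteSub where
  space := E.space ⊔ F.space
  finite := by
    have := E.finite
    have := F.finite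
    infer_instance
  proj_mem i c hc := by
    obtain ⟨a, ha, b, hb, rfl⟩ := Submodule.mem_sup.1 hc
    rw [map_add]
    exact Submodule.add_mem_sup (E.proj_mem i a ha) (F.proj_mem i b hb)
  hit_mem f c hc := by
    obtain ⟨a, ha, b, hb, rfl⟩ := Submodule.mem_sup.1 hc
    rw [map_add]
    exact Submodule.add_mem_sup (E.hit_mem f a ha) (F.hit_mem f b hb)

instance : IsDirectedOrder C.FiniteSub :=
  ⟨fun E F => ⟨E.sup F, (le_sup_left : E.space ≤ E.space ⊔ F.space),
    (le_sup_right : F.space ≤ E.space ⊔ F.space)⟩⟩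

/-- The orbit map `f ↦ hit f c`. -/
def orbit (c : C.carrier) : Module.Dual k C.carrier →ₗ[k] C.carrier where
  toFun f := C.hit f c
  map_add' f g := LinearMap.congr_fun (C.hit_add f g) c
  map_smul' r f := LinearMap.congr_fun (C.hit_smul r f) c

/-- Writing Δ(c) as a finite sum of tensors a ⊗ b, every `hit f c` lies in the span of the vectors
a. This is the finiteness behind the fundamental theorem of coalgebras. -/
theorem finite_range_orbit (c : C.carrier) :
    FiniteDimensional k (LinearMap.range (C.orbit c)) := by
  have h : ∀ z : C.carrier ⊗[k] C.carrier, ∃ S : Submodule k C.carrier, FiniteDimensional k S ∧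
      ∀ f, C.evalRight f z ∈ S := fun z => by
    induction z using TensorProduct.induction_on with
    | zero => exact ⟨⊥, inferInstance, fun f => by simp⟩
    | tmul a b => exact ⟨Submodule.span k {a}, inferInstance, fun f => by
        rw [evalRight_tmul]
        exact Submodule.smul_mem _ _ (Submodule.mem_span_singleton_self a)⟩
    | add x y hx hy =>
      obtain ⟨S, _, hS⟩ := hx
      obtain ⟨T, _, hT⟩ := hy
      exact ⟨S ⊔ T, inferInstance, fun f => by
        rw [map_add]
        exact Submodule.add_mem_sup (hS f) (hT f)⟩
  obtain ⟨S, _, hS⟩ := h (Coalgebra.comul c)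
  refine Submodule.finiteDimensional_of_le (S₂ := S) ?_
  rintro _ ⟨f, rfl⟩
  exact hS f

/-- The super-subcoalgebra generated by a homogeneous element. -/
def orbitSub {i : ZMod 2} {c : C.carrier} (hc : c ∈ C.gr i) : C.FiniteSub where
  space := LinearMap.range (C.orbit c)
  finite := C.finite_range_orbit c
  proj_mem := by
    rintro j _ ⟨f, rfl⟩
    exact ⟨f ∘ₗ proj C.gr (i - j), (C.proj_hit hc f j).symm⟩
  hit_mem := by
    rintro g _ ⟨f, rfl⟩
    exact ⟨g ∘ₗ C.hit f, C.hit_hit f g c⟩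

theorem mem_orbitSub {i : ZMod 2} {c : C.carrier} (hc : c ∈ C.gr i) :
    c ∈ (C.orbitSub hc).space := ⟨Coalgebra.counit, LinearMap.congr_fun C.hit_counit c⟩

/-- Every element of a super-coalgebra lies in a finite-dimensional super-subcoalgebra. -/
theorem exists_mem_finiteSub (c : C.carrier) : ∃ E : C.FiniteSub, c ∈ E.space := by
  refine ⟨(C.orbitSub (proj_mem C.gr 0 c)).sup (C.orbitSub (proj_mem C.gr 1 c)), ?_⟩
  have h := Submodule.add_mem_sup (C.mem_orbitSub (proj_mem C.gr 0 c))
    (C.mem_orbitSub (proj_mem C.gr 1 c))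
  rwa [proj_add_proj] at h

end SCoalg

/-! ### Finite-dimensional super-subcoalgebras are duals -/

namespace SCoalg

variable {k : Type u} [Field k] {C : SCoalg k}

/-- Expand in a basis of the right factor: the coefficients in the left factor are values of
`evalRight` at coordinate functionals, and functionals separate these. -/
theorem tensor_ext {z w : C.carrier ⊗[k] C.carrier}
    (h : ∀ f g : Module.Dual k C.carrier, f (C.evalRight g z) = f (C.evalRight g w)) : z = w := by
  classical
  let b := Module.Basis.ofVectorSpace k C.carrier
  have hb : ∀ x n, TensorProduct.equivFinsuppOfBasisRight b x n = C.evalRight (b.coord n) x := by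
    intro x n
    induction x using TensorProduct.induction_on with
    | zero => simp
    | add x y hx hy => simp only [map_add, Finsupp.add_apply, hx, hy]
    | tmul p q => simp
  refine (TensorProduct.equivFinsuppOfBasisRight b).injective (Finsupp.ext fun n => ?_)
  rw [hb, hb]
  exact Module.eval_apply_injective k (LinearMap.ext fun f => h f _)

theorem dualSAlg_proj (h2 : (2 : k) ≠ 0) (i : ZMod 2) (f : C.DualAlg) :
    DualAlg.form C (proj (C.dualSAlg h2).gr i f) = DualAlg.form C f ∘ₗ proj C.gr i :=
  proj_dual C.gr i f

/-- The annihilator of a super-subcoalgebra in the dual superalgebra. -/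
def FiniteSub.annihilator (E : C.FiniteSub) (h2 : (2 : k) ≠ 0) : Ideal (C.dualSAlg h2).carrier where
  carrier := {f | ∀ c ∈ E.space, DualAlg.form C f c = 0}
  zero_mem' := fun _ _ => rfl
  add_mem' := fun {f g} hf hg c hc => by
    have h : DualAlg.form C (f + g) c = DualAlg.form C f c + DualAlg.form C g c := rfl
    rw [h, hf c hc, hg c hc, add_zero]
  smul_mem' := fun r _ hf c hc => hf _ (E.hit_mem (DualAlg.form C r) c hc)

theorem FiniteSub.annihilator_isHomogeneous (E : C.FiniteSub) (h2 : (2 : k) ≠ 0) :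
    (E.annihilator h2).IsHomogeneous (C.dualSAlg h2).gr := by
  intro i f hf c hc
  exact (LinearMap.congr_fun (dualSAlg_proj h2 i f) c).trans (hf _ (E.proj_mem i c hc))

/-- The quotient of the dual superalgebra by the annihilator of a super-subcoalgebra. -/
def FiniteSub.quot (E : C.FiniteSub) (h2 : (2 : k) ≠ 0) : SAlg k :=
  (C.dualSAlg h2).quot (E.annihilator h2) (E.annihilator_isHomogeneous h2)

/-- The projection to the quotient by the annihilator. -/
def FiniteSub.quotπ (E : C.FiniteSub) (h2 : (2 : k) ≠ 0) : C.dualSAlg h2 ⟶ E.quot h2 :=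
  SAlg.quotπ _ _ _

theorem FiniteSub.quotπ_surjective (E : C.FiniteSub) (h2 : (2 : k) ≠ 0) :
    Function.Surjective (E.quotπ h2).toAlgHom := SAlg.quotπ_surjective _ _ _

/-- Restriction of functionals to the subspace is onto over a field, and its kernel is the
annihilator. -/
theorem FiniteSub.exists_equiv (E : C.FiniteSub) (h2 : (2 : k) ≠ 0) :
    ∃ e : (E.quot h2).carrier ≃ₗ[k] Module.Dual k E.space, ∀ f : C.DualAlg,
      e ((E.quotπ h2).toAlgHom f) = (DualAlg.form C f) ∘ₗ E.space.subtype := by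
  let π : C.DualAlg →ₗ[k] (E.quot h2).carrier := (E.quotπ h2).toAlgHom.toLinearMap
  let ρ : C.DualAlg →ₗ[k] Module.Dual k E.space :=
    E.space.subtype.dualMap ∘ₗ (DualAlg.form C).toLinearMap
  have hρ : Function.Surjective ρ :=
    (LinearMap.dualMap_surjective_of_injective E.space.injective_subtype).comp
      (DualAlg.form C).surjective
  have hker : LinearMap.ker π = LinearMap.ker ρ := by
    ext f
    refine (SAlg.quotπ_eq_zero_iff (E.annihilator_isHomogeneous h2)).trans
      ⟨fun h => LinearMap.ext fun c => h c.1 c.2, fun h c hc => LinearMap.congr_fun h ⟨c, hc⟩⟩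
  refine ⟨(π.quotKerEquivOfSurjective (E.quotπ_surjective h2)).symm ≪≫ₗ
    Submodule.quotEquivOfEq _ _ hker ≪≫ₗ ρ.quotKerEquivOfSurjective hρ, fun f => ?_⟩
  have h : (π.quotKerEquivOfSurjective (E.quotπ_surjective h2)).symm (π f) =
      Submodule.Quotient.mk f := by
    rw [LinearEquiv.symm_apply_eq]
    rfl
  change ρ.quotKerEquivOfSurjective hρ (Submodule.quotEquivOfEq _ _ hker
    ((π.quotKerEquivOfSurjective (E.quotπ_surjective h2)).symm (π f))) = ρ f
  rw [h]
  rfl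

/-- Every finite-dimensional super-subcoalgebra is the dual of a finite-dimensional
superalgebra. -/
theorem FiniteSub.exists_dual (E : C.FiniteSub) (h2 : (2 : k) ≠ 0) :
    ∃ (R : SAlgf k) (ι : dualSCoalg R ⟶ C), Function.Injective ι.toCoalgHom ∧
      ∀ c, (∃ ξ, ι.toCoalgHom ξ = c) ↔ c ∈ E.space := by
  have := E.finite
  obtain ⟨e, he⟩ := E.exists_equiv h2
  let R : SAlgf k := ⟨E.quot h2, Module.Finite.equiv e.symm⟩
  let π : C.DualAlg → R.obj.carrier := (E.quotπ h2).toAlgHom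
  -- Here R is identified with the dual of `E`, so R* is the bidual of `E`. The map `ι` is
  -- characterized by pairing with functionals on C, and each property of it is tested by such
  -- pairings.
  let L : Module.Dual k R.obj.carrier ≃ₗ[k] E.space :=
    e.symm.dualMap ≪≫ₗ (Module.evalEquiv k E.space).symm
  let ι : Module.Dual k R.obj.carrier →ₗ[k] C.carrier := E.space.subtype ∘ₗ L.toLinearMap
  have hι : ∀ ξ (f : C.DualAlg), DualAlg.form C f (ι ξ) = ξ (π f) := fun ξ f => by
    change (DualAlg.form C f ∘ₗ E.space.subtype) ((Module.evalEquiv k E.space).symm _) = _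
    rw [Module.apply_evalEquiv_symm_apply, ← he]
    exact congrArg ξ (e.symm_apply_apply _)
  have hsep : ∀ c d : C.carrier, (∀ f : C.DualAlg, DualAlg.form C f c = DualAlg.form C f d) →
      c = d := fun c d h => Module.eval_apply_injective k (LinearMap.ext h)
  refine ⟨R, ofDual ι ?_ ?_ ?_, ?_, ?_⟩
  · intro i ξ hξ
    rw [mem_iff_proj_eq]
    refine hsep _ _ fun f => ?_
    have h1 := hι ξ (proj (C.dualSAlg h2).gr i f)
    rw [dualSAlg_proj] at h1
    refine h1.trans ?_
    have h3 : ξ ∘ₗ proj R.obj.gr i = ξ :=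
      (proj_dual R.obj.gr i ξ).symm.trans ((mem_iff_proj_eq _).1 hξ)
    have h4 : π (proj (C.dualSAlg h2).gr i f) = proj R.obj.gr i (π f) :=
      SAlg.Hom.map_proj (E.quotπ h2) i f
    rw [h4, hι]
    exact LinearMap.congr_fun h3 (π f)
  · intro ξ
    refine tensor_ext fun f g => ?_
    have h : ∀ w, f (C.evalRight g (TensorProduct.map ι ι w)) =
        TensorProduct.dualDistrib k _ _ w (π f ⊗ₜ[k] π g) := fun w => by
      induction w using TensorProduct.induction_on with
      | zero => simp
      | add x y hx hy => simp only [map_add, LinearMap.add_apply, hx, hy]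
      | tmul x y =>
        rw [TensorProduct.map_tmul, evalRight_tmul, map_smul, TensorProduct.dualDistrib_apply]
        exact (mul_comm _ _).trans (congrArg₂ (· * ·) (hι x f) (hι y g))
    rw [h, dualDistrib_dualComul, signedMul_eq]
    -- In the dual superalgebra (g * f)(c) is f(hit g c), which is the pairing of f and g with Δ(c)
    -- used in `tensor_ext`.
    refine (hι ξ ((show C.DualAlg from g) * (show C.DualAlg from f))).trans ?_
    exact congrArg ξ (map_mul (E.quotπ h2).toAlgHom _ _)
  · intro ξ
    exact (hι ξ 1).trans (congrArg ξ (map_one (E.quotπ h2).toAlgHom))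
  · exact E.space.injective_subtype.comp L.injective
  · intro c
    constructor
    · rintro ⟨ξ, rfl⟩
      exact (L ξ).2
    · intro hc
      exact ⟨L.symm ⟨c, hc⟩, congrArg Subtype.val (L.apply_symm_apply ⟨c, hc⟩)⟩

/-- Every super-coalgebra is the union of the duals of a directed system of finite-dimensional
superalgebras. -/
theorem exists_dualSystem (h2 : (2 : k) ≠ 0) (C : SCoalg k) :
    ∃ A : C.FiniteSub ⥤ (SAlgf k)ᵒᵖ, Nonempty (DualSystem C A) := by
  choose R ι hinj hmem using fun E : C.FiniteSub => E.exists_dual h2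
  have htr : ∀ {E F : C.FiniteSub}, E ≤ F → ∃ φ : R F ⟶ R E, dualHom φ ≫ ι F = ι E := by
    intro E F h
    obtain ⟨g, hg⟩ := exists_factor (ι F) (hinj F) (ι E) fun x =>
      (hmem F _).2 (h ((hmem E _).1 ⟨x, rfl⟩))
    obtain ⟨φ, rfl⟩ := dualHom_surjective g
    exact ⟨φ, hg⟩
  -- Transition maps are unique, by injectivity of `ι F` and faithfulness of duality, so the choices
  -- made below are functorial.
  have huniq : ∀ {E F : C.FiniteSub} (φ ψ : R F ⟶ R E), dualHom φ ≫ ι F = dualHom ψ ≫ ι F →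
      φ = ψ := fun φ ψ h => dualHom_injective (hom_ext fun x => hinj _
    (congrArg (fun q => ofDualLinear q x) h))
  choose φ hφ using @htr
  let A : C.FiniteSub ⥤ (SAlgf k)ᵒᵖ :=
    { obj := fun E => Opposite.op (R E)
      map := fun h => (φ (leOfHom h)).op
      map_id := fun E => congrArg Quiver.Hom.op
        (huniq _ (𝟙 (R E)) ((hφ _).trans (Category.id_comp (ι E)).symm))
      map_comp := fun f g => congrArg Quiver.Hom.op
        (huniq _ (φ (leOfHom g) ≫ φ (leOfHom f)) (by
          rw [hφ, dualHom_comp, Category.assoc, hφ, hφ])) }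
  exact ⟨A, ⟨⟨ι, hinj, fun E F h => hφ _, fun c => by
    obtain ⟨E, hE⟩ := C.exists_mem_finiteSub c
    exact ⟨E, (hmem E c).2 hE⟩⟩⟩⟩

end SCoalg

/-! ### Sp* is fully faithful with values in formal superschemes -/

section FullyFaithful

variable {k : Type u} [Field k]

theorem isFormalSuperscheme_SpStar (h2 : (2 : k) ≠ 0) (C : SCoalg k) :
    IsFormalSuperscheme k ((SpStar k).obj C) := by
  obtain ⟨A, ⟨S⟩⟩ := SCoalg.exists_dualSystem h2 C
  exact (isFormalSuperscheme_iff _).2 ⟨C.FiniteSub, inferInstance, inferInstance, inferInstance, A,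
    S.surjectiveTransitions, ⟨S.presentation⟩⟩

theorem SpStar_faithful (h2 : (2 : k) ≠ 0) : (SpStar k).Faithful where
  map_injective {C D} f g h := by
    obtain ⟨A, ⟨S⟩⟩ := SCoalg.exists_dualSystem h2 C
    exact S.map_SpStar_injective h

theorem SpStar_full (h2 : (2 : k) ≠ 0) : (SpStar k).Full where
  map_surjective {C D} η := by
    obtain ⟨A, ⟨S⟩⟩ := SCoalg.exists_dualSystem h2 C
    exact S.map_SpStar_surjective η

end FullyFaithful

/-! ### Direct limits of super-coalgebras and essential surjectivity -/

section DirectLimits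

variable {k : Type u} [Field k]

theorem twist_map {V W : Type u} [AddCommGroup V] [Module k V] [AddCommGroup W] [Module k W]
    (𝒱 : ZMod 2 → Submodule k V) [DirectSum.Decomposition 𝒱]
    (𝒲 : ZMod 2 → Submodule k W) [DirectSum.Decomposition 𝒲] (f : V →ₗ[k] W)
    (hf : ∀ i v, f (proj 𝒱 i v) = proj 𝒲 i (f v)) (z : V ⊗[k] V) :
    twist 𝒲 𝒲 (TensorProduct.map f f z) = TensorProduct.map f f (twist 𝒱 𝒱 z) := by
  induction z using TensorProduct.induction_on with
  | zero => simp
  | add x y hx hy => simp only [map_add, hx, hy]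
  | tmul v w =>
    simp only [twist, koszul, LinearMap.comp_apply, LinearMap.sum_apply, LinearMap.smul_apply,
      TensorProduct.map_tmul, map_sum, map_smul, LinearEquiv.coe_coe, TensorProduct.comm_tmul, hf]

namespace SCoalg

variable {J : Type u} [Preorder J] (G : J ⥤ SCoalg k)

/-- The terms of a system of super-coalgebras. -/
abbrev LimTerm (j : J) : Type u := (G.obj j).carrier

/-- The transition maps of a system of super-coalgebras. -/
abbrev limTrans (i j : J) (h : i ≤ j) : LimTerm G i →ₗ[k] LimTerm G j :=
  (G.map (homOfLE h)).toCoalgHom.toLinearMap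

open scoped Classical in
/-- The underlying vector space of the direct limit of a system of super-coalgebras. -/
abbrev LimCarrier : Type u :=
  Module.DirectLimit (LimTerm G) (limTrans G)

open scoped Classical in
/-- The linear maps from the terms of a system of super-coalgebras to the direct limit. -/
def limι (j : J) : (G.obj j).carrier →ₗ[k] LimCarrier G :=
  Module.DirectLimit.of k J (LimTerm G) (limTrans G) j

open scoped Classical in
theorem limι_map {i j : J} (h : i ⟶ j) (x : (G.obj i).carrier) :
    limι G j ((G.map h).toCoalgHom x) = limι G i x :=
  Module.DirectLimit.of_f (G := LimTerm G) (f := limTrans G) (hij := leOfHom h)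

open scoped Classical in
variable {G} in
/-- The linear map from the direct limit given by a compatible family. -/
def limDesc {P : Type u} [AddCommGroup P] [Module k P] (g : ∀ j, (G.obj j).carrier →ₗ[k] P)
    (hg : ∀ (i j : J) (h : i ⟶ j) x, g j ((G.map h).toCoalgHom x) = g i x) :
    LimCarrier G →ₗ[k] P :=
  Module.DirectLimit.lift k J _ _ g fun i j h x => hg i j (homOfLE h) x

open scoped Classical in
variable {G} in
theorem limDesc_ι {P : Type u} [AddCommGroup P] [Module k P]
    (g : ∀ j, (G.obj j).carrier →ₗ[k] P)
    (hg : ∀ (i j : J) (h : i ⟶ j) x, g j ((G.map h).toCoalgHom x) = g i x) (j : J)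
    (x : (G.obj j).carrier) : limDesc g hg (limι G j x) = g j x :=
  Module.DirectLimit.lift_of (G := LimTerm G) (f := limTrans G) _ _ _

theorem map_limι {i j : J} (h : i ⟶ j) (z : (G.obj i).carrier ⊗[k] (G.obj i).carrier) :
    TensorProduct.map (limι G j) (limι G j) (TensorProduct.map
      (G.map h).toCoalgHom.toLinearMap (G.map h).toCoalgHom.toLinearMap z) =
      TensorProduct.map (limι G i) (limι G i) z := by
  rw [← LinearMap.comp_apply, ← TensorProduct.map_comp]
  have e : limι G j ∘ₗ (G.map h).toCoalgHom.toLinearMap = limι G i :=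
    LinearMap.ext (limι_map G h)
  rw [e]

/-- The coproduct of the direct limit. -/
def limComul : LimCarrier G →ₗ[k] LimCarrier G ⊗[k] LimCarrier G :=
  limDesc (fun j => TensorProduct.map (limι G j) (limι G j) ∘ₗ Coalgebra.comul)
    fun i j h x => by
      rw [LinearMap.comp_apply, ← Hom.map_comul, map_limι]
      rfl

theorem limComul_ι (j : J) (x : (G.obj j).carrier) : limComul G (limι G j x) =
    TensorProduct.map (limι G j) (limι G j) (Coalgebra.comul (R := k) x) :=
  limDesc_ι _ _ _ _

/-- The counit of the direct limit. -/
def limCounit : LimCarrier G →ₗ[k] k :=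
  limDesc (fun _ => Coalgebra.counit) fun _ _ h x => Hom.map_counit (G.map h) x

theorem limCounit_ι (j : J) (x : (G.obj j).carrier) :
    limCounit G (limι G j x) = Coalgebra.counit (R := k) x :=
  limDesc_ι _ _ _ _

/-- The projections to the homogeneous components of the direct limit. -/
def limProj (i : ZMod 2) : LimCarrier G →ₗ[k] LimCarrier G :=
  limDesc (fun j => limι G j ∘ₗ proj (G.obj j).gr i) fun _ _ h x => by
    rw [LinearMap.comp_apply, ← Hom.map_proj, limι_map]
    rfl

theorem limProj_ι (i : ZMod 2) (j : J) (x : (G.obj j).carrier) :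
    limProj G i (limι G j x) = limι G j (proj (G.obj j).gr i x) :=
  limDesc_ι _ _ _ _

/-- The grading of the direct limit. -/
def limGr (i : ZMod 2) : Submodule k (LimCarrier G) := LinearMap.range (limProj G i)

theorem limι_mem (j : J) (i : ZMod 2) (x : (G.obj j).carrier) (hx : x ∈ (G.obj j).gr i) :
    limι G j x ∈ limGr G i :=
  ⟨limι G j x, by rw [limProj_ι, (mem_iff_proj_eq _).1 hx]⟩

variable [IsDirectedOrder J]

/-- An element that dies in a directed limit already dies at a later stage, where injectivity of the
transition map applies. -/
theorem limι_injective
    (hG : ∀ (i j : J) (h : i ⟶ j), Function.Injective (G.map h).toCoalgHom) (j : J) :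
    Function.Injective (limι G j) := by
  have : DirectedSystem (LimTerm G) fun i j h => limTrans G i j h :=
    ⟨fun i x => congrArg (fun f : G.obj i ⟶ G.obj i => f.toCoalgHom x) (G.map_id i),
      fun l j i hij hjl x => (congrArg (fun f : G.obj i ⟶ G.obj l => f.toCoalgHom x)
        (G.map_comp (homOfLE hij) (homOfLE hjl))).symm⟩
  classical
  refine (injective_iff_map_eq_zero _).2 fun x hx => ?_
  obtain ⟨l, hl, h0⟩ := Module.DirectLimit.of.zero_exact (G := LimTerm G) (f := limTrans G) hx
  exact hG _ _ (homOfLE hl) (h0.trans (map_zero _).symm)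

variable [Nonempty J]

open scoped Classical in
theorem exists_limι (z : LimCarrier G) : ∃ j x, limι G j x = z :=
  Module.DirectLimit.exists_of (G := LimTerm G) (f := limTrans G) z

theorem exists_of_mem_limGr {i : ZMod 2} {z : LimCarrier G} (hz : z ∈ limGr G i) :
    ∃ j, ∃ x ∈ (G.obj j).gr i, limι G j x = z := by
  obtain ⟨w, rfl⟩ := hz
  obtain ⟨j, x, rfl⟩ := exists_limι G w
  exact ⟨j, _, proj_mem _ i x, (limProj_ι G i j x).symm⟩

theorem isInternal_limGr : DirectSum.IsInternal (limGr G) :=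
  isInternal_of_proj _ (fun i => limProj G i) (fun i z => ⟨z, rfl⟩)
    (fun z => by
      obtain ⟨j, x, rfl⟩ := exists_limι G z
      rw [limProj_ι, limProj_ι, ← map_add, proj_add_proj])
    (fun i j hij z hz => by
      obtain ⟨l, x, hx, rfl⟩ := exists_of_mem_limGr G hz
      rw [limProj_ι, proj_of_mem _ _ hx, if_neg hij, map_zero])

instance : DirectSum.Decomposition (limGr G) := (isInternal_limGr G).chooseDecomposition

/-- Every element of the limit comes from one term, on which the structure maps are those of that
term; each axiom is the image of the same axiom there. -/
instance : Coalgebra k (LimCarrier G) where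
  comul := limComul G
  counit := limCounit G
  coassoc := LinearMap.ext fun z => by
    obtain ⟨j, x, rfl⟩ := exists_limι G z
    have h1 : (limComul G).rTensor _ ∘ₗ TensorProduct.map (limι G j) (limι G j) =
        TensorProduct.map (TensorProduct.map (limι G j) (limι G j)) (limι G j) ∘ₗ
          (Coalgebra.comul (R := k)).rTensor _ :=
      TensorProduct.ext' fun a b => congrArg (· ⊗ₜ[k] limι G j b) (limComul_ι G j a)
    have h2 : (limComul G).lTensor _ ∘ₗ TensorProduct.map (limι G j) (limι G j) =
        TensorProduct.map (limι G j) (TensorProduct.map (limι G j) (limι G j)) ∘ₗ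
          (Coalgebra.comul (R := k)).lTensor _ :=
      TensorProduct.ext' fun a b => congrArg (limι G j a ⊗ₜ[k] ·) (limComul_ι G j b)
    have h3 : (TensorProduct.assoc k _ _ _).toLinearMap ∘ₗ
        TensorProduct.map (TensorProduct.map (limι G j) (limι G j)) (limι G j) =
        TensorProduct.map (limι G j) (TensorProduct.map (limι G j) (limι G j)) ∘ₗ
          (TensorProduct.assoc k _ _ _).toLinearMap :=
      TensorProduct.ext_threefold fun a b c => rfl
    simp only [LinearMap.comp_apply, limComul_ι]
    refine (congrArg _ (LinearMap.congr_fun h1 _)).trans ?_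
    refine (LinearMap.congr_fun h3 _).trans ?_
    refine Eq.trans ?_ (LinearMap.congr_fun h2 _).symm
    exact congrArg _ (LinearMap.congr_fun Coalgebra.coassoc x)
  rTensor_counit_comp_comul := LinearMap.ext fun z => by
    obtain ⟨j, x, rfl⟩ := exists_limι G z
    have h1 : (limCounit G).rTensor _ ∘ₗ TensorProduct.map (limι G j) (limι G j) =
        (limι G j).lTensor _ ∘ₗ (Coalgebra.counit (R := k)).rTensor _ :=
      TensorProduct.ext' fun a b => congrArg (· ⊗ₜ[k] limι G j b) (limCounit_ι G j a)
    simp only [LinearMap.comp_apply, limComul_ι]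
    refine (LinearMap.congr_fun h1 _).trans ?_
    exact (congrArg _ (Coalgebra.rTensor_counit_comul x)).trans rfl
  lTensor_counit_comp_comul := LinearMap.ext fun z => by
    obtain ⟨j, x, rfl⟩ := exists_limι G z
    have h1 : (limCounit G).lTensor _ ∘ₗ TensorProduct.map (limι G j) (limι G j) =
        (limι G j).rTensor _ ∘ₗ (Coalgebra.counit (R := k)).lTensor _ :=
      TensorProduct.ext' fun a b => congrArg (limι G j a ⊗ₜ[k] ·) (limCounit_ι G j b)
    simp only [LinearMap.comp_apply, limComul_ι]
    refine (LinearMap.congr_fun h1 _).trans ?_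
    exact (congrArg _ (Coalgebra.lTensor_counit_comul x)).trans rfl

theorem proj_limι (j : J) (i : ZMod 2) (x : (G.obj j).carrier) :
    limι G j (proj (G.obj j).gr i x) = proj (limGr G) i (limι G j x) :=
  map_proj _ _ (limι_mem G j) i x

/-- The direct limit of a directed system of super-coalgebras. -/
def lim : SCoalg k where
  carrier := LimCarrier G
  gr := limGr G
  comul_mem i c hc := by
    obtain ⟨j, x, hx, rfl⟩ := exists_of_mem_limGr G hc
    change limComul G _ ∈ _
    rw [limComul_ι]
    exact map_mem_tensorGr (limι_mem G j) (limι_mem G j) ((G.obj j).comul_mem i x hx)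
  counit_odd c hc := by
    obtain ⟨j, x, hx, rfl⟩ := exists_of_mem_limGr G hc
    exact (limCounit_ι G j x).trans ((G.obj j).counit_odd x hx)
  cocomm := LinearMap.ext fun c => by
    obtain ⟨j, x, rfl⟩ := exists_limι G c
    change twist _ _ (limComul G _) = limComul G _
    rw [limComul_ι, twist_map (G.obj j).gr _ _ (proj_limι G j)]
    exact congrArg _ (LinearMap.congr_fun (G.obj j).cocomm x)

/-- The canonical morphisms to the direct limit. -/
def toLim (j : J) : G.obj j ⟶ lim G where
  toCoalgHom :=
    { limι G j with
      counit_comp := LinearMap.ext (limCounit_ι G j)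
      map_comp_comul := LinearMap.ext fun x => (limComul_ι G j x).symm }
  map_gr := limι_mem G j

end SCoalg

/-- The system of duals of a system of finite-dimensional superalgebras. -/
def dualSystem {J : Type u} [Preorder J] (A : J ⥤ (SAlgf k)ᵒᵖ) : J ⥤ SCoalg k where
  obj j := dualSCoalg (A.obj j).unop
  map h := dualHom (A.map h).unop
  map_id j := by rw [A.map_id]; exact dualHom_id _
  map_comp f g := by rw [A.map_comp]; exact dualHom_comp _ _

/-- Take C to be the direct limit of the duals A_j*. Surjectivity of A_μ → A_λ makes their
transition maps injective, so C is the union of the A_j*, and Sp* C has the same presentation as X.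
-/
theorem exists_SpStar_iso (X : SFFunt k) (hX : IsFormalSuperscheme k X) :
    ∃ C, Nonempty ((SpStar k).obj C ≅ X) := by
  obtain ⟨J, _, _, _, A, hA, ⟨Q⟩⟩ := (isFormalSuperscheme_iff X).1 hX
  have hinj : ∀ (i j : J) (h : i ⟶ j),
      Function.Injective ((dualSystem A).map h).toCoalgHom := fun i j h =>
    LinearMap.dualMap_injective_of_surjective
      (f := (A.map h).unop.hom.toAlgHom.toLinearMap) (hA i j h)
  let S : DualSystem (SCoalg.lim (dualSystem A)) A :=
    { ι := SCoalg.toLim (dualSystem A)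
      injective := SCoalg.limι_injective (dualSystem A) hinj
      compat := fun i j h => SCoalg.hom_ext (SCoalg.limι_map (dualSystem A) h)
      cover := SCoalg.exists_limι (dualSystem A) }
  exact ⟨_, ⟨S.presentation.iso Q⟩⟩

theorem isEquivalence_SpStar (h2 : (2 : k) ≠ 0)
    (h : ∀ C : SCoalg k, IsFormalSuperscheme k ((SpStar k).obj C)) :
    ((IsFormalSuperscheme k).lift (SpStar k) h).IsEquivalence := by
  have := SpStar_faithful h2
  have := SpStar_full h2
  exact
    { essSurj := ⟨fun X => by
        obtain ⟨C, ⟨e⟩⟩ := exists_SpStar_iso X.obj X.property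
        exact ⟨C, ⟨(IsFormalSuperscheme k).isoMk e⟩⟩⟩ }

end DirectLimits

end SuperGeom

end

theorem theorem1p2 (k : Type u) [Field k] (hk : ringChar k ≠ 2) :
    -- (i) `A ↦ PSSpf A` is an anti-equivalence
    (∃ h : ∀ A : (SuperGeom.PSAlg k)ᵒᵖ,
        SuperGeom.IsFormalSuperscheme k ((SuperGeom.PSSpf k).obj A),
      ((SuperGeom.IsFormalSuperscheme k).lift (SuperGeom.PSSpf k) h :
        (SuperGeom.PSAlg k)ᵒᵖ ⥤ SuperGeom.FormalSuperscheme k).IsEquivalence) ∧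
    -- (ii) `SSpf A ≅ Sp* A*`
    (∀ A : SuperGeom.SAlgf k,
      Nonempty ((SuperGeom.SSpf k).obj (Opposite.op A) ≅
        (SuperGeom.SpStar k).obj (SuperGeom.dualSCoalg A))) ∧
    -- (iii) the functor `C ↦ Sp* C` is an equivalence onto formal superschemes
    (∃ h : ∀ C : SuperGeom.SCoalg k,
        SuperGeom.IsFormalSuperscheme k ((SuperGeom.SpStar k).obj C),
      ((SuperGeom.IsFormalSuperscheme k).lift (SuperGeom.SpStar k) h :
        SuperGeom.SCoalg k ⥤ SuperGeom.FormalSuperscheme k).IsEquivalence) ∧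
    -- (iv) formal superschemes are the formal functors that commute with finite limits
    (∀ X : SuperGeom.SFFunt k,
      SuperGeom.IsFormalSuperscheme k X ↔ Limits.PreservesFiniteLimits X) := by
  have h2 : (2 : k) ≠ 0 := Ring.two_ne_zero hk
  exact ⟨⟨SuperGeom.PSAlg.isFormalSuperscheme_PSSpf, SuperGeom.PSAlg.isEquivalence_PSSpf _⟩,
    SuperGeom.nonempty_SSpf_iso_SpStar_dual,
    ⟨SuperGeom.isFormalSuperscheme_SpStar h2, SuperGeom.isEquivalence_SpStar h2 _⟩,
    SuperGeom.isFormalSuperscheme_iff_preservesFiniteLimits⟩
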